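/- Let $\mathcal X_1,\mathcal X_2,\mathcal Y_1,\mathcal Y_2,\mathcal Z$ be finite sets and let $P_{Y_1Y_2Z|X_1X_2}$ be the transition law of a discrete memoryless two-way wiretap channel: for $i=1,2$, User $i$ has input alphabet $\mathcal X_i$ and output alphabet $\mathcal Y_i$, and the eavesdropper has output alphabet $\mathcal Z$. There is no cost constraint. Logarithms are natural. **Codes.** A non-adaptive code $\mathcal C_n$ of length $n$ with decoders of the 2nd type consists of message sets $\mathcal M_1,\mathcal M_2$ of finite sizes $|\mathcal M_i|=e^{nR_{i,n}}\ge 1$, stochastic encoders $P_{X_i^n|M_i}$ from $\mathcal M_i$ to $\mathcal X_i^n$, and decoders $\psi_1:\mathcal X_1^n\times\mathcal Y_1^n\to\mathcal M_2$ and $\psi_2:\mathcal X_2^n\times\mathcal Y_2^n\to\mathcal M_1$. The messages $M_1,M_2$ are independent and uniform, and the words $(Y_1^n,Y_2^n,Z^n)$ are produced from $(X_1^n,X_2^n)$ by $n$ independent uses of the channel. Let $$P_e^n(\mathcal C_n)=\frac1{|\mathcal M_1||\mathcal M_2|}\sum_{m_1,m_2}\Pr\{\psi_2(X_2^n,Y_2^n)\ne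 m_1\ \text{or}\ \psi_1(X_1^n,Y_1^n)\ne m_2\mid M_1=m_1,M_2=m_2\}.$$ Let $\mathcal C_{J,S,N,2}$ be the set of pairs $(R_1,R_2)\in\mathbb R^2$ for which there is a sequence of such codes $(\mathcal C_n)_n$ with $R_{i,n}\to R_i$ for $i=1,2$, $P_e^n(\mathcal C_n)\le\epsilon_n\to0$ and $I(M_1,M_2;Z^n|\mathcal C_n)\le\tau_n\to 0$ (strong joint secrecy). Let $\mathcal C_{I,S,N,2}$ be defined in the same way with the last condition replaced by $I(M_1;Z^n|\mathcal C_n)\le\tau_n$ and $I(M_2;Z^n|\mathcal C_n)\le\tau_n$, $\tau_n\to0$ (strong individual secrecy). **Regions.** Let $\mathcal Q$ be the set of joint laws $P_{V_1V_2X_1X_2}=P_{V_1}P_{X_1|V_1}P_{V_2}P_{X_2|V_2}$, where the auxiliary variables $V_1,V_2$ take values in arbitrary finite sets. For $P\in\mathcal Q$, with $(Y_1,Y_2,Z)$ the channel output for the input $(X_1,X_2)$, let $\mathcal R_{J,N}(P)$ be the set of pairs $R_1,R_2\ge0$ with $$R_1\le I(Y_2;V_1|X_2)-I(Z;V_1),\qquad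 R_2\le I(Y_1;V_2|X_1)-I(Z;V_2),$$ $$R_1+R_2\le I(Y_2;V_1|X_2)+I(Y_1;V_2|X_1)-I(V_1,V_2;Z),$$ and let $\mathcal R_{I,N}(P)$ be the set of pairs $R_1,R_2\ge0$ that satisfy the first two inequalities and $$\max\{R_1,R_2\}\le I(Y_2;V_1|X_2)+I(Y_1;V_2|X_1)-I(V_1,V_2;Z).$$ Let $\mathcal R_{J,N}$ and $\mathcal R_{I,N}$ be the closures of the convex hulls of $\bigcup_{P\in\mathcal Q}\mathcal R_{J,N}(P)$ and $\bigcup_{P\in\mathcal Q}\mathcal R_{I,N}(P)$, respectively. **Theorem.** $\mathcal R_{J,N}\subset\mathcal C_{J,S,N,2}$ and $\mathcal R_{I,N}\subset\mathcal C_{I,S,N,2}$. -/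

import Mathlib

open scoped Topology
open Filter

noncomputable section

namespace TwoWayWiretap

/-! ### Finite random variables and (conditional) mutual information, in nats -/

section Information

variable {Ω α β γ : Type*} [Fintype Ω] [Fintype α] [Fintype β] [Fintype γ]

open Classical in
/-- The probability mass function of the random variable `A`, when the finite sample space `Ω`
carries the probability mass function `P`. -/
def law (P : Ω → ℝ) (A : Ω → α) (a : α) : ℝ :=
  ∑ ω, if A ω = a then P ω else 0

/-- The mutual information `I(A;B)` under `P`. A term with `P(a,b) = 0` vanishes (`0 log 0 = 0`). -/
def mutualInfo (P : Ω → ℝ) (A : Ω → α) (B : Ω → β) : ℝ :=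
  ∑ a, ∑ b, law P (fun ω => (A ω, B ω)) (a, b) *
    Real.log (law P (fun ω => (A ω, B ω)) (a, b) / (law P A a * law P B b))

/-- The conditional mutual information `I(A;B|C)` under `P`, i.e. the sum of
`P(a,b,c) log (P(a,b|c) / (P(a|c) P(b|c)))`. -/
def condMutualInfo (P : Ω → ℝ) (A : Ω → α) (B : Ω → β) (C : Ω → γ) : ℝ :=
  ∑ a, ∑ b, ∑ c, law P (fun ω => (A ω, B ω, C ω)) (a, b, c) *
    Real.log ((law P (fun ω => (A ω, B ω, C ω)) (a, b, c) / law P C c) /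
      ((law P (fun ω => (A ω, C ω)) (a, c) / law P C c) *
        (law P (fun ω => (B ω, C ω)) (b, c) / law P C c)))

end Information

/-- A discrete memoryless two-way wiretap channel, given by its one-use transition law
`P_{Y₁ Y₂ Z | X₁ X₂}`. -/
abbrev Channel (X₁ X₂ Y₁ Y₂ Z : Type*) [Fintype Y₁] [Fintype Y₂] [Fintype Z] : Type _ :=
  X₁ → X₂ → stdSimplex ℝ (Y₁ × Y₂ × Z)

/-! ### Rate regions -/

section Regions

variable {V₁ V₂ X₁ X₂ Y₁ Y₂ Z : Type*}
variable [Fintype V₁] [Fintype V₂] [Fintype X₁] [Fintype X₂] [Fintype Y₁] [Fintype Y₂] [Fintype Z]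

/-- The set of product laws `P_{V₁} P_{X₁|V₁} P_{V₂} P_{X₂|V₂}`. -/
def productLaws (V₁ V₂ X₁ X₂ : Type*) [Fintype V₁] [Fintype V₂] [Fintype X₁] [Fintype X₂] :
    Set (V₁ × V₂ × X₁ × X₂ → ℝ) :=
  {P | ∃ (p₁ : stdSimplex ℝ V₁) (k₁ : V₁ → stdSimplex ℝ X₁)
      (p₂ : stdSimplex ℝ V₂) (k₂ : V₂ → stdSimplex ℝ X₂),
      ∀ v₁ v₂ x₁ x₂, P (v₁, v₂, x₁, x₂) =
        (p₁.1 v₁ * (k₁ v₁).1 x₁) * (p₂.1 v₂ * (k₂ v₂).1 x₂)}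

/-- The joint law of `((V₁, V₂, X₁, X₂), (Y₁, Y₂, Z))` when the law `P` of `(V₁, V₂, X₁, X₂)` is
followed by one use of the channel. -/
def letterLaw (W : Channel X₁ X₂ Y₁ Y₂ Z) (P : V₁ × V₂ × X₁ × X₂ → ℝ) :
    (V₁ × V₂ × X₁ × X₂) × (Y₁ × Y₂ × Z) → ℝ :=
  fun ω => P ω.1 * (W ω.1.2.2.1 ω.1.2.2.2).1 ω.2

/-- `I(Y₂;V₁|X₂)` -/
def infoY₂V₁ (W : Channel X₁ X₂ Y₁ Y₂ Z) (P : V₁ × V₂ × X₁ × X₂ → ℝ) : ℝ :=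
  condMutualInfo (letterLaw W P) (fun ω => ω.2.2.1) (fun ω => ω.1.1) (fun ω => ω.1.2.2.2)

/-- `I(Y₁;V₂|X₁)` -/
def infoY₁V₂ (W : Channel X₁ X₂ Y₁ Y₂ Z) (P : V₁ × V₂ × X₁ × X₂ → ℝ) : ℝ :=
  condMutualInfo (letterLaw W P) (fun ω => ω.2.1) (fun ω => ω.1.2.1) (fun ω => ω.1.2.2.1)

/-- `I(Z;V₁)` -/
def infoZV₁ (W : Channel X₁ X₂ Y₁ Y₂ Z) (P : V₁ × V₂ × X₁ × X₂ → ℝ) : ℝ :=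
  mutualInfo (letterLaw W P) (fun ω => ω.2.2.2) (fun ω => ω.1.1)

/-- `I(Z;V₂)` -/
def infoZV₂ (W : Channel X₁ X₂ Y₁ Y₂ Z) (P : V₁ × V₂ × X₁ × X₂ → ℝ) : ℝ :=
  mutualInfo (letterLaw W P) (fun ω => ω.2.2.2) (fun ω => ω.1.2.1)

/-- `I(V₁,V₂;Z)` -/
def infoV₁V₂Z (W : Channel X₁ X₂ Y₁ Y₂ Z) (P : V₁ × V₂ × X₁ × X₂ → ℝ) : ℝ :=
  mutualInfo (letterLaw W P) (fun ω => (ω.1.1, ω.1.2.1)) (fun ω => ω.2.2.2)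

/-- The region `R_{J,N}(P_{V₁ V₂ X₁ X₂})`. -/
def regionJAt (W : Channel X₁ X₂ Y₁ Y₂ Z) (P : V₁ × V₂ × X₁ × X₂ → ℝ) : Set (ℝ × ℝ) :=
  {R | 0 ≤ R.1 ∧ 0 ≤ R.2 ∧
    R.1 ≤ infoY₂V₁ W P - infoZV₁ W P ∧
    R.2 ≤ infoY₁V₂ W P - infoZV₂ W P ∧
    R.1 + R.2 ≤ infoY₂V₁ W P + infoY₁V₂ W P - infoV₁V₂Z W P}

/-- The region `R_{I,N}(P_{V₁ V₂ X₁ X₂})`. -/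
def regionIAt (W : Channel X₁ X₂ Y₁ Y₂ Z) (P : V₁ × V₂ × X₁ × X₂ → ℝ) : Set (ℝ × ℝ) :=
  {R | 0 ≤ R.1 ∧ 0 ≤ R.2 ∧
    R.1 ≤ infoY₂V₁ W P - infoZV₁ W P ∧
    R.2 ≤ infoY₁V₂ W P - infoZV₂ W P ∧
    max R.1 R.2 ≤ infoY₁V₂ W P + infoY₂V₁ W P - infoV₁V₂Z W P}

/-- The region `R_{J,N}`: closure of the convex hull of the union over all product laws, with
arbitrary finite alphabets (up to relabelling, `Fin k₁` and `Fin k₂`) for `V₁` and `V₂`. -/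
def regionJ (W : Channel X₁ X₂ Y₁ Y₂ Z) : Set (ℝ × ℝ) :=
  closure (convexHull ℝ (⋃ (k₁ : ℕ) (k₂ : ℕ),
    ⋃ P ∈ productLaws (Fin k₁) (Fin k₂) X₁ X₂, regionJAt W P))

/-- The region `R_{I,N}`: closure of the convex hull of the union over all product laws. -/
def regionI (W : Channel X₁ X₂ Y₁ Y₂ Z) : Set (ℝ × ℝ) :=
  closure (convexHull ℝ (⋃ (k₁ : ℕ) (k₂ : ℕ),
    ⋃ P ∈ productLaws (Fin k₁) (Fin k₂) X₁ X₂, regionIAt W P))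

end Regions

/-! ### Codes and achievability -/

/-- A non-adaptive secrecy code of length `n` with decoders of the 2nd type: User `i` has a message
set of size `Mᵢ`, encodes its message stochastically into a whole input word, and decodes the
message of the other user from its own input word and its own output word. -/
structure Code (X₁ X₂ Y₁ Y₂ : Type*) [Fintype X₁] [Fintype X₂] (n : ℕ) where
  M₁ : ℕ
  M₂ : ℕ
  M₁_pos : 0 < M₁
  M₂_pos : 0 < M₂
  enc₁ : Fin M₁ → stdSimplex ℝ (Fin n → X₁)
  enc₂ : Fin M₂ → stdSimplex ℝ (Fin n → X₂)
  dec₁ : (Fin n → X₁) → (Fin n → Y₁) → Fin M₂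
  dec₂ : (Fin n → X₂) → (Fin n → Y₂) → Fin M₁

namespace Code

variable {X₁ X₂ Y₁ Y₂ Z : Type*}
variable [Fintype X₁] [Fintype X₂] [Fintype Y₁] [Fintype Y₂] [Fintype Z] {n : ℕ}

/-- The rate `R₁` (in nats per channel use), so that `M₁ = exp (n R₁)` for `n > 0`. -/
def rate₁ (C : Code X₁ X₂ Y₁ Y₂ n) : ℝ := Real.log C.M₁ / n

/-- The rate `R₂` (in nats per channel use), so that `M₂ = exp (n R₂)` for `n > 0`. -/
def rate₂ (C : Code X₁ X₂ Y₁ Y₂ n) : ℝ := Real.log C.M₂ / n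

/-- The conditional probability of `(x₁ⁿ, x₂ⁿ, y₁ⁿ, y₂ⁿ, zⁿ)` given the messages `m₁, m₂`. -/
def condLaw (W : Channel X₁ X₂ Y₁ Y₂ Z) (C : Code X₁ X₂ Y₁ Y₂ n) (m₁ : Fin C.M₁) (m₂ : Fin C.M₂)
    (x₁ : Fin n → X₁) (x₂ : Fin n → X₂) (y₁ : Fin n → Y₁) (y₂ : Fin n → Y₂) (z : Fin n → Z) : ℝ :=
  (C.enc₁ m₁).1 x₁ * (C.enc₂ m₂).1 x₂ * ∏ t, (W (x₁ t) (x₂ t)).1 (y₁ t, y₂ t, z t)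

/-- The joint law of `((M₁, M₂), (X₁ⁿ, X₂ⁿ, Y₁ⁿ, Y₂ⁿ, Zⁿ))`, with independent, uniformly
distributed messages. -/
def jointLaw (W : Channel X₁ X₂ Y₁ Y₂ Z) (C : Code X₁ X₂ Y₁ Y₂ n) :
    (Fin C.M₁ × Fin C.M₂) ×
      ((Fin n → X₁) × (Fin n → X₂) × (Fin n → Y₁) × (Fin n → Y₂) × (Fin n → Z)) → ℝ :=
  fun ω => 1 / (C.M₁ : ℝ) * (1 / (C.M₂ : ℝ)) *
    C.condLaw W ω.1.1 ω.1.2 ω.2.1 ω.2.2.1 ω.2.2.2.1 ω.2.2.2.2.1 ω.2.2.2.2.2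

/-- The average probability that at least one of the two messages is decoded wrongly. -/
def errorProb (W : Channel X₁ X₂ Y₁ Y₂ Z) (C : Code X₁ X₂ Y₁ Y₂ n) : ℝ :=
  1 / ((C.M₁ : ℝ) * (C.M₂ : ℝ)) * ∑ m₁, ∑ m₂, ∑ x₁, ∑ x₂, ∑ y₁, ∑ y₂, ∑ z,
    if m₁ ≠ C.dec₂ x₂ y₂ ∨ m₂ ≠ C.dec₁ x₁ y₁ then C.condLaw W m₁ m₂ x₁ x₂ y₁ y₂ z else 0

/-- `I(M₁,M₂;Zⁿ)` -/
def leakJoint (W : Channel X₁ X₂ Y₁ Y₂ Z) (C : Code X₁ X₂ Y₁ Y₂ n) : ℝ :=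
  mutualInfo (C.jointLaw W) (fun ω => ω.1) (fun ω => ω.2.2.2.2.2)

/-- `I(M₁;Zⁿ)` -/
def leak₁ (W : Channel X₁ X₂ Y₁ Y₂ Z) (C : Code X₁ X₂ Y₁ Y₂ n) : ℝ :=
  mutualInfo (C.jointLaw W) (fun ω => ω.1.1) (fun ω => ω.2.2.2.2.2)

/-- `I(M₂;Zⁿ)` -/
def leak₂ (W : Channel X₁ X₂ Y₁ Y₂ Z) (C : Code X₁ X₂ Y₁ Y₂ n) : ℝ :=
  mutualInfo (C.jointLaw W) (fun ω => ω.1.2) (fun ω => ω.2.2.2.2.2)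

end Code

section Capacity

variable {X₁ X₂ Y₁ Y₂ Z : Type*}
variable [Fintype X₁] [Fintype X₂] [Fintype Y₁] [Fintype Y₂] [Fintype Z]

/-- `C_{J,S,N,2}`: the rate pairs that are achievable under the strong joint secrecy constraint by
non-adaptive codes with the 2nd type decoder. -/
def capacityJ (W : Channel X₁ X₂ Y₁ Y₂ Z) : Set (ℝ × ℝ) :=
  {R | ∃ (C : ∀ n : ℕ, Code X₁ X₂ Y₁ Y₂ n) (ε τ : ℕ → ℝ),
    Tendsto (fun n => (C n).rate₁) atTop (𝓝 R.1) ∧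
    Tendsto (fun n => (C n).rate₂) atTop (𝓝 R.2) ∧
    (∀ n, (C n).errorProb W ≤ ε n) ∧
    (∀ n, (C n).leakJoint W ≤ τ n) ∧
    Tendsto ε atTop (𝓝 0) ∧ Tendsto τ atTop (𝓝 0)}

/-- `C_{I,S,N,2}`: the rate pairs that are achievable under the strong individual secrecy
constraint by non-adaptive codes with the 2nd type decoder. -/
def capacityI (W : Channel X₁ X₂ Y₁ Y₂ Z) : Set (ℝ × ℝ) :=
  {R | ∃ (C : ∀ n : ℕ, Code X₁ X₂ Y₁ Y₂ n) (ε τ : ℕ → ℝ),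
    Tendsto (fun n => (C n).rate₁) atTop (𝓝 R.1) ∧
    Tendsto (fun n => (C n).rate₂) atTop (𝓝 R.2) ∧
    (∀ n, (C n).errorProb W ≤ ε n) ∧
    (∀ n, (C n).leak₁ W ≤ τ n) ∧
    (∀ n, (C n).leak₂ W ≤ τ n) ∧
    Tendsto ε atTop (𝓝 0) ∧ Tendsto τ atTop (𝓝 0)}

end Capacity

end TwoWayWiretap

end

noncomputable section

namespace TwoWayWiretap

/-! ### Random codebooks -/

section Codebook

variable {A B U U₁ U₂ : Type*} [Fintype A] [Fintype B] [Fintype U] [Fintype U₁] [Fintype U₂]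

/-! The proof is by random coding. User `i` draws `Mᵢ Lᵢ` independent codewords from the law of the
word `Vᵢⁿ`, arranged in `Mᵢ` rows. A message selects a row, the encoder picks one of the `Lᵢ`
codewords of that row uniformly at random, and this codeword passes through the kernel from `Vᵢ` to
`Xᵢ`. Write `rᵢ` and `rᵢ'` for the exponential rates of `Mᵢ` and `Lᵢ`.

Reliability. The receiver's own input is independent of the other user's codeword, so it counts as
part of the channel output, and `I(V₁; X₂, Y₂) = I(Y₂; V₁ | X₂)` (`condMutualInfo_eq_channelInfo`).
A likelihood-ratio threshold test, averaged over the codebooks, has small error when `r₁ + r₁' <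
I(Y₂; V₁ | X₂)`, and symmetrically for the other direction
(`codeMean_codeMean_thresholdDecoder_le`).

Secrecy. The leakage is at most the mean divergence between the law of `Zⁿ` given the message and
any fixed reference law whose zeros are zeros of all these conditional laws
(`mutualInfo_le_sum_divergence`). Given both messages, `Zⁿ` is the output of a multiple access
channel driven by uniformly chosen codewords from two rows. Soft covering (`codeMean_divergence_le`)
brings this law close to the i.i.d. one when `r₁' > I(V₁; Z)`, `r₂' > I(V₂; Z)` and `r₁' + r₂' >
I(V₁, V₂; Z)`. For individual secrecy the whole codebook of the other user acts as randomness, so in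
the bound on `I(M₁; Zⁿ)` the rate `r₂'` is replaced by `r₂ + r₂'`; symmetrically for `I(M₂; Zⁿ)`.

Exponents. Both bounds are expressed through the moments `E exp(s i)` of information densities `i`.
These factor over the letters (`moment_eq_prod`), equal 1 at `s = 0`, and have the mutual
information as derivative there (`hasDerivAt_moment`). Each strict rate inequality therefore gives a
factor `ρⁿ` with `ρ < 1` for every small `s > 0`, and one `s` serves all the inequalities.

Convex hull and closure. A convex combination of rate pairs is handled by drawing the single-letter
law of each position independently with the given weights. The moments are then averaged, their
derivatives at 0 become the averaged informations, and a good deterministic sequence of laws is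
fixed at the end. Closedness is built into `approxAchievable`, from which actual code sequences are
extracted.

Choice of rates. `exists_rate_of_le` puts `rᵢ + rᵢ'` just below the decodable rate. If the target
rate is nearly zero, this may leave no room for `rᵢ'` above `I(Vᵢ; Z)`; then a single message is
used, decoding is vacuous, and `rᵢ'` may be arbitrarily large. -/

open Classical in
/-- The mean of `F c` over random codebooks `c : A → U` with independent codewords of law `p`. -/
def codeMean (p : U → ℝ) (F : (A → U) → ℝ) : ℝ := ∑ c : A → U, (∏ a, p (c a)) * F c

lemma codeMean_add (p : U → ℝ) (F G : (A → U) → ℝ) :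
    codeMean p (fun c => F c + G c) = codeMean p F + codeMean p G := by
  simp only [codeMean, mul_add, Finset.sum_add_distrib]

lemma codeMean_const_mul (p : U → ℝ) (r : ℝ) (F : (A → U) → ℝ) :
    codeMean p (fun c => r * F c) = r * codeMean p F := by
  simp only [codeMean, Finset.mul_sum]
  exact Finset.sum_congr rfl fun c _ => by ring

lemma codeMean_sum {ι : Type*} (p : U → ℝ) (s : Finset ι) (F : ι → (A → U) → ℝ) :
    codeMean p (fun c => ∑ i ∈ s, F i c) = ∑ i ∈ s, codeMean p (F i) := by
  simp only [codeMean, Finset.mul_sum]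
  exact Finset.sum_comm

lemma codeMean_mono (p : stdSimplex ℝ U) {F G : (A → U) → ℝ} (h : ∀ c, F c ≤ G c) :
    codeMean p.1 F ≤ codeMean p.1 G :=
  Finset.sum_le_sum fun c _ =>
    mul_le_mul_of_nonneg_left (h c) (Finset.prod_nonneg fun _ _ => p.2.1 _)

lemma codeMean_const (p : stdSimplex ℝ U) (r : ℝ) : codeMean p.1 (fun _ : A → U => r) = r := by
  classical
  have h := Fintype.prod_sum (fun (_ : A) (u : U) => p.1 u)
  simp only [p.2.2, Finset.prod_const_one] at h
  rw [codeMean, ← Finset.sum_mul]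
  convert one_mul r
  convert h.symm

/-- Exchanging the codeword at `a` with an independent fresh sample is a weight-preserving
involution on pairs (sample, codebook). This is the device for conditioning on one codeword while
still averaging over the others. -/
lemma codeMean_update [DecidableEq A] (p : stdSimplex ℝ U) (F : (A → U) → ℝ) (a : A) :
    codeMean p.1 F = ∑ u, p.1 u * codeMean p.1 (fun c => F (Function.update c a u)) := by
  have key : ∑ x : U × (A → U), p.1 x.1 * ((∏ b, p.1 (x.2 b)) * F (Function.update x.2 a x.1)) =
      ∑ x : U × (A → U), p.1 x.1 * ((∏ b, p.1 (x.2 b)) * F x.2) := by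
    refine Finset.sum_nbij' (fun x => (x.2 a, Function.update x.2 a x.1))
      (fun x => (x.2 a, Function.update x.2 a x.1)) ?_ ?_ ?_ ?_ ?_
    · simp
    · simp
    · rintro ⟨u, c⟩ -; simp
    · rintro ⟨u, c⟩ -; simp
    · rintro ⟨u, c⟩ -
      have h1 := Finset.mul_prod_erase Finset.univ (fun b => p.1 (c b)) (Finset.mem_univ a)
      have h2 := Finset.mul_prod_erase Finset.univ (fun b => p.1 (Function.update c a u b))
        (Finset.mem_univ a)
      have h3 : ∏ b ∈ Finset.univ.erase a, p.1 (Function.update c a u b) =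
          ∏ b ∈ Finset.univ.erase a, p.1 (c b) :=
        Finset.prod_congr rfl fun b hb => by
          rw [Function.update_of_ne (Finset.ne_of_mem_erase hb)]
      simp only [Function.update_self] at h2
      simp only
      rw [← h1, ← h2, h3]
      ring
  simp only [Fintype.sum_prod_type, ← Finset.mul_sum, ← Finset.sum_mul, p.2.2, one_mul] at key
  simp only [codeMean]
  convert key.symm

lemma codeMean_apply (p : stdSimplex ℝ U) (f : U → ℝ) (a : A) :
    codeMean p.1 (fun c => f (c a)) = ∑ u, p.1 u * f u := by
  classical
  rw [codeMean_update p _ a]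
  simp only [Function.update_self, codeMean_const]

/-- The first-moment method, restricted to codebooks of positive weight. The support condition is
needed later: it makes the induced output laws absolutely continuous with respect to the reference
law, so that their divergences are nonnegative. -/
lemma exists_of_codeMean_le (p : stdSimplex ℝ U) {F : (A → U) → ℝ} {r : ℝ}
    (h : codeMean p.1 F ≤ r) : ∃ c, (∀ a, 0 < p.1 (c a)) ∧ F c ≤ r := by
  classical
  by_contra! hc
  have hpos : ∀ c : A → U, 0 ≤ ∏ a, p.1 (c a) := fun c => Finset.prod_nonneg fun a _ => p.2.1 _
  have h1 : codeMean p.1 (fun _ : A → U => (1 : ℝ)) = 1 := codeMean_const p 1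
  obtain ⟨c, hc0⟩ : ∃ c : A → U, 0 < ∏ a, p.1 (c a) := by
    by_contra! h0
    have : codeMean p.1 (fun _ : A → U => (1 : ℝ)) ≤ 0 :=
      Finset.sum_nonpos fun c _ => by simpa using h0 c
    linarith
  have hsupp : ∀ c : A → U, 0 < ∏ a, p.1 (c a) → ∀ a, 0 < p.1 (c a) := fun c hc a =>
    lt_of_le_of_ne (p.2.1 _) fun h0 => hc.ne' (Finset.prod_eq_zero (Finset.mem_univ a) h0.symm)
  have h2 : codeMean p.1 (fun _ : A → U => r) < codeMean p.1 F := by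
    refine Finset.sum_lt_sum (fun d _ => ?_) ⟨c, Finset.mem_univ _, ?_⟩
    · rcases (hpos d).eq_or_lt with h0 | h0
      · rw [← h0]; simp
      · exact mul_le_mul_of_nonneg_left (hc d (hsupp d h0)).le h0.le
    · exact mul_lt_mul_of_pos_left (hc c (hsupp c hc0)) hc0
  rw [codeMean_const] at h2
  linarith

end Codebook

/-! ### Divergence and moments of the information density -/

section Moments

variable {U O : Type*} [Fintype U] [Fintype O]

/-- The divergence `D(P ‖ Q)`, in nats. -/
def divergence (P Q : O → ℝ) : ℝ := ∑ o, P o * Real.log (P o / Q o)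

/-- This is `1 - 1/t ≤ log t` at `t = x / y`. The hypothesis on zeros excludes the convention `x / 0
= 0`, under which the logarithmic term would vanish instead of being infinite. -/
lemma sub_le_mul_log_div {x y : ℝ} (hx : 0 ≤ x) (hy : 0 ≤ y) (h : y = 0 → x = 0) :
    x - y ≤ x * Real.log (x / y) := by
  rcases hx.eq_or_lt with rfl | hx
  · simpa using hy
  · have hy' : 0 < y := lt_of_le_of_ne hy fun h0 => hx.ne' (h h0.symm)
    have h1 := Real.one_sub_inv_le_log_of_pos (div_pos hx hy')
    have h2 := mul_le_mul_of_nonneg_left h1 hx.le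
    have h3 : x * (1 - (x / y)⁻¹) = x - y := by field_simp
    linarith

lemma divergence_nonneg {P Q : O → ℝ} (hP : ∀ o, 0 ≤ P o) (hQ : ∀ o, 0 ≤ Q o)
    (hs : ∑ o, P o = ∑ o, Q o) (h : ∀ o, Q o = 0 → P o = 0) : 0 ≤ divergence P Q := by
  have : ∑ o, (P o - Q o) ≤ divergence P Q :=
    Finset.sum_le_sum fun o _ => sub_le_mul_log_div (hP o) (hQ o) (h o)
  rw [Finset.sum_sub_distrib, hs, sub_self] at this
  exact this

/-- The output law of the channel `G` for the input law `p`. -/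
def outLaw (p : U → ℝ) (G : U → O → ℝ) (o : O) : ℝ := ∑ u, p u * G u o

/-- The mean of `exp (s i)`, where `i` is the information density of the input law `p` and
the channel `G`. -/
def moment (p : U → ℝ) (G : U → O → ℝ) (s : ℝ) : ℝ :=
  ∑ u, ∑ o, p u * G u o * (G u o / outLaw p G o) ^ s

/-- The mutual information of the input and the output of the channel `G` for the input law `p`. -/
def channelInfo (p : U → ℝ) (G : U → O → ℝ) : ℝ :=
  ∑ u, ∑ o, p u * G u o * Real.log (G u o / outLaw p G o)

lemma outLaw_nonneg {p : U → ℝ} {G : U → O → ℝ} (hp : ∀ u, 0 ≤ p u) (hG : ∀ u o, 0 ≤ G u o)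
    (o : O) : 0 ≤ outLaw p G o :=
  Finset.sum_nonneg fun u _ => mul_nonneg (hp u) (hG u o)

lemma mul_le_outLaw {p : U → ℝ} {G : U → O → ℝ} (hp : ∀ u, 0 ≤ p u) (hG : ∀ u o, 0 ≤ G u o)
    (u : U) (o : O) : p u * G u o ≤ outLaw p G o :=
  Finset.single_le_sum (f := fun u => p u * G u o) (fun u _ => mul_nonneg (hp u) (hG u o))
    (Finset.mem_univ u)

lemma sum_outLaw {p : U → ℝ} {G : U → O → ℝ} (hp : ∑ u, p u = 1) (hG : ∀ u, ∑ o, G u o = 1) :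
    ∑ o, outLaw p G o = 1 := by
  simp only [outLaw]
  rw [Finset.sum_comm]
  simp only [← Finset.mul_sum, hG, mul_one, hp]

lemma moment_nonneg {p : U → ℝ} {G : U → O → ℝ} (hp : ∀ u, 0 ≤ p u) (hG : ∀ u o, 0 ≤ G u o)
    (s : ℝ) : 0 ≤ moment p G s :=
  Finset.sum_nonneg fun u _ => Finset.sum_nonneg fun o _ => mul_nonneg (mul_nonneg (hp u) (hG u o))
    (Real.rpow_nonneg (div_nonneg (hG u o) (outLaw_nonneg hp hG o)) s)

lemma moment_zero {p : U → ℝ} {G : U → O → ℝ} (hp : ∑ u, p u = 1) (hG : ∀ u, ∑ o, G u o = 1) :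
    moment p G 0 = 1 := by
  simp only [moment, Real.rpow_zero, mul_one, ← Finset.mul_sum, hG, hp]

/-- Differentiating `E exp(s i)` at `s = 0` gives `E i`. Pairs of weight zero contribute a constant,
and on all others the likelihood ratio is positive. This is where mutual information enters the
error exponents. -/
lemma hasDerivAt_moment {p : U → ℝ} {G : U → O → ℝ} (hp : ∀ u, 0 ≤ p u)
    (hG : ∀ u o, 0 ≤ G u o) : HasDerivAt (moment p G) (channelInfo p G) 0 := by
  unfold moment channelInfo
  refine HasDerivAt.fun_sum fun u _ => HasDerivAt.fun_sum fun o _ => ?_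
  rcases (mul_nonneg (hp u) (hG u o)).eq_or_lt with h0 | h0
  · simp only [← h0, zero_mul]
    exact hasDerivAt_const _ _
  · have hpos : 0 < G u o / outLaw p G o :=
      div_pos (pos_of_mul_pos_right h0 (hp u)) (h0.trans_le (mul_le_outLaw hp hG u o))
    have := ((hasDerivAt_id (0 : ℝ)).const_rpow hpos).const_mul (p u * G u o)
    simpa using this

lemma channelInfo_nonneg {p : U → ℝ} {G : U → O → ℝ} (hp : ∀ u, 0 ≤ p u)
    (hp1 : ∑ u, p u = 1) (hG : ∀ u o, 0 ≤ G u o) (hG1 : ∀ u, ∑ o, G u o = 1) :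
    0 ≤ channelInfo p G := by
  have : ∑ u, ∑ o, p u * (G u o - outLaw p G o) ≤ channelInfo p G := by
    refine Finset.sum_le_sum fun u _ => Finset.sum_le_sum fun o _ => ?_
    rcases (hp u).eq_or_lt with h0 | h0
    · simp [← h0]
    · rw [mul_assoc]
      refine mul_le_mul_of_nonneg_left (sub_le_mul_log_div (hG u o) (outLaw_nonneg hp hG o)
        fun h => ?_) h0.le
      have := mul_le_outLaw hp hG u o
      rw [h] at this
      nlinarith [hG u o]
  simpa [← Finset.mul_sum, Finset.sum_sub_distrib, hG1, sum_outLaw hp1 hG1] using this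

/-- The output law of a product channel with product input is a product, hence so is the likelihood
ratio, and the sum over words factors. The alphabets may vary with the position, as time sharing
requires, and the two equivalences absorb reorderings such as words of pairs against pairs of words.
-/
lemma moment_eq_prod {ι U' O' : Type*} [Fintype ι] [Fintype U'] [Fintype O'] {V : ι → Type*}
    {Y : ι → Type*} [∀ i, Fintype (V i)] [∀ i, Fintype (Y i)] (eU : (∀ i, V i) ≃ U')
    (eO : (∀ i, Y i) ≃ O') (p : ∀ i, V i → ℝ) (G : ∀ i, V i → Y i → ℝ) (p' : U' → ℝ)
    (G' : U' → O' → ℝ) (hp : ∀ i v, 0 ≤ p i v) (hG : ∀ i v y, 0 ≤ G i v y)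
    (hp' : ∀ v, p' (eU v) = ∏ i, p i (v i)) (hG' : ∀ v y, G' (eU v) (eO y) = ∏ i, G i (v i) (y i))
    (s : ℝ) : moment p' G' s = ∏ i, moment (p i) (G i) s := by
  classical
  have hout : ∀ y, outLaw p' G' (eO y) = ∏ i, outLaw (p i) (G i) (y i) := by
    intro y
    simp only [outLaw]
    rw [Fintype.prod_sum, ← eU.sum_comp]
    exact Finset.sum_congr rfl fun v _ => by rw [hp', hG', Finset.prod_mul_distrib]
  simp only [moment]
  rw [Fintype.prod_sum, ← eU.sum_comp]
  refine Finset.sum_congr rfl fun v _ => ?_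
  rw [Fintype.prod_sum, ← eO.sum_comp]
  refine Finset.sum_congr rfl fun y _ => ?_
  rw [hp', hG', hout, Finset.prod_mul_distrib, Finset.prod_mul_distrib,
    Real.finsetProd_rpow _ _ fun i _ => div_nonneg (hG _ _ _) (outLaw_nonneg (hp _) (hG _) _),
    Finset.prod_div_distrib]

end Moments

/-! ### Soft covering for the multiple access channel -/

section SoftCovering

variable {A B U₁ U₂ Z : Type*} [Fintype A] [Fintype B] [Fintype U₁] [Fintype U₂] [Fintype Z]

lemma add_rpow_le_rpow_add_rpow {x y s : ℝ} (hx : 0 ≤ x) (hy : 0 ≤ y) (hs : 0 ≤ s) (hs1 : s ≤ 1) :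
    (x + y) ^ s ≤ x ^ s + y ^ s := by
  have := NNReal.rpow_add_le_add_rpow ⟨x, hx⟩ ⟨y, hy⟩ hs hs1
  exact_mod_cast this

/-- Apply `log t ≤ t - 1` to the `s`-th power of the argument and use that `t ↦ t ^ s` is
subadditive for `s ≤ 1`. The logarithm is thereby replaced by powers, whose means factor over
letters. -/
lemma log_one_add_add_add_le {x y z s : ℝ} (hx : 0 ≤ x) (hy : 0 ≤ y) (hz : 0 ≤ z) (hs : 0 < s)
    (hs1 : s ≤ 1) : Real.log (1 + x + y + z) ≤ s⁻¹ * (x ^ s + y ^ s + z ^ s) := by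
  have hpos : 0 < 1 + x + y + z := by positivity
  have h1 := Real.log_le_sub_one_of_pos (Real.rpow_pos_of_pos hpos s)
  rw [Real.log_rpow hpos] at h1
  have h2 : (1 + x + y + z) ^ s ≤ 1 + x ^ s + y ^ s + z ^ s := by
    calc (1 + x + y + z) ^ s ≤ (1 + x + y) ^ s + z ^ s :=
          add_rpow_le_rpow_add_rpow (by positivity) hz hs.le hs1
      _ ≤ (1 + x) ^ s + y ^ s + z ^ s := by
          gcongr; exact add_rpow_le_rpow_add_rpow (by positivity) hy hs.le hs1
      _ ≤ 1 + x ^ s + y ^ s + z ^ s := by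
          gcongr; simpa using add_rpow_le_rpow_add_rpow zero_le_one hx hs.le hs1
  rw [inv_mul_eq_div, le_div_iff₀ hs]
  linarith

/-- The law of the output when the inputs are uniform on the codewords of `c₁` and `c₂` with indices
in `S` and `T`. -/
def inducedLaw (H : U₁ → U₂ → Z → ℝ) (S : Finset A) (T : Finset B) (c₁ : A → U₁) (c₂ : B → U₂)
    (z : Z) : ℝ := ((S.card : ℝ) * T.card)⁻¹ * ∑ a ∈ S, ∑ b ∈ T, H (c₁ a) (c₂ b) z

variable (p₁ : stdSimplex ℝ U₁) (p₂ : stdSimplex ℝ U₂) {H : U₁ → U₂ → Z → ℝ}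

open Classical in
-- With the codewords at `a` and `b` frozen, the pair `(a', b')` shares both of them, only the
-- first, only the second, or neither. Each case is computed exactly by independence; the inequality
-- arises only because the four nonnegative expressions are added instead of being selected.
lemma codeMean_update_update_le (hH : ∀ u₁ u₂ z, 0 ≤ H u₁ u₂ z) (a a' : A) (b b' : B)
    (u₁ : U₁) (u₂ : U₂) (z : Z) :
    codeMean p₁.1 (fun c₁ : A → U₁ => codeMean p₂.1 fun c₂ : B → U₂ =>
      H (Function.update c₁ a u₁ a') (Function.update c₂ b u₂ b') z) ≤
    (if a' = a then if b' = b then H u₁ u₂ z else 0 else 0) +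
      (if a' = a then ∑ v, p₂.1 v * H u₁ v z else 0) +
      (if b' = b then ∑ v, p₁.1 v * H v u₂ z else 0) +
      ∑ v, p₁.1 v * ∑ w, p₂.1 w * H v w z := by
  have h0 : 0 ≤ ∑ v, p₂.1 v * H u₁ v z :=
    Finset.sum_nonneg fun v _ => mul_nonneg (p₂.2.1 v) (hH _ _ _)
  have h1 : 0 ≤ ∑ v, p₁.1 v * H v u₂ z :=
    Finset.sum_nonneg fun v _ => mul_nonneg (p₁.2.1 v) (hH _ _ _)
  have h2 : 0 ≤ ∑ v, p₁.1 v * ∑ w, p₂.1 w * H v w z :=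
    Finset.sum_nonneg fun v _ => mul_nonneg (p₁.2.1 v)
      (Finset.sum_nonneg fun w _ => mul_nonneg (p₂.2.1 w) (hH _ _ _))
  by_cases ha : a' = a
  · subst ha
    by_cases hb : b' = b
    · subst hb
      simp only [Function.update_self, codeMean_const, if_true]
      linarith
    · simp only [Function.update_self, codeMean_const, Function.update_of_ne hb, if_true, hb,
        if_false, codeMean_apply p₂ (fun v => H u₁ v z) b']
      linarith
  · by_cases hb : b' = b
    · subst hb
      simp only [Function.update_self, codeMean_const, Function.update_of_ne ha, if_true, ha,
        if_false, codeMean_apply p₁ (fun v => H v u₂ z) a']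
      linarith
    · simp only [Function.update_of_ne ha, Function.update_of_ne hb, ha, hb, if_false]
      rw [codeMean_apply p₁ (fun v => codeMean p₂.1 fun c₂ : B → U₂ => H v (c₂ b') z) a']
      simp only [fun v => codeMean_apply p₂ (fun w => H v w z) b']
      linarith

open Classical in
-- Among the `|S| |T|` index pairs, one has both frozen indices, `|T|` have the first and `|S|` have
-- the second; dividing by `|S| |T|` gives the three coefficients.
lemma codeMean_inducedLaw_update_le (hH : ∀ u₁ u₂ z, 0 ≤ H u₁ u₂ z) {S : Finset A} {T : Finset B}
    {a : A} {b : B} (ha : a ∈ S) (hb : b ∈ T) (u₁ : U₁) (u₂ : U₂) (z : Z) :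
    codeMean p₁.1 (fun c₁ : A → U₁ => codeMean p₂.1 fun c₂ : B → U₂ =>
      inducedLaw H S T (Function.update c₁ a u₁) (Function.update c₂ b u₂) z) ≤
    (∑ v, p₁.1 v * ∑ w, p₂.1 w * H v w z) + ((S.card : ℝ) * T.card)⁻¹ * H u₁ u₂ z +
      (S.card : ℝ)⁻¹ * (∑ v, p₂.1 v * H u₁ v z) + (T.card : ℝ)⁻¹ * ∑ v, p₁.1 v * H v u₂ z := by
  have hS : (0 : ℝ) < S.card := by exact_mod_cast Finset.card_pos.2 ⟨a, ha⟩
  have hT : (0 : ℝ) < T.card := by exact_mod_cast Finset.card_pos.2 ⟨b, hb⟩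
  simp only [inducedLaw, codeMean_const_mul, codeMean_sum]
  calc _ ≤ ((S.card : ℝ) * T.card)⁻¹ * ∑ a' ∈ S, ∑ b' ∈ T,
        ((if a' = a then if b' = b then H u₁ u₂ z else 0 else 0) +
      (if a' = a then ∑ v, p₂.1 v * H u₁ v z else 0) +
      (if b' = b then ∑ v, p₁.1 v * H v u₂ z else 0) +
      ∑ v, p₁.1 v * ∑ w, p₂.1 w * H v w z) := by
        gcongr with a' _ b' _
        exact codeMean_update_update_le p₁ p₂ hH a a' b b' u₁ u₂ z
    _ = _ := by
        have e : ∀ x y : ℝ, ∑ a' ∈ S, ∑ b' ∈ T, (if a' = a then if b' = b then x else 0 else 0) = x ∧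
            ∑ a' ∈ S, ∑ _b' ∈ T, (if a' = a then y else 0) = T.card * y ∧
            ∑ _a' ∈ S, ∑ b' ∈ T, (if b' = b then y else 0) = S.card * y := by
          intro x y
          simp [Finset.sum_ite_irrel, ha, hb]
        simp only [Finset.sum_add_distrib]
        rw [(e _ 0).1, (e 0 _).2.1, (e 0 _).2.2]
        simp only [Finset.sum_const, nsmul_eq_mul]
        field_simp
        ring

/-- Jensen's inequality for the logarithm, obtained by averaging its tangent line at `y`; an upper
bound `y` on the mean suffices. -/
lemma codeMean_log_div_le {X : (A → U₁) → (B → U₂) → ℝ} {y Q : ℝ} (hX : ∀ c₁ c₂, 0 < X c₁ c₂)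
    (hy : codeMean p₁.1 (fun c₁ => codeMean p₂.1 fun c₂ => X c₁ c₂) ≤ y) (hy0 : 0 < y)
    (hQ : 0 < Q) :
    codeMean p₁.1 (fun c₁ => codeMean p₂.1 fun c₂ => Real.log (X c₁ c₂ / Q)) ≤
      Real.log (y / Q) := by
  have hpt : ∀ c₁ c₂, Real.log (X c₁ c₂ / Q) ≤ (Real.log (y / Q) - 1) + y⁻¹ * X c₁ c₂ := by
    intro c₁ c₂
    have h := Real.log_le_sub_one_of_pos (div_pos (hX c₁ c₂) hy0)
    rw [Real.log_div (hX c₁ c₂).ne' hy0.ne'] at h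
    rw [Real.log_div (hX c₁ c₂).ne' hQ.ne', Real.log_div hy0.ne' hQ.ne', inv_mul_eq_div]
    linarith
  have h1 := codeMean_mono p₁ fun c₁ => codeMean_mono p₂ fun c₂ => hpt c₁ c₂
  simp only [codeMean_add, codeMean_const_mul, codeMean_const] at h1
  have h2 := mul_le_mul_of_nonneg_left hy (inv_nonneg.2 hy0.le)
  rw [inv_mul_cancel₀ hy0.ne'] at h2
  linarith

lemma log_div_le_rpow {Q h h₁ h₂ N₁ N₂ s : ℝ} (hQ : 0 < Q) (h0 : 0 ≤ h) (h1 : 0 ≤ h₁)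
    (h2 : 0 ≤ h₂) (hN₁ : 0 < N₁) (hN₂ : 0 < N₂) (hs : 0 < s) (hs1 : s ≤ 1) :
    Real.log ((Q + (N₁ * N₂)⁻¹ * h + N₁⁻¹ * h₁ + N₂⁻¹ * h₂) / Q) ≤
      s⁻¹ * ((N₁ * N₂) ^ (-s) * (h / Q) ^ s + N₁ ^ (-s) * (h₁ / Q) ^ s +
        N₂ ^ (-s) * (h₂ / Q) ^ s) := by
  have e : (Q + (N₁ * N₂)⁻¹ * h + N₁⁻¹ * h₁ + N₂⁻¹ * h₂) / Q =
      1 + (N₁ * N₂)⁻¹ * (h / Q) + N₁⁻¹ * (h₁ / Q) + N₂⁻¹ * (h₂ / Q) := by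
    field_simp
  have key : ∀ N x : ℝ, 0 < N → 0 ≤ x → (N⁻¹ * (x / Q)) ^ s = N ^ (-s) * (x / Q) ^ s := by
    intro N x hN hx
    rw [Real.mul_rpow (by positivity) (by positivity), Real.inv_rpow hN.le, Real.rpow_neg hN.le]
  rw [e, ← key _ _ (mul_pos hN₁ hN₂) h0, ← key _ _ hN₁ h1, ← key _ _ hN₂ h2]
  exact log_one_add_add_add_le (by positivity) (by positivity) (by positivity) hs hs1

lemma inducedLaw_update_pos [DecidableEq A] [DecidableEq B]
    (hH : ∀ u₁ u₂ z, 0 ≤ H u₁ u₂ z) {S : Finset A} {T : Finset B}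
    {a : A} {b : B} (ha : a ∈ S) (hb : b ∈ T) {u₁ : U₁} {u₂ : U₂} {z : Z} (hpos : 0 < H u₁ u₂ z)
    (c₁ : A → U₁) (c₂ : B → U₂) :
    0 < inducedLaw H S T (Function.update c₁ a u₁) (Function.update c₂ b u₂) z := by
  have hS : (0 : ℝ) < S.card := by exact_mod_cast Finset.card_pos.2 ⟨a, ha⟩
  have hT : (0 : ℝ) < T.card := by exact_mod_cast Finset.card_pos.2 ⟨b, hb⟩
  refine mul_pos (by positivity) ?_
  refine Finset.sum_pos' (fun a' _ => Finset.sum_nonneg fun b' _ => hH _ _ _) ⟨a, ha, ?_⟩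
  refine Finset.sum_pos' (fun b' _ => hH _ _ _) ⟨b, hb, ?_⟩
  simpa using hpos

/-- The channel from the first input to the output, when the second input has the law `p₂`. -/
def leftChannel (p₂ : U₂ → ℝ) (H : U₁ → U₂ → Z → ℝ) (u₁ : U₁) (z : Z) : ℝ :=
  ∑ u₂, p₂ u₂ * H u₁ u₂ z

/-- The channel from the second input to the output, when the first input has the law `p₁`. -/
def rightChannel (p₁ : U₁ → ℝ) (H : U₁ → U₂ → Z → ℝ) (u₂ : U₂) (z : Z) : ℝ :=
  ∑ u₁, p₁ u₁ * H u₁ u₂ z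

/-- The mean of `exp (s i)`, where `i` is the information density between both inputs and
the output. -/
def pairMoment (p₁ : U₁ → ℝ) (p₂ : U₂ → ℝ) (H : U₁ → U₂ → Z → ℝ) (s : ℝ) : ℝ :=
  moment (fun u : U₁ × U₂ => p₁ u.1 * p₂ u.2) (fun u z => H u.1 u.2 z) s

/-- The output law of the two-input channel `H` for independent inputs. -/
def pairOutLaw (p₁ : U₁ → ℝ) (p₂ : U₂ → ℝ) (H : U₁ → U₂ → Z → ℝ) : Z → ℝ :=
  outLaw (fun u : U₁ × U₂ => p₁ u.1 * p₂ u.2) (fun u z => H u.1 u.2 z)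

lemma pairOutLaw_eq (p₁ : U₁ → ℝ) (p₂ : U₂ → ℝ) (H : U₁ → U₂ → Z → ℝ) (z : Z) :
    pairOutLaw p₁ p₂ H z = ∑ v, p₁ v * ∑ w, p₂ w * H v w z := by
  simp only [pairOutLaw, outLaw, Fintype.sum_prod_type, Finset.mul_sum, mul_assoc]

lemma outLaw_leftChannel (p₁ : U₁ → ℝ) (p₂ : U₂ → ℝ) (H : U₁ → U₂ → Z → ℝ) :
    outLaw p₁ (leftChannel p₂ H) = pairOutLaw p₁ p₂ H := by
  ext z
  simp only [pairOutLaw_eq, outLaw, leftChannel]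

lemma outLaw_rightChannel (p₁ : U₁ → ℝ) (p₂ : U₂ → ℝ) (H : U₁ → U₂ → Z → ℝ) :
    outLaw p₂ (rightChannel p₁ H) = pairOutLaw p₁ p₂ H := by
  ext z
  simp only [pairOutLaw_eq, outLaw, rightChannel, Finset.mul_sum]
  rw [Finset.sum_comm]
  exact Finset.sum_congr rfl fun v _ => Finset.sum_congr rfl fun w _ => by ring

open Classical in
lemma codeMean_log_inducedLaw_update_le
    (hH : ∀ u₁ u₂ z, 0 ≤ H u₁ u₂ z) {S : Finset A} {T : Finset B}
    {a : A} {b : B} (ha : a ∈ S) (hb : b ∈ T) {u₁ : U₁} {u₂ : U₂} {z : Z} {s : ℝ} (hs : 0 < s)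
    (hs1 : s ≤ 1) (hQ : 0 < pairOutLaw p₁.1 p₂.1 H z) (hpos : 0 < H u₁ u₂ z) :
    codeMean p₁.1 (fun c₁ : A → U₁ => codeMean p₂.1 fun c₂ : B → U₂ =>
      Real.log (inducedLaw H S T (Function.update c₁ a u₁) (Function.update c₂ b u₂) z /
        pairOutLaw p₁.1 p₂.1 H z)) ≤
    s⁻¹ * (((S.card : ℝ) * T.card) ^ (-s) * (H u₁ u₂ z / pairOutLaw p₁.1 p₂.1 H z) ^ s +
      (S.card : ℝ) ^ (-s) * (leftChannel p₂.1 H u₁ z / pairOutLaw p₁.1 p₂.1 H z) ^ s +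
      (T.card : ℝ) ^ (-s) * (rightChannel p₁.1 H u₂ z / pairOutLaw p₁.1 p₂.1 H z) ^ s) := by
  have hS : (0 : ℝ) < S.card := by exact_mod_cast Finset.card_pos.2 ⟨a, ha⟩
  have hT : (0 : ℝ) < T.card := by exact_mod_cast Finset.card_pos.2 ⟨b, hb⟩
  have h1 : 0 ≤ leftChannel p₂.1 H u₁ z :=
    Finset.sum_nonneg fun v _ => mul_nonneg (p₂.2.1 v) (hH _ _ _)
  have h2 : 0 ≤ rightChannel p₁.1 H u₂ z :=
    Finset.sum_nonneg fun v _ => mul_nonneg (p₁.2.1 v) (hH _ _ _)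
  have hmean := codeMean_inducedLaw_update_le p₁ p₂ hH ha hb u₁ u₂ z
  rw [← pairOutLaw_eq] at hmean
  refine (codeMean_log_div_le p₁ p₂ (inducedLaw_update_pos hH ha hb hpos) hmean ?_ hQ).trans
    (log_div_le_rpow hQ hpos.le h1 h2 hS hT hs hs1)
  change 0 < pairOutLaw p₁.1 p₂.1 H z + _ * H u₁ u₂ z + _ * leftChannel p₂.1 H u₁ z +
    _ * rightChannel p₁.1 H u₂ z
  positivity

/-- The bound on the mean divergence of soft covering with `N₁` and `N₂` codewords. -/
def coveringBound (p₁ : U₁ → ℝ) (p₂ : U₂ → ℝ) (H : U₁ → U₂ → Z → ℝ) (s N₁ N₂ : ℝ) : ℝ :=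
  s⁻¹ * ((N₁ * N₂) ^ (-s) * pairMoment p₁ p₂ H s + N₁ ^ (-s) * moment p₁ (leftChannel p₂ H) s +
    N₂ ^ (-s) * moment p₂ (rightChannel p₁ H) s)

/-- Soft covering. The factor in front of the logarithm is an average over index pairs `(a, b)`. For
each pair, the two codewords that generate `z` are frozen and Jensen's inequality moves the mean
over the other codewords inside the logarithm. What remains is `log (1 + ...)` with one term per
kind of collision, and each term becomes a moment of an information density. -/
theorem codeMean_divergence_le (hH : ∀ u₁ u₂ z, 0 ≤ H u₁ u₂ z) {S : Finset A} {T : Finset B}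
    (hS : S.Nonempty) (hT : T.Nonempty) {s : ℝ} (hs : 0 < s) (hs1 : s ≤ 1) :
    codeMean p₁.1 (fun c₁ : A → U₁ => codeMean p₂.1 fun c₂ : B → U₂ =>
      divergence (inducedLaw H S T c₁ c₂) (pairOutLaw p₁.1 p₂.1 H)) ≤
    coveringBound p₁.1 p₂.1 H s S.card T.card := by
  classical
  have hS0 : (0 : ℝ) < S.card := by exact_mod_cast Finset.card_pos.2 hS
  have hT0 : (0 : ℝ) < T.card := by exact_mod_cast Finset.card_pos.2 hT
  have hterm : ∀ a ∈ S, ∀ b ∈ T, codeMean p₁.1 (fun c₁ : A → U₁ => codeMean p₂.1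
      fun c₂ : B → U₂ => ∑ z, H (c₁ a) (c₂ b) z *
        Real.log (inducedLaw H S T c₁ c₂ z / pairOutLaw p₁.1 p₂.1 H z)) ≤
      coveringBound p₁.1 p₂.1 H s S.card T.card := by
    intro a ha b hb
    -- Resampling at `a` and then at `b` makes the generating pair of codewords explicit, so the
    -- factor `H` leaves the mean and only the logarithm is averaged.
    have e1 : codeMean p₁.1 (fun c₁ : A → U₁ => codeMean p₂.1
      fun c₂ : B → U₂ => ∑ z, H (c₁ a) (c₂ b) z *
        Real.log (inducedLaw H S T c₁ c₂ z / pairOutLaw p₁.1 p₂.1 H z)) =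
        ∑ u₁, ∑ u₂, ∑ z, p₁.1 u₁ * p₂.1 u₂ * H u₁ u₂ z *
          codeMean p₁.1 (fun c₁ : A → U₁ => codeMean p₂.1 fun c₂ : B → U₂ =>
            Real.log (inducedLaw H S T (Function.update c₁ a u₁) (Function.update c₂ b u₂) z /
              pairOutLaw p₁.1 p₂.1 H z)) := by
      rw [codeMean_update p₁ _ a]
      refine Finset.sum_congr rfl fun u₁ _ => ?_
      refine (congrArg (fun x => p₁.1 u₁ * codeMean p₁.1 x)
        (funext fun c₁ => codeMean_update p₂ _ b)).trans ?_
      simp only [Function.update_self, codeMean_sum, codeMean_const_mul, Finset.mul_sum]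
      exact Finset.sum_congr rfl fun u₂ _ => Finset.sum_congr rfl fun z _ => by ring
    -- All three moments are rewritten as means over the same triple `(u₁, u₂, z)`, so that the
    -- comparison can be made pointwise.
    have e2 : coveringBound p₁.1 p₂.1 H s S.card T.card =
        ∑ u₁, ∑ u₂, ∑ z, p₁.1 u₁ * p₂.1 u₂ * H u₁ u₂ z *
          (s⁻¹ * (((S.card : ℝ) * T.card) ^ (-s) * (H u₁ u₂ z / pairOutLaw p₁.1 p₂.1 H z) ^ s +
            (S.card : ℝ) ^ (-s) * (leftChannel p₂.1 H u₁ z / pairOutLaw p₁.1 p₂.1 H z) ^ s +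
            (T.card : ℝ) ^ (-s) * (rightChannel p₁.1 H u₂ z / pairOutLaw p₁.1 p₂.1 H z) ^ s)) := by
      have m0 : pairMoment p₁.1 p₂.1 H s = ∑ u₁, ∑ u₂, ∑ z, p₁.1 u₁ * p₂.1 u₂ * H u₁ u₂ z *
          (H u₁ u₂ z / pairOutLaw p₁.1 p₂.1 H z) ^ s := by
        simp only [pairMoment, moment, Fintype.sum_prod_type, pairOutLaw]
      have m1 : moment p₁.1 (leftChannel p₂.1 H) s =
          ∑ u₁, ∑ u₂, ∑ z, p₁.1 u₁ * p₂.1 u₂ * H u₁ u₂ z *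
          (leftChannel p₂.1 H u₁ z / pairOutLaw p₁.1 p₂.1 H z) ^ s := by
        simp only [moment, outLaw_leftChannel]
        refine Finset.sum_congr rfl fun u₁ _ => ?_
        rw [Finset.sum_comm]
        refine Finset.sum_congr rfl fun z _ => ?_
        rw [← Finset.sum_mul]
        congr 1
        simp only [leftChannel, Finset.mul_sum, mul_assoc]
      have m2 : moment p₂.1 (rightChannel p₁.1 H) s =
          ∑ u₁, ∑ u₂, ∑ z, p₁.1 u₁ * p₂.1 u₂ * H u₁ u₂ z *
          (rightChannel p₁.1 H u₂ z / pairOutLaw p₁.1 p₂.1 H z) ^ s := by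
        simp only [moment, outLaw_rightChannel]
        conv_rhs => rw [Finset.sum_comm]
        refine Finset.sum_congr rfl fun u₂ _ => ?_
        rw [Finset.sum_comm]
        refine Finset.sum_congr rfl fun z _ => ?_
        rw [← Finset.sum_mul]
        congr 1
        simp only [rightChannel, Finset.mul_sum]
        exact Finset.sum_congr rfl fun u₁ _ => by ring
      rw [coveringBound, m0, m1, m2]
      simp only [Finset.mul_sum, ← Finset.sum_add_distrib]
      exact Finset.sum_congr rfl fun u₁ _ => Finset.sum_congr rfl fun u₂ _ =>
        Finset.sum_congr rfl fun z _ => by ring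
    rw [e1, e2]
    refine Finset.sum_le_sum fun u₁ _ => Finset.sum_le_sum fun u₂ _ => Finset.sum_le_sum fun z _ => ?_
    have hw : 0 ≤ p₁.1 u₁ * p₂.1 u₂ * H u₁ u₂ z :=
      mul_nonneg (mul_nonneg (p₁.2.1 _) (p₂.2.1 _)) (hH _ _ _)
    rcases hw.eq_or_lt with h0 | h0
    · simp [← h0]
    · refine mul_le_mul_of_nonneg_left ?_ hw
      have hQ : 0 < pairOutLaw p₁.1 p₂.1 H z :=
        h0.trans_le (mul_le_outLaw (p := fun u : U₁ × U₂ => p₁.1 u.1 * p₂.1 u.2)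
          (G := fun u z => H u.1 u.2 z) (fun u => mul_nonneg (p₁.2.1 _) (p₂.2.1 _))
          (fun u z => hH _ _ _) (u₁, u₂) z)
      have hpos := pos_of_mul_pos_right h0 (mul_nonneg (p₁.2.1 _) (p₂.2.1 _))
      exact codeMean_log_inducedLaw_update_le p₁ p₂ hH ha hb hs hs1 hQ hpos
  have e : ∀ (c₁ : A → U₁) (c₂ : B → U₂),
      divergence (inducedLaw H S T c₁ c₂) (pairOutLaw p₁.1 p₂.1 H) =
      ((S.card : ℝ) * T.card)⁻¹ * ∑ a ∈ S, ∑ b ∈ T, ∑ z, H (c₁ a) (c₂ b) z *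
        Real.log (inducedLaw H S T c₁ c₂ z / pairOutLaw p₁.1 p₂.1 H z) := by
    intro c₁ c₂
    rw [divergence]
    have : ∀ z, inducedLaw H S T c₁ c₂ z *
        Real.log (inducedLaw H S T c₁ c₂ z / pairOutLaw p₁.1 p₂.1 H z) =
        ((S.card : ℝ) * T.card)⁻¹ * ∑ a ∈ S, ∑ b ∈ T, H (c₁ a) (c₂ b) z *
        Real.log (inducedLaw H S T c₁ c₂ z / pairOutLaw p₁.1 p₂.1 H z) := by
      intro z
      simp only [← Finset.sum_mul]
      rw [← mul_assoc]
      rfl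
    simp only [this, ← Finset.mul_sum]
    congr 1
    rw [Finset.sum_comm]
    exact Finset.sum_congr rfl fun a _ => Finset.sum_comm
  simp only [e, codeMean_const_mul, codeMean_sum] at hterm ⊢
  calc _ ≤ ((S.card : ℝ) * T.card)⁻¹ * ∑ a ∈ S, ∑ b ∈ T,
        coveringBound p₁.1 p₂.1 H s S.card T.card := by
        refine mul_le_mul_of_nonneg_left ?_ (by positivity)
        exact Finset.sum_le_sum fun a ha => Finset.sum_le_sum fun b hb => hterm a ha b hb
    _ = _ := by
        simp only [Finset.sum_const, nsmul_eq_mul]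
        field_simp

end SoftCovering

/-! ### Threshold decoding -/

section Decoding

variable {M L B U U' X Y O : Type*} [Fintype M] [Fintype L] [Fintype B] [Fintype U] [Fintype U']
  [Fintype X] [Fintype Y] [Fintype O]

open Classical in
/-- The decoder that outputs a message one of whose codewords has a likelihood ratio above `θ`. -/
def thresholdDecoder [Nonempty M] (G : U → O → ℝ) (q : O → ℝ) (θ : ℝ) (c : M × L → U) (o : O) : M :=
  if h : ∃ m l, θ * q o < G (c (m, l)) o then h.choose else Classical.arbitrary M

open Classical in
-- If the sent codeword passes the test, the decoder returns the message of some passing codeword,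
-- so an error forces a passing codeword in another row. Several passing codewords of the correct
-- row do no harm.
lemma thresholdDecoder_error_le [Nonempty M] [DecidableEq M] (G : U → O → ℝ) (q : O → ℝ) (θ : ℝ) (c : M × L → U)
    (o : O) (m : M) (l : L) :
    (if thresholdDecoder G q θ c o ≠ m then (1 : ℝ) else 0) ≤
      (if G (c (m, l)) o ≤ θ * q o then 1 else 0) +
        ∑ i : M × L, if i.1 ≠ m then if θ * q o < G (c i) o then 1 else 0 else 0 := by
  have hsum : ∀ i ∈ (Finset.univ : Finset (M × L)),
      (0 : ℝ) ≤ if i.1 ≠ m then if θ * q o < G (c i) o then 1 else 0 else 0 := by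
    intro i _
    split_ifs <;> norm_num
  by_cases hm : G (c (m, l)) o ≤ θ * q o
  · rw [if_pos hm]
    have := Finset.sum_nonneg hsum
    split_ifs <;> linarith
  · rw [if_neg hm, zero_add]
    split_ifs with hd
    · have hex : ∃ m l, θ * q o < G (c (m, l)) o := ⟨m, l, not_le.1 hm⟩
      have hdec : thresholdDecoder G q θ c o = hex.choose := dif_pos hex
      obtain ⟨l', hl'⟩ := hex.choose_spec
      rw [hdec] at hd
      have := Finset.single_le_sum hsum (Finset.mem_univ (hex.choose, l'))
      simpa only [if_pos hd, if_pos hl'] using this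
    · exact Finset.sum_nonneg hsum

/-- The bound on the mean error probability of threshold decoding with `N` codewords. -/
def decodingBound (p : U → ℝ) (G : U → O → ℝ) (s θ N : ℝ) : ℝ :=
  θ ^ s * moment p G (-s) + N / θ

variable (p : stdSimplex ℝ U) {G : U → O → ℝ}

open Classical in
-- Markov's inequality for the power `-s` of the likelihood ratio, which is at least `θ ^ (-s)`
-- whenever the test fails.
lemma sum_missed_le (hG : ∀ u o, 0 ≤ G u o) {s θ : ℝ} (hs : 0 < s) (hθ : 0 < θ) :
    ∑ u, p.1 u * ∑ o, (if G u o ≤ θ * outLaw p.1 G o then G u o else 0) ≤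
      θ ^ s * moment p.1 G (-s) := by
  simp only [moment, Finset.mul_sum]
  refine Finset.sum_le_sum fun u _ => Finset.sum_le_sum fun o _ => ?_
  have hq := outLaw_nonneg (G := G) p.2.1 hG o
  have hw := mul_nonneg (p.2.1 u) (hG u o)
  have hR : 0 ≤ θ ^ s * (p.1 u * G u o * (G u o / outLaw p.1 G o) ^ (-s)) :=
    mul_nonneg (Real.rpow_nonneg hθ.le s)
      (mul_nonneg hw (Real.rpow_nonneg (div_nonneg (hG u o) hq) _))
  split_ifs with h
  · rcases hw.eq_or_lt with h0 | h0
    · rw [← h0] at hR ⊢; simp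
    · have hg : 0 < G u o := pos_of_mul_pos_right h0 (p.2.1 u)
      have hq' : 0 < outLaw p.1 G o := h0.trans_le (mul_le_outLaw p.2.1 hG u o)
      have hr : 0 < G u o / outLaw p.1 G o := div_pos hg hq'
      have h1 : (G u o / outLaw p.1 G o) ^ s ≤ θ ^ s :=
        Real.rpow_le_rpow hr.le ((div_le_iff₀ hq').2 h) hs.le
      have h2 : 1 ≤ θ ^ s * (G u o / outLaw p.1 G o) ^ (-s) := by
        rw [Real.rpow_neg hr.le, ← div_eq_mul_inv, one_le_div (Real.rpow_pos_of_pos hr s)]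
        exact h1
      nlinarith
  · simpa using hR

open Classical in
-- A change of measure: where the test passes, the product weight `p u * q o` is at most `1 / θ`
-- times the joint weight `p u * G u o`.
lemma outLaw_mul_sum_passing_le (hG : ∀ u o, 0 ≤ G u o) {θ : ℝ} (hθ : 0 < θ) (o : O) :
    outLaw p.1 G o * ∑ u, p.1 u * (if θ * outLaw p.1 G o < G u o then 1 else 0) ≤
      outLaw p.1 G o / θ := by
  conv_rhs => rw [outLaw]
  rw [Finset.mul_sum, Finset.sum_div]
  refine Finset.sum_le_sum fun u _ => ?_
  have hw := mul_nonneg (p.2.1 u) (hG u o)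
  split_ifs with h
  · rw [le_div_iff₀ hθ]
    nlinarith [p.2.1 u]
  · simpa using div_nonneg hw hθ.le

open Classical in
-- A codeword of another row is independent of the sent one, hence of the output, so it passes with
-- probability at most `1 / θ`. The union bound runs over the whole codebook.
theorem codeMean_thresholdDecoder_le [Nonempty M] [DecidableEq M] (hG : ∀ u o, 0 ≤ G u o)
    (hG1 : ∀ u, ∑ o, G u o = 1) {s θ : ℝ} (hs : 0 < s) (hθ : 0 < θ) (m : M) (l : L) :
    codeMean p.1 (fun c : M × L → U => ∑ o,
      if thresholdDecoder G (outLaw p.1 G) θ c o ≠ m then G (c (m, l)) o else 0) ≤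
    decodingBound p.1 G s θ (Fintype.card (M × L)) := by
  have hpt : ∀ c : M × L → U, (∑ o,
      if thresholdDecoder G (outLaw p.1 G) θ c o ≠ m then G (c (m, l)) o else 0) ≤
      (∑ o, if G (c (m, l)) o ≤ θ * outLaw p.1 G o then G (c (m, l)) o else 0) +
        ∑ i : M × L, ∑ o, if i.1 ≠ m then
          G (c (m, l)) o * (if θ * outLaw p.1 G o < G (c i) o then 1 else 0) else 0 := by
    intro c
    rw [Finset.sum_comm, ← Finset.sum_add_distrib]
    refine Finset.sum_le_sum fun o _ => ?_
    have h := mul_le_mul_of_nonneg_left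
      (thresholdDecoder_error_le G (outLaw p.1 G) θ c o m l) (hG (c (m, l)) o)
    simpa only [mul_add, Finset.mul_sum, mul_ite, mul_one, mul_zero] using h
  refine (codeMean_mono p hpt).trans ?_
  rw [codeMean_add, decodingBound]
  refine add_le_add ?_ ?_
  · rw [codeMean_apply p
      (fun u => ∑ o, if G u o ≤ θ * outLaw p.1 G o then G u o else 0) (m, l)]
    exact sum_missed_le p hG hs hθ
  · calc _ ≤ ∑ _i : M × L, 1 / θ := by
          rw [codeMean_sum]
          refine Finset.sum_le_sum fun i _ => ?_
          rw [codeMean_sum]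
          calc _ ≤ ∑ o, outLaw p.1 G o / θ := by
                refine Finset.sum_le_sum fun o _ => ?_
                by_cases him : i.1 = m
                · simp only [him, ne_eq, not_true, if_false, codeMean_const]
                  exact div_nonneg (outLaw_nonneg p.2.1 hG o) hθ.le
                · have hne : (m, l) ≠ i := fun h => him (by rw [← h])
                  simp only [ne_eq, him, not_false_eq_true, if_true]
                  -- The competing codeword is resampled; the sent codeword, having a different
                  -- index, then averages to the output law.
                  rw [codeMean_update p _ i]
                  simp only [Function.update_self, Function.update_of_ne hne]
                  refine le_trans (le_of_eq ?_) (outLaw_mul_sum_passing_le p hG hθ o)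
                  rw [Finset.mul_sum]
                  refine Finset.sum_congr rfl fun u _ => ?_
                  simp only [mul_comm (G _ o)]
                  rw [codeMean_const_mul, codeMean_apply p (fun v => G v o) (m, l), outLaw]
                  ring
            _ = 1 / θ := by rw [← Finset.sum_div, sum_outLaw p.2.2 hG1]
    _ = _ := by
          rw [Finset.sum_const, nsmul_eq_mul, Finset.card_univ]
          ring

/-- The channel from a codeword of one user to the input and the output of the other user, whose
codeword has the law `p'` and is mapped to a channel input by `κ`. -/
def sideChannel (p' : U' → ℝ) (κ : U' → X → ℝ) (T : U → X → Y → ℝ) (u : U) (o : X × Y) : ℝ :=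
  outLaw p' κ o.1 * T u o.1 o.2

open Classical in
-- The decoder tests against the sender's codebook `c` and sees the receiver's own input `x`, but
-- does not use the receiver's codebook `c'`. The mean over `c'` therefore only replaces the law of
-- `x` by its marginal, which reduces the claim to a point-to-point channel with output `(x, y)`.
theorem codeMean_codeMean_thresholdDecoder_le [Nonempty M] [DecidableEq M] (p' : stdSimplex ℝ U')
    {κ : U' → X → ℝ} {T : U → X → Y → ℝ} (hκ : ∀ u x, 0 ≤ κ u x) (hκ1 : ∀ u, ∑ x, κ u x = 1)
    (hT : ∀ u x y, 0 ≤ T u x y) (hT1 : ∀ u x, ∑ y, T u x y = 1)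
    {s θ : ℝ} (hs : 0 < s) (hθ : 0 < θ) (m : M) (l : L) (b : B) :
    codeMean p.1 (fun c : M × L → U => codeMean p'.1 fun c' : B → U' => ∑ x, ∑ y,
      if thresholdDecoder (sideChannel p'.1 κ T) (outLaw p.1 (sideChannel p'.1 κ T)) θ c (x, y) ≠ m
        then κ (c' b) x * T (c (m, l)) x y else 0) ≤
    decodingBound p.1 (sideChannel p'.1 κ T) s θ (Fintype.card (M × L)) := by
  refine le_trans (le_of_eq ?_) (codeMean_thresholdDecoder_le p (G := sideChannel p'.1 κ T)
    (fun u o => mul_nonneg (outLaw_nonneg p'.2.1 hκ _) (hT _ _ _)) (fun u => ?_) hs hθ m l)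
  · congr 1
    ext c
    rw [Fintype.sum_prod_type]
    rw [codeMean_sum]
    refine Finset.sum_congr rfl fun x _ => ?_
    rw [codeMean_sum]
    refine Finset.sum_congr rfl fun y _ => ?_
    split_ifs with h
    · simp only [mul_comm (κ _ x)]
      rw [codeMean_const_mul, codeMean_apply p' (fun v => κ v x) b, sideChannel, outLaw]
      ring
    · exact codeMean_const p' 0
  · simp only [Fintype.sum_prod_type, sideChannel, ← Finset.mul_sum, hT1, mul_one]
    exact sum_outLaw p'.2.2 hκ1

end Decoding

/-! ### Leakage -/

section Leakage

variable {Ω α β : Type*} [Fintype Ω] [Fintype α] [Fintype β]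

/-- For uniform `A`, the mean divergence of the conditional laws from `Q` equals the mutual
information plus the divergence of the law of `B` from `Q`, and the latter is nonnegative. -/
lemma mutualInfo_le_sum_divergence {P : Ω → ℝ} {A : Ω → α} {B : Ω → β} {w : ℝ} {K : α → β → ℝ}
    {Q : β → ℝ} (hw : 0 < w) (hw1 : Fintype.card α * w = 1) (hK : ∀ a b, 0 ≤ K a b)
    (hK1 : ∀ a, ∑ b, K a b = 1) (hQ : ∀ b, 0 ≤ Q b) (hQ1 : ∑ b, Q b = 1)
    (hQK : ∀ b, Q b = 0 → ∀ a, K a b = 0)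
    (hAB : ∀ a b, law P (fun ω => (A ω, B ω)) (a, b) = w * K a b) (hA : ∀ a, law P A a = w)
    (hB : ∀ b, law P B b = ∑ a, w * K a b) :
    mutualInfo P A B ≤ w * ∑ a, divergence (K a) Q := by
  have hR : ∀ b, 0 ≤ ∑ a, w * K a b := fun b => Finset.sum_nonneg fun a _ => mul_nonneg hw.le (hK a b)
  have hRle : ∀ a b, w * K a b ≤ ∑ a, w * K a b := fun a b =>
    Finset.single_le_sum (f := fun a => w * K a b) (fun a _ => mul_nonneg hw.le (hK a b))
      (Finset.mem_univ a)
  have hdiv : 0 ≤ divergence (fun b => ∑ a, w * K a b) Q := by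
    refine divergence_nonneg hR hQ ?_ fun b hb => by simp [hQK b hb]
    rw [Finset.sum_comm]
    simp only [← Finset.mul_sum, hK1, hQ1, Finset.sum_const, nsmul_eq_mul, mul_one,
      Finset.card_univ]
    linarith
  obtain ⟨R, hRe⟩ : ∃ R : β → ℝ, ∀ b, ∑ a, w * K a b = R b := ⟨_, fun _ => rfl⟩
  simp only [hRe] at hB hdiv hRle
  have e' : divergence R Q = ∑ a, ∑ b, w * K a b * Real.log (R b / Q b) := by
    rw [divergence, Finset.sum_comm]
    exact Finset.sum_congr rfl fun b _ => by rw [← Finset.sum_mul, hRe]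
  have e : w * ∑ a, divergence (K a) Q = mutualInfo P A B + divergence R Q := by
    rw [e']
    simp only [mutualInfo, divergence, hAB, hA, hB, Finset.mul_sum]
    rw [← Finset.sum_add_distrib]
    refine Finset.sum_congr rfl fun a _ => ?_
    rw [← Finset.sum_add_distrib]
    refine Finset.sum_congr rfl fun b _ => ?_
    rcases (hK a b).eq_or_lt with h0 | h0
    · simp [← h0]
    · have hQb : 0 < Q b := lt_of_le_of_ne (hQ b) fun h => h0.ne' (hQK b h.symm a)
      have hRb : 0 < R b := (mul_pos hw h0).trans_le (hRle a b)
      rw [Real.log_div h0.ne' hQb.ne', Real.log_div (mul_pos hw h0).ne' (mul_pos hw hRb).ne',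
        Real.log_mul hw.ne' h0.ne', Real.log_mul hw.ne' hRb.ne', Real.log_div hRb.ne' hQb.ne']
      ring
  rw [e]
  exact le_add_of_nonneg_right hdiv

end Leakage

/-! ### Marginals of joint laws -/

section Law

variable {Ω α β γ : Type*} [Fintype Ω] [Fintype α] [Fintype β] [Fintype γ]

lemma law_eq_sum_right (P : Ω → ℝ) (A : Ω → α) (B : Ω → β) (a : α) :
    law P A a = ∑ b, law P (fun ω => (A ω, B ω)) (a, b) := by
  classical
  simp only [law, Prod.mk.injEq, ite_and]
  rw [Finset.sum_comm]
  refine Finset.sum_congr rfl fun ω _ => ?_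
  split_ifs <;> simp

lemma law_eq_sum_left (P : Ω → ℝ) (A : Ω → α) (B : Ω → β) (b : β) :
    law P B b = ∑ a, law P (fun ω => (A ω, B ω)) (a, b) := by
  classical
  simp only [law, Prod.mk.injEq, and_comm (b := _ = b), ite_and]
  rw [Finset.sum_comm]
  refine Finset.sum_congr rfl fun ω _ => ?_
  split_ifs <;> simp

lemma law_eq_sum_middle (P : Ω → ℝ) (A : Ω → α) (B : Ω → β) (C : Ω → γ) (a : α) (c : γ) :
    law P (fun ω => (A ω, C ω)) (a, c) = ∑ b, law P (fun ω => (A ω, B ω, C ω)) (a, b, c) := by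
  classical
  simp only [law, Prod.mk.injEq]
  rw [Finset.sum_comm]
  refine Finset.sum_congr rfl fun ω _ => ?_
  simp only [and_left_comm (a := A ω = a), ite_and]
  simp

end Law

/-! ### Channels induced by an encoder -/

section InducedChannels

variable {V₁ V₂ X₁ X₂ Y₁ Y₂ Z : Type*} [Fintype V₁] [Fintype V₂]
variable [Fintype X₁] [Fintype X₂] [Fintype Y₁] [Fintype Y₂] [Fintype Z]

/-- The channel from `(V₁, V₂)` to `Z`. -/
def eveChannel (W : Channel X₁ X₂ Y₁ Y₂ Z) (k₁ : V₁ → stdSimplex ℝ X₁) (k₂ : V₂ → stdSimplex ℝ X₂)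
    (v₁ : V₁) (v₂ : V₂) (z : Z) : ℝ :=
  ∑ x₁, ∑ x₂, (k₁ v₁).1 x₁ * (k₂ v₂).1 x₂ * ∑ y₁, ∑ y₂, (W x₁ x₂).1 (y₁, y₂, z)

/-- The channel from `V₁` to `Y₂`, for a given `X₂`. -/
def forwardChannel (W : Channel X₁ X₂ Y₁ Y₂ Z) (k₁ : V₁ → stdSimplex ℝ X₁) (v₁ : V₁) (x₂ : X₂)
    (y₂ : Y₂) : ℝ :=
  ∑ x₁, (k₁ v₁).1 x₁ * ∑ y₁, ∑ z, (W x₁ x₂).1 (y₁, y₂, z)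

/-- The channel from `V₂` to `Y₁`, for a given `X₁`. -/
def backwardChannel (W : Channel X₁ X₂ Y₁ Y₂ Z) (k₂ : V₂ → stdSimplex ℝ X₂) (v₂ : V₂) (x₁ : X₁)
    (y₁ : Y₁) : ℝ :=
  ∑ x₂, (k₂ v₂).1 x₂ * ∑ y₂, ∑ z, (W x₁ x₂).1 (y₁, y₂, z)

/-- The channel from `V₁` to `(X₂, Y₂)`. -/
def forwardSideChannel (W : Channel X₁ X₂ Y₁ Y₂ Z) (k₁ : V₁ → stdSimplex ℝ X₁)
    (p₂ : stdSimplex ℝ V₂) (k₂ : V₂ → stdSimplex ℝ X₂) : V₁ → X₂ × Y₂ → ℝ :=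
  sideChannel p₂.1 (fun v => (k₂ v).1) (forwardChannel W k₁)

/-- The channel from `V₂` to `(X₁, Y₁)`. -/
def backwardSideChannel (W : Channel X₁ X₂ Y₁ Y₂ Z) (p₁ : stdSimplex ℝ V₁)
    (k₁ : V₁ → stdSimplex ℝ X₁) (k₂ : V₂ → stdSimplex ℝ X₂) : V₂ → X₁ × Y₁ → ℝ :=
  sideChannel p₁.1 (fun v => (k₁ v).1) (backwardChannel W k₂)

variable (W : Channel X₁ X₂ Y₁ Y₂ Z) (p₁ : stdSimplex ℝ V₁) (k₁ : V₁ → stdSimplex ℝ X₁)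
  (p₂ : stdSimplex ℝ V₂) (k₂ : V₂ → stdSimplex ℝ X₂)

lemma sum_channel (x₁ : X₁) (x₂ : X₂) : ∑ y₁, ∑ y₂, ∑ z, (W x₁ x₂).1 (y₁, y₂, z) = 1 := by
  have := (W x₁ x₂).2.2
  simpa only [Fintype.sum_prod_type] using this

lemma eveChannel_nonneg (v₁ : V₁) (v₂ : V₂) (z : Z) : 0 ≤ eveChannel W k₁ k₂ v₁ v₂ z :=
  Finset.sum_nonneg fun x₁ _ => Finset.sum_nonneg fun x₂ _ =>
    mul_nonneg (mul_nonneg ((k₁ v₁).2.1 _) ((k₂ v₂).2.1 _))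
      (Finset.sum_nonneg fun _ _ => Finset.sum_nonneg fun _ _ => (W x₁ x₂).2.1 _)

lemma sum_eveChannel (v₁ : V₁) (v₂ : V₂) : ∑ z, eveChannel W k₁ k₂ v₁ v₂ z = 1 := by
  have h : ∀ x₁ x₂, ∑ z, ∑ y₁, ∑ y₂, (W x₁ x₂).1 (y₁, y₂, z) = 1 := by
    intro x₁ x₂
    rw [Finset.sum_comm, ← sum_channel W x₁ x₂]
    exact Finset.sum_congr rfl fun y₁ _ => Finset.sum_comm
  simp only [eveChannel]
  rw [Finset.sum_comm]
  have h2 : ∀ x₁, ∑ z, ∑ x₂, (k₁ v₁).1 x₁ * (k₂ v₂).1 x₂ * ∑ y₁, ∑ y₂, (W x₁ x₂).1 (y₁, y₂, z) =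
      (k₁ v₁).1 x₁ := by
    intro x₁
    rw [Finset.sum_comm]
    simp only [← Finset.mul_sum, h, mul_one, (k₂ v₂).2.2]
  simp only [h2, (k₁ v₁).2.2]

lemma forwardChannel_nonneg (v₁ : V₁) (x₂ : X₂) (y₂ : Y₂) : 0 ≤ forwardChannel W k₁ v₁ x₂ y₂ :=
  Finset.sum_nonneg fun x₁ _ => mul_nonneg ((k₁ v₁).2.1 _)
    (Finset.sum_nonneg fun _ _ => Finset.sum_nonneg fun _ _ => (W x₁ x₂).2.1 _)

lemma sum_forwardChannel (v₁ : V₁) (x₂ : X₂) : ∑ y₂, forwardChannel W k₁ v₁ x₂ y₂ = 1 := by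
  have h : ∀ x₁, ∑ y₂, ∑ y₁, ∑ z, (W x₁ x₂).1 (y₁, y₂, z) = 1 := by
    intro x₁
    rw [Finset.sum_comm, sum_channel W x₁ x₂]
  simp only [forwardChannel]
  rw [Finset.sum_comm]
  simp only [← Finset.mul_sum, h, mul_one, (k₁ v₁).2.2]

lemma backwardChannel_nonneg (v₂ : V₂) (x₁ : X₁) (y₁ : Y₁) : 0 ≤ backwardChannel W k₂ v₂ x₁ y₁ :=
  Finset.sum_nonneg fun x₂ _ => mul_nonneg ((k₂ v₂).2.1 _)
    (Finset.sum_nonneg fun _ _ => Finset.sum_nonneg fun _ _ => (W x₁ x₂).2.1 _)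

lemma sum_backwardChannel (v₂ : V₂) (x₁ : X₁) : ∑ y₁, backwardChannel W k₂ v₂ x₁ y₁ = 1 := by
  simp only [backwardChannel]
  rw [Finset.sum_comm]
  simp only [← Finset.mul_sum, sum_channel, mul_one, (k₂ v₂).2.2]

lemma forwardSideChannel_nonneg (v₁ : V₁) (o : X₂ × Y₂) :
    0 ≤ forwardSideChannel W k₁ p₂ k₂ v₁ o :=
  mul_nonneg (outLaw_nonneg p₂.2.1 (fun v x => (k₂ v).2.1 x) _) (forwardChannel_nonneg W k₁ _ _ _)

lemma sum_forwardSideChannel (v₁ : V₁) : ∑ o, forwardSideChannel W k₁ p₂ k₂ v₁ o = 1 := by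
  simp only [forwardSideChannel, Fintype.sum_prod_type, sideChannel, ← Finset.mul_sum,
    sum_forwardChannel, mul_one]
  exact sum_outLaw p₂.2.2 fun v => (k₂ v).2.2

lemma backwardSideChannel_nonneg (v₂ : V₂) (o : X₁ × Y₁) :
    0 ≤ backwardSideChannel W p₁ k₁ k₂ v₂ o :=
  mul_nonneg (outLaw_nonneg p₁.2.1 (fun v x => (k₁ v).2.1 x) _) (backwardChannel_nonneg W k₂ _ _ _)

lemma sum_backwardSideChannel (v₂ : V₂) : ∑ o, backwardSideChannel W p₁ k₁ k₂ v₂ o = 1 := by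
  simp only [backwardSideChannel, Fintype.sum_prod_type, sideChannel, ← Finset.mul_sum,
    sum_backwardChannel, mul_one]
  exact sum_outLaw p₁.2.2 fun v => (k₁ v).2.2

lemma pairOutLaw_eveChannel_nonneg (z : Z) : 0 ≤ pairOutLaw p₁.1 p₂.1 (eveChannel W k₁ k₂) z :=
  outLaw_nonneg (fun _ => mul_nonneg (p₁.2.1 _) (p₂.2.1 _)) (fun _ _ => eveChannel_nonneg W k₁ k₂ _ _ _) z

lemma sum_pairOutLaw_eveChannel : ∑ z, pairOutLaw p₁.1 p₂.1 (eveChannel W k₁ k₂) z = 1 := by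
  refine sum_outLaw ?_ fun u => sum_eveChannel W k₁ k₂ u.1 u.2
  simp only [Fintype.sum_prod_type, ← Finset.mul_sum, p₂.2.2, mul_one, p₁.2.2]

lemma eveChannel_eq_zero {v₁ : V₁} {v₂ : V₂} (h₁ : 0 < p₁.1 v₁) (h₂ : 0 < p₂.1 v₂) {z : Z}
    (h : pairOutLaw p₁.1 p₂.1 (eveChannel W k₁ k₂) z = 0) : eveChannel W k₁ k₂ v₁ v₂ z = 0 := by
  have := mul_le_outLaw (p := fun u : V₁ × V₂ => p₁.1 u.1 * p₂.1 u.2)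
    (G := fun u z => eveChannel W k₁ k₂ u.1 u.2 z) (fun u => mul_nonneg (p₁.2.1 _) (p₂.2.1 _))
    (fun u z => eveChannel_nonneg W k₁ k₂ _ _ _) (v₁, v₂) z
  have h' : p₁.1 v₁ * p₂.1 v₂ * eveChannel W k₁ k₂ v₁ v₂ z ≤ 0 := this.trans_eq h
  exact le_antisymm (nonpos_of_mul_nonpos_right h' (mul_pos h₁ h₂)) (eveChannel_nonneg W k₁ k₂ _ _ _)

/-- The channel for words of length `n`. -/
def wordChannel (W : Channel X₁ X₂ Y₁ Y₂ Z) (n : ℕ) :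
    Channel (Fin n → X₁) (Fin n → X₂) (Fin n → Y₁) (Fin n → Y₂) (Fin n → Z) :=
  fun x₁ x₂ => ⟨fun y => ∏ t, (W (x₁ t) (x₂ t)).1 (y.1 t, y.2.1 t, y.2.2 t),
    fun y => Finset.prod_nonneg fun t _ => (W (x₁ t) (x₂ t)).2.1 _, by
      classical
      simp only [Fintype.sum_prod_type]
      have h := fun t => sum_channel W (x₁ t) (x₂ t)
      have h1 : ∏ t, ∑ y₁, ∑ y₂, ∑ z, (W (x₁ t) (x₂ t)).1 (y₁, y₂, z) = 1 :=
        Finset.prod_eq_one fun t _ => h t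
      simpa only [Fintype.prod_sum] using h1⟩

end InducedChannels

/-! ### The code of a pair of codebooks -/

section CodebookCode

variable {U X : Type*} [Fintype X]

/-- The encoder that picks one of the `L` codewords of the message at random and sends it over the
channel `k`. -/
def codebookEncoder {M L : ℕ} (hL : 0 < L) (k : U → stdSimplex ℝ X) (c : Fin M × Fin L → U)
    (m : Fin M) : stdSimplex ℝ X :=
  ⟨fun x => (L : ℝ)⁻¹ * ∑ l, (k (c (m, l))).1 x,
    fun x => mul_nonneg (by positivity) (Finset.sum_nonneg fun l _ => (k _).2.1 x), by
      have : (L : ℝ) ≠ 0 := by positivity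
      rw [← Finset.mul_sum, Finset.sum_comm]
      simp [(k _).2.2, this]⟩

variable {U₁ U₂ X₁ X₂ Y₁ Y₂ Z : Type*} [Fintype U₁] [Fintype U₂]
variable [Fintype X₁] [Fintype X₂] [Fintype Y₁] [Fintype Y₂] [Fintype Z]

/-- The code with the codebooks `c₁` and `c₂` and threshold decoders. -/
def codebookCode (W : Channel X₁ X₂ Y₁ Y₂ Z) {n M₁ L₁ M₂ L₂ : ℕ} (hM₁ : 0 < M₁) (hL₁ : 0 < L₁)
    (hM₂ : 0 < M₂) (hL₂ : 0 < L₂) (p₁ : stdSimplex ℝ U₁) (k₁ : U₁ → stdSimplex ℝ (Fin n → X₁))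
    (p₂ : stdSimplex ℝ U₂) (k₂ : U₂ → stdSimplex ℝ (Fin n → X₂)) (θ₁ θ₂ : ℝ)
    (c₁ : Fin M₁ × Fin L₁ → U₁) (c₂ : Fin M₂ × Fin L₂ → U₂) : Code X₁ X₂ Y₁ Y₂ n where
  M₁ := M₁
  M₂ := M₂
  M₁_pos := hM₁
  M₂_pos := hM₂
  enc₁ := codebookEncoder hL₁ k₁ c₁
  enc₂ := codebookEncoder hL₂ k₂ c₂
  dec₁ x₁ y₁ :=
    haveI : Nonempty (Fin M₂) := ⟨⟨0, hM₂⟩⟩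
    thresholdDecoder (backwardSideChannel (wordChannel W n) p₁ k₁ k₂)
      (outLaw p₂.1 (backwardSideChannel (wordChannel W n) p₁ k₁ k₂)) θ₂ c₂ (x₁, y₁)
  dec₂ x₂ y₂ :=
    haveI : Nonempty (Fin M₁) := ⟨⟨0, hM₁⟩⟩
    thresholdDecoder (forwardSideChannel (wordChannel W n) k₁ p₂ k₂)
      (outLaw p₁.1 (forwardSideChannel (wordChannel W n) k₁ p₂ k₂)) θ₁ c₁ (x₂, y₂)

variable (W : Channel X₁ X₂ Y₁ Y₂ Z) {n M₁ L₁ M₂ L₂ : ℕ}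

lemma law_message_output (C : Code X₁ X₂ Y₁ Y₂ n) (m : Fin C.M₁ × Fin C.M₂) (z : Fin n → Z) :
    law (C.jointLaw W) (fun ω => (ω.1, ω.2.2.2.2.2)) (m, z) =
      1 / (C.M₁ : ℝ) * (1 / (C.M₂ : ℝ)) *
        eveChannel (wordChannel W n) C.enc₁ C.enc₂ m.1 m.2 z := by
  classical
  simp only [law, Prod.mk.injEq, ite_and, Fintype.sum_prod_type (α₁ := Fin C.M₁ × Fin C.M₂)]
  simp only [Finset.sum_ite_irrel, Finset.sum_const_zero, Finset.sum_ite_eq', Finset.mem_univ,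
    if_true, Fintype.sum_prod_type, Code.jointLaw, Code.condLaw, eveChannel, Finset.mul_sum]
  rfl

lemma law_message₁_output (C : Code X₁ X₂ Y₁ Y₂ n) (m : Fin C.M₁) (z : Fin n → Z) :
    law (C.jointLaw W) (fun ω => (ω.1.1, ω.2.2.2.2.2)) (m, z) =
      1 / (C.M₁ : ℝ) * (1 / (C.M₂ : ℝ) *
        ∑ m₂, eveChannel (wordChannel W n) C.enc₁ C.enc₂ m m₂ z) := by
  classical
  have h : ∀ m₂, law (C.jointLaw W) (fun ω => (ω.1.1, ω.1.2, ω.2.2.2.2.2)) (m, m₂, z) =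
      law (C.jointLaw W) (fun ω => (ω.1, ω.2.2.2.2.2)) ((m, m₂), z) := by
    intro m₂
    simp only [law, Prod.ext_iff, and_assoc]
  rw [law_eq_sum_middle _ _ (fun ω => ω.1.2)]
  simp only [h, law_message_output, ← Finset.mul_sum]
  ring

lemma law_message₂_output (C : Code X₁ X₂ Y₁ Y₂ n) (m : Fin C.M₂) (z : Fin n → Z) :
    law (C.jointLaw W) (fun ω => (ω.1.2, ω.2.2.2.2.2)) (m, z) =
      1 / (C.M₂ : ℝ) * (1 / (C.M₁ : ℝ) *
        ∑ m₁, eveChannel (wordChannel W n) C.enc₁ C.enc₂ m₁ m z) := by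
  classical
  have h : ∀ m₁, law (C.jointLaw W) (fun ω => (ω.1.2, ω.1.1, ω.2.2.2.2.2)) (m, m₁, z) =
      law (C.jointLaw W) (fun ω => (ω.1, ω.2.2.2.2.2)) ((m₁, m), z) := by
    intro m₁
    simp only [law, Prod.ext_iff, and_assoc, and_left_comm]
  rw [law_eq_sum_middle _ _ (fun ω => ω.1.1)]
  simp only [h, law_message_output, ← Finset.mul_sum]
  ring

lemma eveChannel_codebookEncoder {X₁ X₂ Y₁ Y₂ Z : Type*} [Fintype X₁] [Fintype X₂] [Fintype Y₁]
    [Fintype Y₂] [Fintype Z] (W : Channel X₁ X₂ Y₁ Y₂ Z) (hL₁ : 0 < L₁) (hL₂ : 0 < L₂)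
    (k₁ : U₁ → stdSimplex ℝ X₁) (k₂ : U₂ → stdSimplex ℝ X₂) (c₁ : Fin M₁ × Fin L₁ → U₁)
    (c₂ : Fin M₂ × Fin L₂ → U₂) (m₁ : Fin M₁) (m₂ : Fin M₂) (z : Z) :
    eveChannel W (codebookEncoder hL₁ k₁ c₁) (codebookEncoder hL₂ k₂ c₂) m₁ m₂ z =
      ((L₁ : ℝ) * L₂)⁻¹ * ∑ l₁, ∑ l₂, eveChannel W k₁ k₂ (c₁ (m₁, l₁)) (c₂ (m₂, l₂)) z := by
  simp only [eveChannel, codebookEncoder]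
  have e : ∀ x₁ x₂, ((L₁ : ℝ)⁻¹ * ∑ l, (k₁ (c₁ (m₁, l))).1 x₁) *
      ((L₂ : ℝ)⁻¹ * ∑ l, (k₂ (c₂ (m₂, l))).1 x₂) * ∑ y₁, ∑ y₂, (W x₁ x₂).1 (y₁, y₂, z) =
      ((L₁ : ℝ) * L₂)⁻¹ * ∑ l₁, ∑ l₂, (k₁ (c₁ (m₁, l₁))).1 x₁ * (k₂ (c₂ (m₂, l₂))).1 x₂ *
        ∑ y₁, ∑ y₂, (W x₁ x₂).1 (y₁, y₂, z) := by
    intro x₁ x₂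
    simp only [← Finset.sum_mul, ← Finset.mul_sum]
    rw [mul_inv]
    ring
  simp only [e, ← Finset.mul_sum]
  congr 1
  simp only [Finset.sum_comm (s := (Finset.univ : Finset X₂)) (t := (Finset.univ : Finset (Fin L₁)))]
  rw [Finset.sum_comm]
  refine Finset.sum_congr rfl fun l₁ _ => ?_
  simp only [Finset.sum_comm (s := (Finset.univ : Finset X₂)) (t := (Finset.univ : Finset (Fin L₂)))]
  rw [Finset.sum_comm]

end CodebookCode

/-! ### Error probability and leakage of an arbitrary code -/

section CodeBounds

variable {X₁ X₂ Y₁ Y₂ Z : Type*}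
variable [Fintype X₁] [Fintype X₂] [Fintype Y₁] [Fintype Y₂] [Fintype Z]
variable (W : Channel X₁ X₂ Y₁ Y₂ Z) {n : ℕ} (C : Code X₁ X₂ Y₁ Y₂ n)

open Classical in
/-- The probability that User 2 decodes the message of User 1 wrongly. -/
def Code.missProb₂ (m₁ : Fin C.M₁) (m₂ : Fin C.M₂) : ℝ :=
  ∑ x₂, ∑ y₂, if C.dec₂ x₂ y₂ ≠ m₁ then
    (C.enc₂ m₂).1 x₂ * forwardChannel (wordChannel W n) C.enc₁ m₁ x₂ y₂ else 0

open Classical in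
/-- The probability that User 1 decodes the message of User 2 wrongly. -/
def Code.missProb₁ (m₁ : Fin C.M₁) (m₂ : Fin C.M₂) : ℝ :=
  ∑ x₁, ∑ y₁, if C.dec₁ x₁ y₁ ≠ m₂ then
    (C.enc₁ m₁).1 x₁ * backwardChannel (wordChannel W n) C.enc₂ m₂ x₁ y₁ else 0

lemma Code.missProb₂_nonneg (m₁ : Fin C.M₁) (m₂ : Fin C.M₂) : 0 ≤ C.missProb₂ W m₁ m₂ := by
  classical
  refine Finset.sum_nonneg fun x _ => Finset.sum_nonneg fun y _ => ?_
  split_ifs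
  · exact mul_nonneg ((C.enc₂ m₂).2.1 x) (forwardChannel_nonneg _ _ _ _ _)
  · exact le_rfl

lemma Code.missProb₁_nonneg (m₁ : Fin C.M₁) (m₂ : Fin C.M₂) : 0 ≤ C.missProb₁ W m₁ m₂ := by
  classical
  refine Finset.sum_nonneg fun x _ => Finset.sum_nonneg fun y _ => ?_
  split_ifs
  · exact mul_nonneg ((C.enc₁ m₁).2.1 x) (backwardChannel_nonneg _ _ _ _ _)
  · exact le_rfl

lemma Code.condLaw_nonneg (m₁ : Fin C.M₁) (m₂ : Fin C.M₂) (x₁ : Fin n → X₁) (x₂ : Fin n → X₂)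
    (y₁ : Fin n → Y₁) (y₂ : Fin n → Y₂) (z : Fin n → Z) :
    0 ≤ C.condLaw W m₁ m₂ x₁ x₂ y₁ y₂ z :=
  mul_nonneg (mul_nonneg ((C.enc₁ m₁).2.1 _) ((C.enc₂ m₂).2.1 _))
    (Finset.prod_nonneg fun _ _ => (W _ _).2.1 _)

/-- The event depends only on `x₂` and `y₂`, so summing out `x₁`, `y₁` and `z` leaves the forward
channel of the encoder. -/
lemma Code.sum_condLaw_miss₂ (m₁ : Fin C.M₁) (m₂ : Fin C.M₂) :
    (∑ x₁, ∑ x₂, ∑ y₁, ∑ y₂, ∑ z,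
      if m₁ ≠ C.dec₂ x₂ y₂ then C.condLaw W m₁ m₂ x₁ x₂ y₁ y₂ z else 0) =
    C.missProb₂ W m₁ m₂ := by
  classical
  rw [Finset.sum_comm]
  refine Finset.sum_congr rfl fun x₂ _ => ?_
  have h : ∀ x₁, (∑ y₁, ∑ y₂, ∑ z,
      if m₁ ≠ C.dec₂ x₂ y₂ then C.condLaw W m₁ m₂ x₁ x₂ y₁ y₂ z else 0) =
      ∑ y₂, if m₁ ≠ C.dec₂ x₂ y₂ then ∑ y₁, ∑ z, C.condLaw W m₁ m₂ x₁ x₂ y₁ y₂ z else 0 := by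
    intro x₁
    rw [Finset.sum_comm]
    simp only [Finset.sum_ite_irrel, Finset.sum_const_zero]
  simp only [h]
  rw [Finset.sum_comm]
  refine Finset.sum_congr rfl fun y₂ _ => ?_
  simp only [Finset.sum_ite_irrel, Finset.sum_const_zero, ne_comm (a := m₁)]
  congr 1
  simp only [forwardChannel, Finset.mul_sum]
  refine Finset.sum_congr rfl fun x₁ _ => Finset.sum_congr rfl fun y₁ _ =>
    Finset.sum_congr rfl fun z _ => ?_
  simp only [Code.condLaw, wordChannel]
  ring

lemma Code.sum_condLaw_miss₁ (m₁ : Fin C.M₁) (m₂ : Fin C.M₂) :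
    (∑ x₁, ∑ x₂, ∑ y₁, ∑ y₂, ∑ z,
      if m₂ ≠ C.dec₁ x₁ y₁ then C.condLaw W m₁ m₂ x₁ x₂ y₁ y₂ z else 0) =
    C.missProb₁ W m₁ m₂ := by
  classical
  refine Finset.sum_congr rfl fun x₁ _ => ?_
  rw [Finset.sum_comm]
  refine Finset.sum_congr rfl fun y₁ _ => ?_
  simp only [Finset.sum_ite_irrel, Finset.sum_const_zero, ne_comm (a := m₂)]
  congr 1
  simp only [backwardChannel, Finset.mul_sum]
  refine Finset.sum_congr rfl fun x₂ _ => Finset.sum_congr rfl fun y₂ _ =>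
    Finset.sum_congr rfl fun z _ => ?_
  simp only [Code.condLaw, wordChannel]
  ring

lemma ite_or_le_add {P Q : Prop} [Decidable P] [Decidable Q] [Decidable (P ∨ Q)] {r : ℝ}
    (hr : 0 ≤ r) : (if P ∨ Q then r else 0) ≤ (if P then r else 0) + if Q then r else 0 := by
  by_cases hP : P <;> by_cases hQ : Q <;> simp [hP, hQ, hr]

lemma Code.errorProb_le :
    C.errorProb W ≤ ((C.M₁ : ℝ) * C.M₂)⁻¹ * ∑ m₁, ∑ m₂,
      (C.missProb₂ W m₁ m₂ + C.missProb₁ W m₁ m₂) := by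
  classical
  rw [Code.errorProb, one_div]
  refine mul_le_mul_of_nonneg_left ?_ (by positivity)
  refine Finset.sum_le_sum fun m₁ _ => Finset.sum_le_sum fun m₂ _ => ?_
  rw [← Code.sum_condLaw_miss₂, ← Code.sum_condLaw_miss₁]
  simp only [← Finset.sum_add_distrib]
  refine Finset.sum_le_sum fun x₁ _ => Finset.sum_le_sum fun x₂ _ => Finset.sum_le_sum fun y₁ _ =>
    Finset.sum_le_sum fun y₂ _ => Finset.sum_le_sum fun z _ => ?_
  exact ite_or_le_add (C.condLaw_nonneg W m₁ m₂ x₁ x₂ y₁ y₂ z)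

lemma Code.leakJoint_le {Q : (Fin n → Z) → ℝ} (hQ : ∀ z, 0 ≤ Q z) (hQ1 : ∑ z, Q z = 1)
    (hQK : ∀ z, Q z = 0 → ∀ m₁ m₂, eveChannel (wordChannel W n) C.enc₁ C.enc₂ m₁ m₂ z = 0) :
    C.leakJoint W ≤ 1 / (C.M₁ : ℝ) * (1 / (C.M₂ : ℝ)) *
    ∑ m : Fin C.M₁ × Fin C.M₂,
      divergence (eveChannel (wordChannel W n) C.enc₁ C.enc₂ m.1 m.2) Q := by
  have h1 : (0 : ℝ) < C.M₁ := by exact_mod_cast C.M₁_pos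
  have h2 : (0 : ℝ) < C.M₂ := by exact_mod_cast C.M₂_pos
  have hA : ∀ m, law (C.jointLaw W) (fun ω => ω.1) m = 1 / (C.M₁ : ℝ) * (1 / (C.M₂ : ℝ)) := by
    intro m
    rw [law_eq_sum_right _ _ (fun ω => ω.2.2.2.2.2)]
    simp only [law_message_output, ← Finset.mul_sum, sum_eveChannel, mul_one]
  have hB : ∀ z, law (C.jointLaw W) (fun ω => ω.2.2.2.2.2) z = ∑ m : Fin C.M₁ × Fin C.M₂,
      1 / (C.M₁ : ℝ) * (1 / (C.M₂ : ℝ)) *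
        eveChannel (wordChannel W n) C.enc₁ C.enc₂ m.1 m.2 z := by
    intro z
    rw [law_eq_sum_left _ (fun ω => ω.1)]
    simp only [law_message_output]
  have hcard : (Fintype.card (Fin C.M₁ × Fin C.M₂) : ℝ) *
      (1 / (C.M₁ : ℝ) * (1 / (C.M₂ : ℝ))) = 1 := by
    rw [Fintype.card_prod, Fintype.card_fin, Fintype.card_fin, Nat.cast_mul]
    field_simp
  have hw : 0 < 1 / (C.M₁ : ℝ) * (1 / (C.M₂ : ℝ)) := by positivity
  exact mutualInfo_le_sum_divergence (P := C.jointLaw W) (A := fun ω => ω.1)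
    (B := fun ω => ω.2.2.2.2.2)
    (K := fun m => eveChannel (wordChannel W n) C.enc₁ C.enc₂ m.1 m.2) hw hcard
    (fun _ _ => eveChannel_nonneg _ _ _ _ _ _) (fun _ => sum_eveChannel _ _ _ _ _) hQ hQ1
    (fun z hz m => hQK z hz m.1 m.2) (law_message_output W C) hA hB

lemma Code.leak₁_le {Q : (Fin n → Z) → ℝ} (hQ : ∀ z, 0 ≤ Q z) (hQ1 : ∑ z, Q z = 1)
    (hQK : ∀ z, Q z = 0 → ∀ m₁ m₂, eveChannel (wordChannel W n) C.enc₁ C.enc₂ m₁ m₂ z = 0) :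
    C.leak₁ W ≤ 1 / (C.M₁ : ℝ) * ∑ m₁, divergence (fun z => 1 / (C.M₂ : ℝ) *
    ∑ m₂, eveChannel (wordChannel W n) C.enc₁ C.enc₂ m₁ m₂ z) Q := by
  have h1 : (0 : ℝ) < C.M₁ := by exact_mod_cast C.M₁_pos
  have h2 : (0 : ℝ) < C.M₂ := by exact_mod_cast C.M₂_pos
  have hsum : ∀ m₁, ∑ z, 1 / (C.M₂ : ℝ) *
      ∑ m₂, eveChannel (wordChannel W n) C.enc₁ C.enc₂ m₁ m₂ z = 1 := by
    intro m₁
    rw [← Finset.mul_sum, Finset.sum_comm]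
    simp only [sum_eveChannel, Finset.sum_const, Finset.card_univ, Fintype.card_fin, nsmul_eq_mul]
    field_simp
  refine mutualInfo_le_sum_divergence
    (K := fun m₁ z => 1 / (C.M₂ : ℝ) * ∑ m₂, eveChannel (wordChannel W n) C.enc₁ C.enc₂ m₁ m₂ z)
    (by positivity) ?_ (fun m z => mul_nonneg (by positivity)
      (Finset.sum_nonneg fun _ _ => eveChannel_nonneg _ _ _ _ _ _)) hsum hQ hQ1
    (fun z hz m => ?_) (fun m z => law_message₁_output W C m z) (fun m => ?_) fun z => ?_
  · rw [Fintype.card_fin]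
    field_simp
  · simp only [hQK z hz, Finset.sum_const_zero, mul_zero]
  · rw [law_eq_sum_right _ _ (fun ω => ω.2.2.2.2.2)]
    simp only [law_message₁_output]
    rw [← Finset.mul_sum, hsum, mul_one]
  · rw [law_eq_sum_left _ (fun ω => ω.1.1)]
    simp only [law_message₁_output]

lemma Code.leak₂_le {Q : (Fin n → Z) → ℝ} (hQ : ∀ z, 0 ≤ Q z) (hQ1 : ∑ z, Q z = 1)
    (hQK : ∀ z, Q z = 0 → ∀ m₁ m₂, eveChannel (wordChannel W n) C.enc₁ C.enc₂ m₁ m₂ z = 0) :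
    C.leak₂ W ≤ 1 / (C.M₂ : ℝ) * ∑ m₂, divergence (fun z => 1 / (C.M₁ : ℝ) *
    ∑ m₁, eveChannel (wordChannel W n) C.enc₁ C.enc₂ m₁ m₂ z) Q := by
  have h1 : (0 : ℝ) < C.M₁ := by exact_mod_cast C.M₁_pos
  have h2 : (0 : ℝ) < C.M₂ := by exact_mod_cast C.M₂_pos
  have hsum : ∀ m₂, ∑ z, 1 / (C.M₁ : ℝ) *
      ∑ m₁, eveChannel (wordChannel W n) C.enc₁ C.enc₂ m₁ m₂ z = 1 := by
    intro m₂
    rw [← Finset.mul_sum, Finset.sum_comm]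
    simp only [sum_eveChannel, Finset.sum_const, Finset.card_univ, Fintype.card_fin, nsmul_eq_mul]
    field_simp
  refine mutualInfo_le_sum_divergence
    (K := fun m₂ z => 1 / (C.M₁ : ℝ) * ∑ m₁, eveChannel (wordChannel W n) C.enc₁ C.enc₂ m₁ m₂ z)
    (by positivity) ?_ (fun m z => mul_nonneg (by positivity)
      (Finset.sum_nonneg fun _ _ => eveChannel_nonneg _ _ _ _ _ _)) hsum hQ hQ1
    (fun z hz m => ?_) (fun m z => law_message₂_output W C m z) (fun m => ?_) fun z => ?_
  · rw [Fintype.card_fin]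
    field_simp
  · simp only [hQK z hz, Finset.sum_const_zero, mul_zero]
  · rw [law_eq_sum_right _ _ (fun ω => ω.2.2.2.2.2)]
    simp only [law_message₂_output]
    rw [← Finset.mul_sum, hsum, mul_one]
  · rw [law_eq_sum_left _ (fun ω => ω.1.2)]
    simp only [law_message₂_output]

end CodeBounds

/-! ### One-shot random coding bounds -/

section OneShot

variable {U₁ U₂ : Type*} [Fintype U₁] [Fintype U₂]

lemma codeMean_comm {A B : Type*} [Fintype A] [Fintype B] (p₁ : U₁ → ℝ) (p₂ : U₂ → ℝ)
    (F : (A → U₁) → (B → U₂) → ℝ) :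
    codeMean p₁ (fun c₁ => codeMean p₂ fun c₂ => F c₁ c₂) =
      codeMean p₂ fun c₂ => codeMean p₁ fun c₁ => F c₁ c₂ := by
  simp only [codeMean, Finset.mul_sum]
  rw [Finset.sum_comm]
  exact Finset.sum_congr rfl fun _ _ => Finset.sum_congr rfl fun _ _ => by ring

variable {X₁ X₂ Y₁ Y₂ Z : Type*}
variable [Fintype X₁] [Fintype X₂] [Fintype Y₁] [Fintype Y₂] [Fintype Z]
variable (W : Channel X₁ X₂ Y₁ Y₂ Z) {n M₁ L₁ M₂ L₂ : ℕ} (hM₁ : 0 < M₁) (hL₁ : 0 < L₁)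
    (hM₂ : 0 < M₂) (hL₂ : 0 < L₂) (p₁ : stdSimplex ℝ U₁) (k₁ : U₁ → stdSimplex ℝ (Fin n → X₁))
    (p₂ : stdSimplex ℝ U₂) (k₂ : U₂ → stdSimplex ℝ (Fin n → X₂)) {s θ₁ θ₂ : ℝ}

/-- The bound on the probability that User 2 decodes the message of User 1 wrongly. -/
def forwardBound (M₁ L₁ : ℕ) (s θ : ℝ) : ℝ :=
  if M₁ = 1 then 0 else
    decodingBound p₁.1 (forwardSideChannel (wordChannel W n) k₁ p₂ k₂) s θ (M₁ * L₁)

/-- The bound on the probability that User 1 decodes the message of User 2 wrongly. -/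
def backwardBound (M₂ L₂ : ℕ) (s θ : ℝ) : ℝ :=
  if M₂ = 1 then 0 else
    decodingBound p₂.1 (backwardSideChannel (wordChannel W n) p₁ k₁ k₂) s θ (M₂ * L₂)

lemma forwardChannel_codebookEncoder {X₁ X₂ Y₁ Y₂ Z : Type*} [Fintype X₁] [Fintype X₂]
    [Fintype Y₁] [Fintype Y₂] [Fintype Z] (W : Channel X₁ X₂ Y₁ Y₂ Z) (hL : 0 < L₁)
    (k₁ : U₁ → stdSimplex ℝ X₁) (c : Fin M₁ × Fin L₁ → U₁) (m : Fin M₁) (x₂ : X₂) (y₂ : Y₂) :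
    forwardChannel W (codebookEncoder hL k₁ c) m x₂ y₂ =
      (L₁ : ℝ)⁻¹ * ∑ l, forwardChannel W k₁ (c (m, l)) x₂ y₂ := by
  simp only [forwardChannel, codebookEncoder]
  rw [Finset.sum_comm]
  simp only [mul_assoc, ← Finset.mul_sum, ← Finset.sum_mul]

lemma backwardChannel_codebookEncoder {X₁ X₂ Y₁ Y₂ Z : Type*} [Fintype X₁] [Fintype X₂]
    [Fintype Y₁] [Fintype Y₂] [Fintype Z] (W : Channel X₁ X₂ Y₁ Y₂ Z) (hL : 0 < L₂)
    (k₂ : U₂ → stdSimplex ℝ X₂) (c : Fin M₂ × Fin L₂ → U₂) (m : Fin M₂) (x₁ : X₁) (y₁ : Y₁) :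
    backwardChannel W (codebookEncoder hL k₂ c) m x₁ y₁ =
      (L₂ : ℝ)⁻¹ * ∑ l, backwardChannel W k₂ (c (m, l)) x₁ y₁ := by
  simp only [backwardChannel, codebookEncoder]
  rw [Finset.sum_comm]
  simp only [mul_assoc, ← Finset.mul_sum, ← Finset.sum_mul]

lemma sum_sum_ite_mul_average {X Y : Type*} [Fintype X] [Fintype Y] {L L' : ℕ} (P : X → Y → Prop)
    [∀ x y, Decidable (P x y)] (f : Fin L → X → ℝ) (g : Fin L' → X → Y → ℝ) :
    (∑ x, ∑ y, if P x y then ((L : ℝ)⁻¹ * ∑ l, f l x) * ((L' : ℝ)⁻¹ * ∑ l, g l x y) else 0) =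
      ((L' : ℝ)⁻¹ * (L : ℝ)⁻¹) * ∑ l', ∑ l, ∑ x, ∑ y, if P x y then f l x * g l' x y else 0 := by
  have h : ∀ x y, (if P x y then ((L : ℝ)⁻¹ * ∑ l, f l x) * ((L' : ℝ)⁻¹ * ∑ l, g l x y) else 0) =
      ((L' : ℝ)⁻¹ * (L : ℝ)⁻¹) * ∑ l', ∑ l, if P x y then f l x * g l' x y else 0 := by
    intro x y
    split_ifs
    · simp only [← Finset.mul_sum, ← Finset.sum_mul]
      ring
    · simp
  simp only [h, ← Finset.mul_sum]
  congr 1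
  calc _ = ∑ x, ∑ l', ∑ l, ∑ y, if P x y then f l x * g l' x y else 0 := by
        refine Finset.sum_congr rfl fun x _ => ?_
        rw [Finset.sum_comm]
        exact Finset.sum_congr rfl fun l' _ => Finset.sum_comm
    _ = _ := by
        rw [Finset.sum_comm]
        exact Finset.sum_congr rfl fun l' _ => Finset.sum_comm

lemma inv_mul_sum_le {L L' : ℕ} (hL : 0 < L) (hL' : 0 < L') {f : Fin L → Fin L' → ℝ} {D : ℝ}
    (h : ∀ l l', f l l' ≤ D) : ((L : ℝ)⁻¹ * (L' : ℝ)⁻¹) * ∑ l, ∑ l', f l l' ≤ D := by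
  have h1 : (0 : ℝ) < L := by exact_mod_cast hL
  have h2 : (0 : ℝ) < L' := by exact_mod_cast hL'
  calc _ ≤ ((L : ℝ)⁻¹ * (L' : ℝ)⁻¹) * ∑ _l : Fin L, ∑ _l' : Fin L', D := by
        gcongr with l _ l' _
        exact h l l'
    _ = D := by
        simp only [Finset.sum_const, Finset.card_univ, Fintype.card_fin, nsmul_eq_mul]
        field_simp

lemma codeMean_missProb₂_le (hs : 0 < s) (hθ : 0 < θ₁) (m₁ : Fin M₁) (m₂ : Fin M₂) :
    codeMean p₁.1 (fun c₁ : Fin M₁ × Fin L₁ → U₁ => codeMean p₂.1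
      fun c₂ : Fin M₂ × Fin L₂ → U₂ =>
      (codebookCode W hM₁ hL₁ hM₂ hL₂ p₁ k₁ p₂ k₂ θ₁ θ₂ c₁ c₂).missProb₂ W m₁ m₂) ≤
    forwardBound W p₁ k₁ p₂ k₂ M₁ L₁ s θ₁ := by
  classical
  have : Nonempty (Fin M₁) := ⟨m₁⟩
  rw [forwardBound]
  split_ifs with h1
  -- A lone message cannot be decoded wrongly, however many codewords carry it. This frees the
  -- randomisation rate from any decodability constraint at message rate zero.
  · have : Subsingleton (Fin M₁) := by rw [h1]; infer_instance
    have h : ∀ c₁ c₂, (codebookCode W hM₁ hL₁ hM₂ hL₂ p₁ k₁ p₂ k₂ θ₁ θ₂ c₁ c₂).missProb₂ W m₁ m₂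
        = 0 := by
      intro c₁ c₂
      refine Finset.sum_eq_zero fun x _ => Finset.sum_eq_zero fun y _ => if_neg fun hne => hne ?_
      exact Subsingleton.elim (α := Fin M₁) _ _
    simp only [h, codeMean_const, le_refl]
  · have e : ∀ c₁ c₂, (codebookCode W hM₁ hL₁ hM₂ hL₂ p₁ k₁ p₂ k₂ θ₁ θ₂ c₁ c₂).missProb₂ W m₁ m₂
        = ((L₁ : ℝ)⁻¹ * (L₂ : ℝ)⁻¹) * ∑ l₁, ∑ l₂, ∑ x, ∑ y,
          if thresholdDecoder (forwardSideChannel (wordChannel W n) k₁ p₂ k₂)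
            (outLaw p₁.1 (forwardSideChannel (wordChannel W n) k₁ p₂ k₂)) θ₁ c₁ (x, y) ≠ m₁ then
          (k₂ (c₂ (m₂, l₂))).1 x * forwardChannel (wordChannel W n) k₁ (c₁ (m₁, l₁)) x y
          else 0 := by
      intro c₁ c₂
      rw [← sum_sum_ite_mul_average]
      simp only [← forwardChannel_codebookEncoder (wordChannel W n) hL₁]
      rfl
    simp only [e, codeMean_const_mul, codeMean_sum]
    refine inv_mul_sum_le hL₁ hL₂ fun l₁ l₂ => ?_
    have h := codeMean_codeMean_thresholdDecoder_le (B := Fin M₂ × Fin L₂) p₁ p₂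
      (κ := fun v => (k₂ v).1) (T := forwardChannel (wordChannel W n) k₁) (fun v x => (k₂ v).2.1 x) (fun v => (k₂ v).2.2) (forwardChannel_nonneg (wordChannel W n) k₁)
      (sum_forwardChannel (wordChannel W n) k₁) hs hθ m₁ l₁ (m₂, l₂)
    rw [Fintype.card_prod, Fintype.card_fin, Fintype.card_fin, Nat.cast_mul] at h
    simp only [codeMean_sum] at h
    exact h

lemma codeMean_missProb₁_le (hs : 0 < s) (hθ : 0 < θ₂) (m₁ : Fin M₁) (m₂ : Fin M₂) :
    codeMean p₁.1 (fun c₁ : Fin M₁ × Fin L₁ → U₁ => codeMean p₂.1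
      fun c₂ : Fin M₂ × Fin L₂ → U₂ =>
      (codebookCode W hM₁ hL₁ hM₂ hL₂ p₁ k₁ p₂ k₂ θ₁ θ₂ c₁ c₂).missProb₁ W m₁ m₂) ≤
    backwardBound W p₁ k₁ p₂ k₂ M₂ L₂ s θ₂ := by
  classical
  have : Nonempty (Fin M₂) := ⟨m₂⟩
  rw [backwardBound]
  split_ifs with h1
  · have : Subsingleton (Fin M₂) := by rw [h1]; infer_instance
    have h : ∀ c₁ c₂, (codebookCode W hM₁ hL₁ hM₂ hL₂ p₁ k₁ p₂ k₂ θ₁ θ₂ c₁ c₂).missProb₁ W m₁ m₂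
        = 0 := by
      intro c₁ c₂
      refine Finset.sum_eq_zero fun x _ => Finset.sum_eq_zero fun y _ => if_neg fun hne => hne ?_
      exact Subsingleton.elim (α := Fin M₂) _ _
    simp only [h, codeMean_const, le_refl]
  · have e : ∀ c₁ c₂, (codebookCode W hM₁ hL₁ hM₂ hL₂ p₁ k₁ p₂ k₂ θ₁ θ₂ c₁ c₂).missProb₁ W m₁ m₂
        = ((L₂ : ℝ)⁻¹ * (L₁ : ℝ)⁻¹) * ∑ l₂, ∑ l₁, ∑ x, ∑ y,
          if thresholdDecoder (backwardSideChannel (wordChannel W n) p₁ k₁ k₂)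
            (outLaw p₂.1 (backwardSideChannel (wordChannel W n) p₁ k₁ k₂)) θ₂ c₂ (x, y) ≠ m₂ then
          (k₁ (c₁ (m₁, l₁))).1 x * backwardChannel (wordChannel W n) k₂ (c₂ (m₂, l₂)) x y
          else 0 := by
      intro c₁ c₂
      rw [← sum_sum_ite_mul_average]
      simp only [← backwardChannel_codebookEncoder (wordChannel W n) hL₂]
      rfl
    -- For this direction the sender's codebook is `c₂`, which must be the outer average.
    rw [codeMean_comm]
    simp only [e, codeMean_const_mul, codeMean_sum]
    refine inv_mul_sum_le hL₂ hL₁ fun l₂ l₁ => ?_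
    have h := codeMean_codeMean_thresholdDecoder_le (B := Fin M₁ × Fin L₁) p₂ p₁
      (κ := fun v => (k₁ v).1) (T := backwardChannel (wordChannel W n) k₂) (fun v x => (k₁ v).2.1 x) (fun v => (k₁ v).2.2) (backwardChannel_nonneg (wordChannel W n) k₂)
      (sum_backwardChannel (wordChannel W n) k₂) hs hθ m₂ l₂ (m₁, l₁)
    rw [Fintype.card_prod, Fintype.card_fin, Fintype.card_fin, Nat.cast_mul] at h
    simp only [codeMean_sum] at h
    exact h

/-- The bound on the error probability of `codebookCode`. -/
def Code.missAverage {n : ℕ} (C : Code X₁ X₂ Y₁ Y₂ n) : ℝ :=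
  ((C.M₁ : ℝ) * C.M₂)⁻¹ * ∑ m₁, ∑ m₂, (C.missProb₂ W m₁ m₂ + C.missProb₁ W m₁ m₂)

lemma Code.missAverage_nonneg {n : ℕ} (C : Code X₁ X₂ Y₁ Y₂ n) : 0 ≤ C.missAverage W :=
  mul_nonneg (by positivity) (Finset.sum_nonneg fun _ _ => Finset.sum_nonneg fun _ _ =>
    add_nonneg (C.missProb₂_nonneg W _ _) (C.missProb₁_nonneg W _ _))

lemma codeMean_missAverage_le (hs : 0 < s) (hθ₁ : 0 < θ₁) (hθ₂ : 0 < θ₂) :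
    codeMean p₁.1 (fun c₁ : Fin M₁ × Fin L₁ → U₁ => codeMean p₂.1
      fun c₂ : Fin M₂ × Fin L₂ → U₂ =>
      (codebookCode W hM₁ hL₁ hM₂ hL₂ p₁ k₁ p₂ k₂ θ₁ θ₂ c₁ c₂).missAverage W) ≤
    forwardBound W p₁ k₁ p₂ k₂ M₁ L₁ s θ₁ + backwardBound W p₁ k₁ p₂ k₂ M₂ L₂ s θ₂ := by
  have e : ∀ c₁ c₂, (codebookCode W hM₁ hL₁ hM₂ hL₂ p₁ k₁ p₂ k₂ θ₁ θ₂ c₁ c₂).missAverage W =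
      ((M₁ : ℝ)⁻¹ * (M₂ : ℝ)⁻¹) * ∑ m₁ : Fin M₁, ∑ m₂ : Fin M₂,
        ((codebookCode W hM₁ hL₁ hM₂ hL₂ p₁ k₁ p₂ k₂ θ₁ θ₂ c₁ c₂).missProb₂ W m₁ m₂ +
        (codebookCode W hM₁ hL₁ hM₂ hL₂ p₁ k₁ p₂ k₂ θ₁ θ₂ c₁ c₂).missProb₁ W m₁ m₂) := by
    intro c₁ c₂
    rw [← mul_inv]
    rfl
  simp only [e, codeMean_const_mul, codeMean_sum, codeMean_add]
  exact inv_mul_sum_le hM₁ hM₂ fun m₁ m₂ =>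
    add_le_add (codeMean_missProb₂_le W hM₁ hL₁ hM₂ hL₂ p₁ k₁ p₂ k₂ hs hθ₁ m₁ m₂)
      (codeMean_missProb₁_le W hM₁ hL₁ hM₂ hL₂ p₁ k₁ p₂ k₂ hs hθ₂ m₁ m₂)

lemma inducedLaw_nonneg {A B Z : Type*} {H : U₁ → U₂ → Z → ℝ} (hH : ∀ u₁ u₂ z, 0 ≤ H u₁ u₂ z)
    (S : Finset A) (T : Finset B) (c₁ : A → U₁) (c₂ : B → U₂) (z : Z) :
    0 ≤ inducedLaw H S T c₁ c₂ z :=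
  mul_nonneg (by positivity) (Finset.sum_nonneg fun _ _ => Finset.sum_nonneg fun _ _ => hH _ _ _)

lemma sum_inducedLaw {A B Z : Type*} [Fintype Z] {H : U₁ → U₂ → Z → ℝ}
    (hH : ∀ u₁ u₂, ∑ z, H u₁ u₂ z = 1) {S : Finset A} {T : Finset B} (hS : S.Nonempty)
    (hT : T.Nonempty) (c₁ : A → U₁) (c₂ : B → U₂) : ∑ z, inducedLaw H S T c₁ c₂ z = 1 := by
  have hS0 : (0 : ℝ) < S.card := by exact_mod_cast Finset.card_pos.2 hS
  have hT0 : (0 : ℝ) < T.card := by exact_mod_cast Finset.card_pos.2 hT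
  simp only [inducedLaw, ← Finset.mul_sum]
  rw [Finset.sum_comm]
  have : ∀ a, ∑ z, ∑ b ∈ T, H (c₁ a) (c₂ b) z = T.card := by
    intro a
    rw [Finset.sum_comm]
    simp [hH]
  simp only [this, Finset.sum_const, nsmul_eq_mul]
  field_simp

lemma divergence_inducedLaw_nonneg {X₁ X₂ Y₁ Y₂ Z : Type*} [Fintype X₁] [Fintype X₂] [Fintype Y₁]
    [Fintype Y₂] [Fintype Z] (W : Channel X₁ X₂ Y₁ Y₂ Z) (k₁ : U₁ → stdSimplex ℝ X₁)
    (k₂ : U₂ → stdSimplex ℝ X₂) {A B : Type*} {S : Finset A} {T : Finset B} (hS : S.Nonempty)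
    (hT : T.Nonempty) {c₁ : A → U₁} {c₂ : B → U₂} (h₁ : ∀ a, 0 < p₁.1 (c₁ a))
    (h₂ : ∀ b, 0 < p₂.1 (c₂ b)) :
    0 ≤ divergence (inducedLaw (eveChannel W k₁ k₂) S T c₁ c₂)
      (pairOutLaw p₁.1 p₂.1 (eveChannel W k₁ k₂)) := by
  refine divergence_nonneg (inducedLaw_nonneg (eveChannel_nonneg W k₁ k₂) S T c₁ c₂)
    (pairOutLaw_eveChannel_nonneg W p₁ k₁ p₂ k₂) ?_ fun z hz => ?_
  · rw [sum_inducedLaw (sum_eveChannel W k₁ k₂) hS hT, sum_pairOutLaw_eveChannel]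
  · simp [inducedLaw, eveChannel_eq_zero W p₁ k₁ p₂ k₂ (h₁ _) (h₂ _) hz]

lemma eveChannel_codebookEncoder_eq_inducedLaw {X₁ X₂ Y₁ Y₂ Z : Type*} [Fintype X₁] [Fintype X₂]
    [Fintype Y₁] [Fintype Y₂] [Fintype Z] (W : Channel X₁ X₂ Y₁ Y₂ Z)
    (k₁ : U₁ → stdSimplex ℝ X₁) (k₂ : U₂ → stdSimplex ℝ X₂) (c₁ : Fin M₁ × Fin L₁ → U₁)
    (c₂ : Fin M₂ × Fin L₂ → U₂) (m₁ : Fin M₁) (m₂ : Fin M₂) :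
    eveChannel W (codebookEncoder hL₁ k₁ c₁) (codebookEncoder hL₂ k₂ c₂) m₁ m₂ =
      inducedLaw (eveChannel W k₁ k₂) ({m₁} ×ˢ Finset.univ) ({m₂} ×ˢ Finset.univ) c₁ c₂ := by
  ext z
  rw [eveChannel_codebookEncoder, inducedLaw]
  simp

/-- Averaging over a uniform `m₂` as well as over the local index makes the second codeword uniform
on the entire codebook. This is the gain of individual over joint secrecy. -/
lemma average_eveChannel_codebookEncoder₁ {X₁ X₂ Y₁ Y₂ Z : Type*} [Fintype X₁] [Fintype X₂]
    [Fintype Y₁] [Fintype Y₂] [Fintype Z] (W : Channel X₁ X₂ Y₁ Y₂ Z)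
    (k₁ : U₁ → stdSimplex ℝ X₁) (k₂ : U₂ → stdSimplex ℝ X₂) (c₁ : Fin M₁ × Fin L₁ → U₁)
    (c₂ : Fin M₂ × Fin L₂ → U₂) (m₁ : Fin M₁) :
    (fun z => 1 / (M₂ : ℝ) * ∑ m₂,
      eveChannel W (codebookEncoder hL₁ k₁ c₁) (codebookEncoder hL₂ k₂ c₂) m₁ m₂ z) =
      inducedLaw (eveChannel W k₁ k₂) ({m₁} ×ˢ Finset.univ) Finset.univ c₁ c₂ := by
  ext z
  simp only [eveChannel_codebookEncoder, inducedLaw, ← Finset.mul_sum]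
  simp only [Finset.card_product, Finset.card_singleton, Finset.card_univ, Fintype.card_fin,
    Fintype.card_prod, Finset.sum_product, Finset.sum_singleton, one_mul, Nat.cast_mul,
    Fintype.sum_prod_type]
  rw [Finset.sum_comm]
  simp only [mul_inv]
  ring

lemma average_eveChannel_codebookEncoder₂ {X₁ X₂ Y₁ Y₂ Z : Type*} [Fintype X₁] [Fintype X₂]
    [Fintype Y₁] [Fintype Y₂] [Fintype Z] (W : Channel X₁ X₂ Y₁ Y₂ Z)
    (k₁ : U₁ → stdSimplex ℝ X₁) (k₂ : U₂ → stdSimplex ℝ X₂) (c₁ : Fin M₁ × Fin L₁ → U₁)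
    (c₂ : Fin M₂ × Fin L₂ → U₂) (m₂ : Fin M₂) :
    (fun z => 1 / (M₁ : ℝ) * ∑ m₁,
      eveChannel W (codebookEncoder hL₁ k₁ c₁) (codebookEncoder hL₂ k₂ c₂) m₁ m₂ z) =
      inducedLaw (eveChannel W k₁ k₂) Finset.univ ({m₂} ×ˢ Finset.univ) c₁ c₂ := by
  ext z
  simp only [eveChannel_codebookEncoder, inducedLaw, ← Finset.mul_sum]
  simp only [Finset.card_product, Finset.card_singleton, Finset.card_univ, Fintype.card_fin,
    Fintype.card_prod, Finset.sum_product, Finset.sum_singleton, one_mul, Nat.cast_mul,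
    Fintype.sum_prod_type, mul_inv]
  ring

lemma eveChannel_codebookEncoder_eq_zero {X₁ X₂ Y₁ Y₂ Z : Type*} [Fintype X₁] [Fintype X₂]
    [Fintype Y₁] [Fintype Y₂] [Fintype Z] (W : Channel X₁ X₂ Y₁ Y₂ Z)
    (k₁ : U₁ → stdSimplex ℝ X₁) (k₂ : U₂ → stdSimplex ℝ X₂) {c₁ : Fin M₁ × Fin L₁ → U₁}
    {c₂ : Fin M₂ × Fin L₂ → U₂} (h₁ : ∀ a, 0 < p₁.1 (c₁ a)) (h₂ : ∀ b, 0 < p₂.1 (c₂ b)) (z : Z)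
    (hz : pairOutLaw p₁.1 p₂.1 (eveChannel W k₁ k₂) z = 0) (m₁ : Fin M₁) (m₂ : Fin M₂) :
    eveChannel W (codebookEncoder hL₁ k₁ c₁) (codebookEncoder hL₂ k₂ c₂) m₁ m₂ z = 0 := by
  simp [eveChannel_codebookEncoder, eveChannel_eq_zero W p₁ k₁ p₂ k₂ (h₁ _) (h₂ _) hz]

variable (θ₁ θ₂) {c₁ : Fin M₁ × Fin L₁ → U₁} {c₂ : Fin M₂ × Fin L₂ → U₂}

lemma codebookCode_leakJoint_le (h₁ : ∀ a, 0 < p₁.1 (c₁ a))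
    (h₂ : ∀ b, 0 < p₂.1 (c₂ b)) :
    (codebookCode W hM₁ hL₁ hM₂ hL₂ p₁ k₁ p₂ k₂ θ₁ θ₂ c₁ c₂).leakJoint W ≤
      ((M₁ : ℝ)⁻¹ * (M₂ : ℝ)⁻¹) * ∑ m₁ : Fin M₁, ∑ m₂ : Fin M₂, divergence
        (inducedLaw (eveChannel (wordChannel W n) k₁ k₂) ({m₁} ×ˢ Finset.univ)
          ({m₂} ×ˢ Finset.univ) c₁ c₂) (pairOutLaw p₁.1 p₂.1 (eveChannel (wordChannel W n) k₁ k₂)) := by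
  have h := Code.leakJoint_le W (codebookCode W hM₁ hL₁ hM₂ hL₂ p₁ k₁ p₂ k₂ θ₁ θ₂ c₁ c₂)
    (pairOutLaw_eveChannel_nonneg (wordChannel W n) p₁ k₁ p₂ k₂)
    (sum_pairOutLaw_eveChannel (wordChannel W n) p₁ k₁ p₂ k₂)
    (eveChannel_codebookEncoder_eq_zero hL₁ hL₂ p₁ p₂ (wordChannel W n) k₁ k₂ h₁ h₂)
  change _ ≤ 1 / (M₁ : ℝ) * (1 / (M₂ : ℝ)) * ∑ m : Fin M₁ × Fin M₂, divergence (eveChannel (wordChannel W n) (codebookEncoder hL₁ k₁ c₁)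
      (codebookEncoder hL₂ k₂ c₂) m.1 m.2)
      (pairOutLaw p₁.1 p₂.1 (eveChannel (wordChannel W n) k₁ k₂)) at h
  refine h.trans_eq ?_
  rw [Fintype.sum_prod_type, one_div, one_div]
  refine congrArg _ (Finset.sum_congr rfl fun m₁ _ => Finset.sum_congr rfl fun m₂ _ => ?_)
  rw [eveChannel_codebookEncoder_eq_inducedLaw]

lemma codebookCode_leak₁_le (h₁ : ∀ a, 0 < p₁.1 (c₁ a))
    (h₂ : ∀ b, 0 < p₂.1 (c₂ b)) :
    (codebookCode W hM₁ hL₁ hM₂ hL₂ p₁ k₁ p₂ k₂ θ₁ θ₂ c₁ c₂).leak₁ W ≤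
      1 / (M₁ : ℝ) * ∑ m₁ : Fin M₁, divergence
        (inducedLaw (eveChannel (wordChannel W n) k₁ k₂) ({m₁} ×ˢ Finset.univ)
          Finset.univ c₁ c₂) (pairOutLaw p₁.1 p₂.1 (eveChannel (wordChannel W n) k₁ k₂)) := by
  have h := Code.leak₁_le W (codebookCode W hM₁ hL₁ hM₂ hL₂ p₁ k₁ p₂ k₂ θ₁ θ₂ c₁ c₂)
    (pairOutLaw_eveChannel_nonneg (wordChannel W n) p₁ k₁ p₂ k₂)
    (sum_pairOutLaw_eveChannel (wordChannel W n) p₁ k₁ p₂ k₂)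
    (eveChannel_codebookEncoder_eq_zero hL₁ hL₂ p₁ p₂ (wordChannel W n) k₁ k₂ h₁ h₂)
  change _ ≤ 1 / (M₁ : ℝ) * ∑ m₁ : Fin M₁, divergence (fun z => 1 / (M₂ : ℝ) * ∑ m₂ : Fin M₂,
    eveChannel (wordChannel W n) (codebookEncoder hL₁ k₁ c₁)
      (codebookEncoder hL₂ k₂ c₂) m₁ m₂ z)
      (pairOutLaw p₁.1 p₂.1 (eveChannel (wordChannel W n) k₁ k₂)) at h
  refine h.trans_eq ?_
  refine congrArg _ (Finset.sum_congr rfl fun m₁ _ => ?_)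
  rw [average_eveChannel_codebookEncoder₁]

lemma codebookCode_leak₂_le (h₁ : ∀ a, 0 < p₁.1 (c₁ a))
    (h₂ : ∀ b, 0 < p₂.1 (c₂ b)) :
    (codebookCode W hM₁ hL₁ hM₂ hL₂ p₁ k₁ p₂ k₂ θ₁ θ₂ c₁ c₂).leak₂ W ≤
      1 / (M₂ : ℝ) * ∑ m₂ : Fin M₂, divergence
        (inducedLaw (eveChannel (wordChannel W n) k₁ k₂) Finset.univ
          ({m₂} ×ˢ Finset.univ) c₁ c₂) (pairOutLaw p₁.1 p₂.1 (eveChannel (wordChannel W n) k₁ k₂)) := by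
  have h := Code.leak₂_le W (codebookCode W hM₁ hL₁ hM₂ hL₂ p₁ k₁ p₂ k₂ θ₁ θ₂ c₁ c₂)
    (pairOutLaw_eveChannel_nonneg (wordChannel W n) p₁ k₁ p₂ k₂)
    (sum_pairOutLaw_eveChannel (wordChannel W n) p₁ k₁ p₂ k₂)
    (eveChannel_codebookEncoder_eq_zero hL₁ hL₂ p₁ p₂ (wordChannel W n) k₁ k₂ h₁ h₂)
  change _ ≤ 1 / (M₂ : ℝ) * ∑ m₂ : Fin M₂, divergence (fun z => 1 / (M₁ : ℝ) * ∑ m₁ : Fin M₁,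
    eveChannel (wordChannel W n) (codebookEncoder hL₁ k₁ c₁)
      (codebookEncoder hL₂ k₂ c₂) m₁ m₂ z)
      (pairOutLaw p₁.1 p₂.1 (eveChannel (wordChannel W n) k₁ k₂)) at h
  refine h.trans_eq ?_
  refine congrArg _ (Finset.sum_congr rfl fun m₂ _ => ?_)
  rw [average_eveChannel_codebookEncoder₂]

variable {θ₁ θ₂}

/-- The first-moment method is applied to the sum of the error bound and the leakage bound. For
codebooks in the support both are nonnegative, so each is bounded by the sum. -/
theorem exists_code_joint (hM₁ : 0 < M₁) (hL₁ : 0 < L₁) (hM₂ : 0 < M₂) (hL₂ : 0 < L₂)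
    (hs : 0 < s) (hs1 : s ≤ 1) (hθ₁ : 0 < θ₁) (hθ₂ : 0 < θ₂) {r : ℝ}
    (hr : forwardBound W p₁ k₁ p₂ k₂ M₁ L₁ s θ₁ + backwardBound W p₁ k₁ p₂ k₂ M₂ L₂ s θ₂ +
      coveringBound p₁.1 p₂.1 (eveChannel (wordChannel W n) k₁ k₂) s L₁ L₂ ≤ r) :
    ∃ C : Code X₁ X₂ Y₁ Y₂ n, C.M₁ = M₁ ∧ C.M₂ = M₂ ∧ C.errorProb W ≤ r ∧ C.leakJoint W ≤ r := by
  have hne₁ : (Finset.univ : Finset (Fin L₁)).Nonempty := ⟨⟨0, hL₁⟩, Finset.mem_univ _⟩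
  have hne₂ : (Finset.univ : Finset (Fin L₂)).Nonempty := ⟨⟨0, hL₂⟩, Finset.mem_univ _⟩
  have hS : ∀ m : Fin M₁, (({m} : Finset (Fin M₁)) ×ˢ (Finset.univ : Finset (Fin L₁))).Nonempty :=
    fun m => (Finset.singleton_nonempty m).product hne₁
  have hT : ∀ m : Fin M₂, (({m} : Finset (Fin M₂)) ×ˢ (Finset.univ : Finset (Fin L₂))).Nonempty :=
    fun m => (Finset.singleton_nonempty m).product hne₂
  let leak : (Fin M₁ × Fin L₁ → U₁) → (Fin M₂ × Fin L₂ → U₂) → ℝ := fun c₁ c₂ =>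
    ((M₁ : ℝ)⁻¹ * (M₂ : ℝ)⁻¹) * ∑ m₁ : Fin M₁, ∑ m₂ : Fin M₂, divergence
      (inducedLaw (eveChannel (wordChannel W n) k₁ k₂) ({m₁} ×ˢ Finset.univ)
        ({m₂} ×ˢ Finset.univ) c₁ c₂) (pairOutLaw p₁.1 p₂.1 (eveChannel (wordChannel W n) k₁ k₂))
  have hleak : codeMean p₁.1 (fun c₁ => codeMean p₂.1 fun c₂ => leak c₁ c₂) ≤
      coveringBound p₁.1 p₂.1 (eveChannel (wordChannel W n) k₁ k₂) s L₁ L₂ := by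
    simp only [leak, codeMean_const_mul, codeMean_sum]
    refine inv_mul_sum_le hM₁ hM₂ fun m₁ m₂ => ?_
    have h := codeMean_divergence_le p₁ p₂ (eveChannel_nonneg (wordChannel W n) k₁ k₂) (hS m₁)
      (hT m₂) hs hs1
    simpa using h
  have hmiss := codeMean_missAverage_le W hM₁ hL₁ hM₂ hL₂ p₁ k₁ p₂ k₂ hs hθ₁ hθ₂
  have htot : codeMean p₁.1 (fun c₁ => codeMean p₂.1 fun c₂ =>
      (codebookCode W hM₁ hL₁ hM₂ hL₂ p₁ k₁ p₂ k₂ θ₁ θ₂ c₁ c₂).missAverage W + leak c₁ c₂) ≤ r := by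
    simp only [codeMean_add]
    linarith
  obtain ⟨c₁, hc₁, h1⟩ := exists_of_codeMean_le p₁ htot
  obtain ⟨c₂, hc₂, h2⟩ := exists_of_codeMean_le p₂ h1
  have hm0 := (codebookCode W hM₁ hL₁ hM₂ hL₂ p₁ k₁ p₂ k₂ θ₁ θ₂ c₁ c₂).missAverage_nonneg W
  have hl0 : 0 ≤ leak c₁ c₂ :=
    mul_nonneg (by positivity) (Finset.sum_nonneg fun _ _ => Finset.sum_nonneg fun _ _ =>
      divergence_inducedLaw_nonneg p₁ p₂ _ k₁ k₂ (hS _) (hT _) hc₁ hc₂)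
  refine ⟨codebookCode W hM₁ hL₁ hM₂ hL₂ p₁ k₁ p₂ k₂ θ₁ θ₂ c₁ c₂, rfl, rfl, ?_, ?_⟩
  · exact (Code.errorProb_le W _).trans (by change Code.missAverage W _ ≤ r; linarith)
  · exact (codebookCode_leakJoint_le W hM₁ hL₁ hM₂ hL₂ p₁ k₁ p₂ k₂ θ₁ θ₂ hc₁ hc₂).trans
      (by linarith : leak c₁ c₂ ≤ r)

/-- As in the joint case, with two covering terms: one row of User 1 against all `M₂ L₂` codewords
of User 2, and conversely. -/
theorem exists_code_individual (hM₁ : 0 < M₁) (hL₁ : 0 < L₁) (hM₂ : 0 < M₂) (hL₂ : 0 < L₂)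
    (hs : 0 < s) (hs1 : s ≤ 1) (hθ₁ : 0 < θ₁) (hθ₂ : 0 < θ₂) {r : ℝ}
    (hr : forwardBound W p₁ k₁ p₂ k₂ M₁ L₁ s θ₁ + backwardBound W p₁ k₁ p₂ k₂ M₂ L₂ s θ₂ +
      (coveringBound p₁.1 p₂.1 (eveChannel (wordChannel W n) k₁ k₂) s L₁ (M₂ * L₂) +
      coveringBound p₁.1 p₂.1 (eveChannel (wordChannel W n) k₁ k₂) s (M₁ * L₁) L₂) ≤ r) :
    ∃ C : Code X₁ X₂ Y₁ Y₂ n, C.M₁ = M₁ ∧ C.M₂ = M₂ ∧ C.errorProb W ≤ r ∧ C.leak₁ W ≤ r ∧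
      C.leak₂ W ≤ r := by
  have hne₁ : (Finset.univ : Finset (Fin L₁)).Nonempty := ⟨⟨0, hL₁⟩, Finset.mem_univ _⟩
  have hne₂ : (Finset.univ : Finset (Fin L₂)).Nonempty := ⟨⟨0, hL₂⟩, Finset.mem_univ _⟩
  have hS : ∀ m : Fin M₁, (({m} : Finset (Fin M₁)) ×ˢ (Finset.univ : Finset (Fin L₁))).Nonempty :=
    fun m => (Finset.singleton_nonempty m).product hne₁
  have hT : ∀ m : Fin M₂, (({m} : Finset (Fin M₂)) ×ˢ (Finset.univ : Finset (Fin L₂))).Nonempty :=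
    fun m => (Finset.singleton_nonempty m).product hne₂
  have hS' : (Finset.univ : Finset (Fin M₁ × Fin L₁)).Nonempty :=
    ⟨(⟨0, hM₁⟩, ⟨0, hL₁⟩), Finset.mem_univ _⟩
  have hT' : (Finset.univ : Finset (Fin M₂ × Fin L₂)).Nonempty :=
    ⟨(⟨0, hM₂⟩, ⟨0, hL₂⟩), Finset.mem_univ _⟩
  let leak₁ : (Fin M₁ × Fin L₁ → U₁) → (Fin M₂ × Fin L₂ → U₂) → ℝ := fun c₁ c₂ =>
    1 / (M₁ : ℝ) * ∑ m₁ : Fin M₁, divergence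
      (inducedLaw (eveChannel (wordChannel W n) k₁ k₂) ({m₁} ×ˢ Finset.univ)
        Finset.univ c₁ c₂) (pairOutLaw p₁.1 p₂.1 (eveChannel (wordChannel W n) k₁ k₂))
  let leak₂ : (Fin M₁ × Fin L₁ → U₁) → (Fin M₂ × Fin L₂ → U₂) → ℝ := fun c₁ c₂ =>
    1 / (M₂ : ℝ) * ∑ m₂ : Fin M₂, divergence
      (inducedLaw (eveChannel (wordChannel W n) k₁ k₂) Finset.univ ({m₂} ×ˢ Finset.univ)
        c₁ c₂) (pairOutLaw p₁.1 p₂.1 (eveChannel (wordChannel W n) k₁ k₂))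
  have havg : ∀ {M : ℕ} (_ : 0 < M) {f : Fin M → ℝ} {D : ℝ}, (∀ m, f m ≤ D) →
      1 / (M : ℝ) * ∑ m, f m ≤ D := by
    intro M hM f D h
    simpa using inv_mul_sum_le hM one_pos (f := fun m _ => f m) fun m _ => h m
  have hleak₁ : codeMean p₁.1 (fun c₁ => codeMean p₂.1 fun c₂ => leak₁ c₁ c₂) ≤
      coveringBound p₁.1 p₂.1 (eveChannel (wordChannel W n) k₁ k₂) s L₁ (M₂ * L₂) := by
    simp only [leak₁, codeMean_const_mul, codeMean_sum]
    refine havg hM₁ fun m₁ => ?_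
    have h := codeMean_divergence_le p₁ p₂ (eveChannel_nonneg (wordChannel W n) k₁ k₂) (hS m₁)
      hT' hs hs1
    simpa using h
  have hleak₂ : codeMean p₁.1 (fun c₁ => codeMean p₂.1 fun c₂ => leak₂ c₁ c₂) ≤
      coveringBound p₁.1 p₂.1 (eveChannel (wordChannel W n) k₁ k₂) s (M₁ * L₁) L₂ := by
    simp only [leak₂, codeMean_const_mul, codeMean_sum]
    refine havg hM₂ fun m₂ => ?_
    have h := codeMean_divergence_le p₁ p₂ (eveChannel_nonneg (wordChannel W n) k₁ k₂) hS'
      (hT m₂) hs hs1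
    simpa using h
  have hmiss := codeMean_missAverage_le W hM₁ hL₁ hM₂ hL₂ p₁ k₁ p₂ k₂ hs hθ₁ hθ₂
  have htot : codeMean p₁.1 (fun c₁ => codeMean p₂.1 fun c₂ =>
      (codebookCode W hM₁ hL₁ hM₂ hL₂ p₁ k₁ p₂ k₂ θ₁ θ₂ c₁ c₂).missAverage W +
        (leak₁ c₁ c₂ + leak₂ c₁ c₂)) ≤ r := by
    simp only [codeMean_add]
    linarith
  obtain ⟨c₁, hc₁, h1⟩ := exists_of_codeMean_le p₁ htot
  obtain ⟨c₂, hc₂, h2⟩ := exists_of_codeMean_le p₂ h1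
  have hm0 := (codebookCode W hM₁ hL₁ hM₂ hL₂ p₁ k₁ p₂ k₂ θ₁ θ₂ c₁ c₂).missAverage_nonneg W
  have hl₁ : 0 ≤ leak₁ c₁ c₂ :=
    mul_nonneg (by positivity) (Finset.sum_nonneg fun _ _ =>
      divergence_inducedLaw_nonneg p₁ p₂ _ k₁ k₂ (hS _) hT' hc₁ hc₂)
  have hl₂ : 0 ≤ leak₂ c₁ c₂ :=
    mul_nonneg (by positivity) (Finset.sum_nonneg fun _ _ =>
      divergence_inducedLaw_nonneg p₁ p₂ _ k₁ k₂ hS' (hT _) hc₁ hc₂)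
  refine ⟨codebookCode W hM₁ hL₁ hM₂ hL₂ p₁ k₁ p₂ k₂ θ₁ θ₂ c₁ c₂, rfl, rfl, ?_, ?_, ?_⟩
  · exact (Code.errorProb_le W _).trans (by change Code.missAverage W _ ≤ r; linarith)
  · exact (codebookCode_leak₁_le W hM₁ hL₁ hM₂ hL₂ p₁ k₁ p₂ k₂ θ₁ θ₂ hc₁ hc₂).trans
      (by linarith : leak₁ c₁ c₂ ≤ r)
  · exact (codebookCode_leak₂_le W hM₁ hL₁ hM₂ hL₂ p₁ k₁ p₂ k₂ θ₁ θ₂ hc₁ hc₂).trans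
      (by linarith : leak₂ c₁ c₂ ≤ r)

end OneShot

/-! ### Factorisation over the letters of a word -/

section Words

/-- The product of a finite family of laws. -/
def piSimplex {ι : Type*} [Fintype ι] [DecidableEq ι] {α : ι → Type*} [∀ i, Fintype (α i)]
    (f : ∀ i, stdSimplex ℝ (α i)) : stdSimplex ℝ (∀ i, α i) :=
  ⟨fun x => ∏ i, (f i).1 (x i), fun _ => Finset.prod_nonneg fun i _ => (f i).2.1 _, by
    rw [← Fintype.prod_sum]
    exact Finset.prod_eq_one fun i _ => (f i).2.2⟩

/-- A law of `(V₁, V₂, X₁, X₂)` of the form `P_{V₁} P_{X₁|V₁} P_{V₂} P_{X₂|V₂}`. -/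
structure Ensemble (X₁ X₂ : Type*) [Fintype X₁] [Fintype X₂] where
  size₁ : ℕ
  size₂ : ℕ
  p₁ : stdSimplex ℝ (Fin size₁)
  k₁ : Fin size₁ → stdSimplex ℝ X₁
  p₂ : stdSimplex ℝ (Fin size₂)
  k₂ : Fin size₂ → stdSimplex ℝ X₂

variable {X₁ X₂ Y₁ Y₂ Z : Type*}
variable [Fintype X₁] [Fintype X₂] [Fintype Y₁] [Fintype Y₂] [Fintype Z]
variable (W : Channel X₁ X₂ Y₁ Y₂ Z)

namespace Ensemble

/-- The channel from `(V₁, V₂)` to `Z`. -/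
def eve (E : Ensemble X₁ X₂) : Fin E.size₁ → Fin E.size₂ → Z → ℝ := eveChannel W E.k₁ E.k₂

/-- The channel from `V₁` to `(X₂, Y₂)`. -/
def forward (E : Ensemble X₁ X₂) : Fin E.size₁ → X₂ × Y₂ → ℝ :=
  forwardSideChannel W E.k₁ E.p₂ E.k₂

/-- The channel from `V₂` to `(X₁, Y₁)`. -/
def backward (E : Ensemble X₁ X₂) : Fin E.size₂ → X₁ × Y₁ → ℝ :=
  backwardSideChannel W E.p₁ E.k₁ E.k₂

end Ensemble

variable {n : ℕ} (q : Fin n → Ensemble X₁ X₂)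

/-- The law of the word `V₁ⁿ`. -/
def wordLaw₁ : stdSimplex ℝ (∀ t, Fin (q t).size₁) := piSimplex fun t => (q t).p₁

/-- The law of the word `V₂ⁿ`. -/
def wordLaw₂ : stdSimplex ℝ (∀ t, Fin (q t).size₂) := piSimplex fun t => (q t).p₂

/-- The law of `X₁ⁿ` given `V₁ⁿ`. -/
def wordKernel₁ (v : ∀ t, Fin (q t).size₁) : stdSimplex ℝ (Fin n → X₁) :=
  piSimplex fun t => (q t).k₁ (v t)

/-- The law of `X₂ⁿ` given `V₂ⁿ`. -/
def wordKernel₂ (v : ∀ t, Fin (q t).size₂) : stdSimplex ℝ (Fin n → X₂) :=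
  piSimplex fun t => (q t).k₂ (v t)

lemma eveChannel_word (v₁ : ∀ t, Fin (q t).size₁) (v₂ : ∀ t, Fin (q t).size₂) (z : Fin n → Z) :
    eveChannel (wordChannel W n) (wordKernel₁ q) (wordKernel₂ q) v₁ v₂ z =
      ∏ t, (q t).eve W (v₁ t) (v₂ t) (z t) := by
  simp only [Ensemble.eve, eveChannel, Fintype.prod_sum, Finset.prod_mul_distrib]
  rfl

lemma forwardChannel_word (v₁ : ∀ t, Fin (q t).size₁) (x₂ : Fin n → X₂) (y₂ : Fin n → Y₂) :
    forwardChannel (wordChannel W n) (wordKernel₁ q) v₁ x₂ y₂ =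
      ∏ t, forwardChannel W (q t).k₁ (v₁ t) (x₂ t) (y₂ t) := by
  simp only [forwardChannel, Fintype.prod_sum, Finset.prod_mul_distrib]
  rfl

lemma backwardChannel_word (v₂ : ∀ t, Fin (q t).size₂) (x₁ : Fin n → X₁) (y₁ : Fin n → Y₁) :
    backwardChannel (wordChannel W n) (wordKernel₂ q) v₂ x₁ y₁ =
      ∏ t, backwardChannel W (q t).k₂ (v₂ t) (x₁ t) (y₁ t) := by
  simp only [backwardChannel, Fintype.prod_sum, Finset.prod_mul_distrib]
  rfl

lemma forwardSideChannel_word (v₁ : ∀ t, Fin (q t).size₁) (o : Fin n → X₂ × Y₂) :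
    forwardSideChannel (wordChannel W n) (wordKernel₁ q) (wordLaw₂ q) (wordKernel₂ q) v₁
      (fun t => (o t).1, fun t => (o t).2) = ∏ t, (q t).forward W (v₁ t) (o t) := by
  simp only [Ensemble.forward, forwardSideChannel, sideChannel, forwardChannel_word,
    Finset.prod_mul_distrib]
  congr 1
  simp only [outLaw, Fintype.prod_sum, Finset.prod_mul_distrib]
  rfl

lemma backwardSideChannel_word (v₂ : ∀ t, Fin (q t).size₂) (o : Fin n → X₁ × Y₁) :
    backwardSideChannel (wordChannel W n) (wordLaw₁ q) (wordKernel₁ q) (wordKernel₂ q) v₂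
      (fun t => (o t).1, fun t => (o t).2) = ∏ t, (q t).backward W (v₂ t) (o t) := by
  simp only [Ensemble.backward, backwardSideChannel, sideChannel, backwardChannel_word,
    Finset.prod_mul_distrib]
  congr 1
  simp only [outLaw, Fintype.prod_sum, Finset.prod_mul_distrib]
  rfl

lemma leftChannel_word (v : ∀ t, Fin (q t).size₁) (z : Fin n → Z) :
    leftChannel (wordLaw₂ q).1 (eveChannel (wordChannel W n) (wordKernel₁ q) (wordKernel₂ q)) v z =
      ∏ t, leftChannel (q t).p₂.1 ((q t).eve W) (v t) (z t) := by
  simp only [leftChannel, eveChannel_word, Fintype.prod_sum, Finset.prod_mul_distrib]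
  rfl

lemma rightChannel_word (v : ∀ t, Fin (q t).size₂) (z : Fin n → Z) :
    rightChannel (wordLaw₁ q).1 (eveChannel (wordChannel W n) (wordKernel₁ q) (wordKernel₂ q)) v z =
      ∏ t, rightChannel (q t).p₁.1 ((q t).eve W) (v t) (z t) := by
  simp only [rightChannel, eveChannel_word, Fintype.prod_sum, Finset.prod_mul_distrib]
  rfl

namespace Ensemble

variable (E : Ensemble X₁ X₂)

lemma eve_nonneg (v₁ : Fin E.size₁) (v₂ : Fin E.size₂) (z : Z) : 0 ≤ E.eve W v₁ v₂ z :=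
  eveChannel_nonneg W _ _ _ _ _

lemma leftChannel_nonneg (v : Fin E.size₁) (z : Z) : 0 ≤ leftChannel E.p₂.1 (E.eve W) v z :=
  Finset.sum_nonneg fun _ _ => mul_nonneg (E.p₂.2.1 _) (E.eve_nonneg W _ _ _)

lemma rightChannel_nonneg (v : Fin E.size₂) (z : Z) : 0 ≤ rightChannel E.p₁.1 (E.eve W) v z :=
  Finset.sum_nonneg fun _ _ => mul_nonneg (E.p₁.2.1 _) (E.eve_nonneg W _ _ _)

lemma sum_leftChannel (v : Fin E.size₁) : ∑ z, leftChannel E.p₂.1 (E.eve W) v z = 1 := by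
  simp only [leftChannel]
  rw [Finset.sum_comm]
  simp only [← Finset.mul_sum, eve, sum_eveChannel, mul_one, E.p₂.2.2]

lemma sum_rightChannel (v : Fin E.size₂) : ∑ z, rightChannel E.p₁.1 (E.eve W) v z = 1 := by
  simp only [rightChannel]
  rw [Finset.sum_comm]
  simp only [← Finset.mul_sum, eve, sum_eveChannel, mul_one, E.p₁.2.2]

lemma sum_pair : ∑ u : Fin E.size₁ × Fin E.size₂, E.p₁.1 u.1 * E.p₂.1 u.2 = 1 := by
  simp only [Fintype.sum_prod_type, ← Finset.mul_sum, E.p₂.2.2, mul_one, E.p₁.2.2]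

end Ensemble

lemma moment_forward_word (s : ℝ) :
    moment (wordLaw₁ q).1
      (forwardSideChannel (wordChannel W n) (wordKernel₁ q) (wordLaw₂ q) (wordKernel₂ q)) s =
    ∏ t, moment (q t).p₁.1 ((q t).forward W) s :=
  moment_eq_prod (Equiv.refl _) (Equiv.arrowProdEquivProdArrow _ _ _) _ _ _ _
    (fun t => (q t).p₁.2.1) (fun _ => forwardSideChannel_nonneg W _ _ _) (fun _ => rfl)
    (fun v o => forwardSideChannel_word W q v o) s

lemma moment_backward_word (s : ℝ) :
    moment (wordLaw₂ q).1
      (backwardSideChannel (wordChannel W n) (wordLaw₁ q) (wordKernel₁ q) (wordKernel₂ q)) s =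
    ∏ t, moment (q t).p₂.1 ((q t).backward W) s :=
  moment_eq_prod (Equiv.refl _) (Equiv.arrowProdEquivProdArrow _ _ _) _ _ _ _
    (fun t => (q t).p₂.2.1) (fun _ => backwardSideChannel_nonneg W _ _ _) (fun _ => rfl)
    (fun v o => backwardSideChannel_word W q v o) s

lemma moment_left_word (s : ℝ) :
    moment (wordLaw₁ q).1 (leftChannel (wordLaw₂ q).1
      (eveChannel (wordChannel W n) (wordKernel₁ q) (wordKernel₂ q))) s =
    ∏ t, moment (q t).p₁.1 (leftChannel (q t).p₂.1 ((q t).eve W)) s :=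
  moment_eq_prod (Equiv.refl _) (Equiv.refl _) _ _ _ _
    (fun t => (q t).p₁.2.1) (fun t => (q t).leftChannel_nonneg W) (fun _ => rfl)
    (fun v z => leftChannel_word W q v z) s

lemma moment_right_word (s : ℝ) :
    moment (wordLaw₂ q).1 (rightChannel (wordLaw₁ q).1
      (eveChannel (wordChannel W n) (wordKernel₁ q) (wordKernel₂ q))) s =
    ∏ t, moment (q t).p₂.1 (rightChannel (q t).p₁.1 ((q t).eve W)) s :=
  moment_eq_prod (Equiv.refl _) (Equiv.refl _) _ _ _ _
    (fun t => (q t).p₂.2.1) (fun t => (q t).rightChannel_nonneg W) (fun _ => rfl)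
    (fun v z => rightChannel_word W q v z) s

lemma pairMoment_word (s : ℝ) :
    pairMoment (wordLaw₁ q).1 (wordLaw₂ q).1
      (eveChannel (wordChannel W n) (wordKernel₁ q) (wordKernel₂ q)) s =
    ∏ t, pairMoment (q t).p₁.1 (q t).p₂.1 ((q t).eve W) s :=
  moment_eq_prod (Equiv.arrowProdEquivProdArrow _ _ _) (Equiv.refl _)
    (fun t (u : Fin (q t).size₁ × Fin (q t).size₂) => (q t).p₁.1 u.1 * (q t).p₂.1 u.2)
    (fun t u z => (q t).eve W u.1 u.2 z) _ _
    (fun t _ => mul_nonneg ((q t).p₁.2.1 _) ((q t).p₂.2.1 _)) (fun t _ _ => (q t).eve_nonneg W _ _ _)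
    (fun _ => by rw [Finset.prod_mul_distrib]; rfl) (fun v z => eveChannel_word W q _ _ z) s

end Words

/-! ### Single-letter informations as channel informations -/

section LetterInformation

variable {Ω α β γ : Type*} [Fintype Ω] [Fintype α] [Fintype β] [Fintype γ]

lemma log_ratio_eq {x p g q : ℝ} (hx : x = p * g) (hp : 0 ≤ p) :
    x * Real.log (x / (p * q)) = p * g * Real.log (g / q) := by
  subst hx
  rcases hp.eq_or_lt with h | h
  · simp [← h]
  · rw [mul_div_mul_left _ _ h.ne']

lemma mutualInfo_eq_channelInfo {P : Ω → ℝ} {A : Ω → α} {B : Ω → β} {p : α → ℝ} {G : α → β → ℝ}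
    (hp : ∀ a, 0 ≤ p a) (hG1 : ∀ a, ∑ b, G a b = 1)
    (h : ∀ a b, law P (fun ω => (A ω, B ω)) (a, b) = p a * G a b) :
    mutualInfo P A B = channelInfo p G := by
  have hA : ∀ a, law P A a = p a := fun a => by
    rw [law_eq_sum_right P A B]
    simp only [h, ← Finset.mul_sum, hG1, mul_one]
  have hB : ∀ b, law P B b = outLaw p G b := fun b => by
    rw [law_eq_sum_left P A B]
    simp only [h, outLaw]
  simp only [mutualInfo, channelInfo, hA, hB]
  exact Finset.sum_congr rfl fun a _ => Finset.sum_congr rfl fun b _ =>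
    log_ratio_eq (h a b) (hp a)

lemma mutualInfo_comm (P : Ω → ℝ) (A : Ω → α) (B : Ω → β) :
    mutualInfo P A B = mutualInfo P B A := by
  classical
  have h : ∀ a b, law P (fun ω => (A ω, B ω)) (a, b) = law P (fun ω => (B ω, A ω)) (b, a) := by
    intro a b
    simp only [law, Prod.mk.injEq, and_comm]
  simp only [mutualInfo, h]
  rw [Finset.sum_comm]
  exact Finset.sum_congr rfl fun b _ => Finset.sum_congr rfl fun a _ => by
    rw [mul_comm (law P A a)]

/-- The assumed factorisation makes `B` and `C` independent, so `I(A; B | C) = I(B; C, A)` by the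
chain rule. This identifies the information in the region with that of the side channel used in
decoding. -/
lemma condMutualInfo_eq_channelInfo {P : Ω → ℝ} {A : Ω → α} {B : Ω → β} {C : Ω → γ} {p : β → ℝ}
    {π : γ → ℝ} {T : β → γ → α → ℝ} (hp : ∀ b, 0 ≤ p b) (hp1 : ∑ b, p b = 1) (hπ : ∀ c, 0 ≤ π c)
    (hT1 : ∀ b c, ∑ a, T b c a = 1)
    (h : ∀ a b c, law P (fun ω => (A ω, B ω, C ω)) (a, b, c) = p b * (π c * T b c a)) :
    condMutualInfo P A B C = channelInfo p (fun b (o : γ × α) => π o.1 * T b o.1 o.2) := by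
  have hAC : ∀ a c, law P (fun ω => (A ω, C ω)) (a, c) = ∑ b, p b * (π c * T b c a) := by
    intro a c
    rw [law_eq_sum_middle P A B C]
    simp only [h]
  have hBC : ∀ b c, law P (fun ω => (B ω, C ω)) (b, c) = p b * π c := by
    intro b c
    rw [law_eq_sum_left P A (fun ω => (B ω, C ω))]
    simp only [h, ← Finset.mul_sum, hT1, mul_one]
  have hC : ∀ c, law P C c = π c := by
    intro c
    rw [law_eq_sum_left P B C]
    simp only [hBC, ← Finset.sum_mul, hp1, one_mul]
  simp only [condMutualInfo, channelInfo, hC, hAC, hBC, h, Fintype.sum_prod_type]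
  rw [Finset.sum_comm]
  refine Finset.sum_congr rfl fun b _ => ?_
  rw [Finset.sum_comm]
  refine Finset.sum_congr rfl fun c _ => Finset.sum_congr rfl fun a _ => ?_
  rw [outLaw]
  rcases (hp b).eq_or_lt with h0 | h0
  · simp [← h0]
  rcases (hπ c).eq_or_lt with h1 | h1
  · simp [← h1]
  have e : ∀ q, p b * (π c * T b c a) / π c / (q / π c * (p b * π c / π c)) = π c * T b c a / q := by
    intro q
    field_simp
  rw [e]

variable {X₁ X₂ Y₁ Y₂ Z : Type*}
variable [Fintype X₁] [Fintype X₂] [Fintype Y₁] [Fintype Y₂] [Fintype Z]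
variable (W : Channel X₁ X₂ Y₁ Y₂ Z)

namespace Ensemble

variable (E : Ensemble X₁ X₂)

/-- The joint law of `(V₁, V₂, X₁, X₂)`. -/
def joint (v : Fin E.size₁ × Fin E.size₂ × X₁ × X₂) : ℝ :=
  (E.p₁.1 v.1 * (E.k₁ v.1).1 v.2.2.1) * (E.p₂.1 v.2.1 * (E.k₂ v.2.1).1 v.2.2.2)

lemma law_joint_eve (v : Fin E.size₁ × Fin E.size₂) (z : Z) :
    law (letterLaw W E.joint) (fun ω => ((ω.1.1, ω.1.2.1), ω.2.2.2)) (v, z) =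
      E.p₁.1 v.1 * E.p₂.1 v.2 * E.eve W v.1 v.2 z := by
  classical
  obtain ⟨v₁, v₂⟩ := v
  simp only [law, Prod.mk.injEq, ite_and, Fintype.sum_prod_type, Finset.sum_ite_irrel,
    Finset.sum_const_zero, Finset.sum_ite_eq', Finset.mem_univ, if_true, letterLaw, joint, eve,
    eveChannel, Finset.mul_sum]
  refine Finset.sum_congr rfl fun _ _ => Finset.sum_congr rfl fun _ _ => Finset.sum_congr rfl
    fun _ _ => Finset.sum_congr rfl fun _ _ => ?_
  ring

lemma law_joint_left (v : Fin E.size₁) (z : Z) :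
    law (letterLaw W E.joint) (fun ω => (ω.1.1, ω.2.2.2)) (v, z) =
      E.p₁.1 v * leftChannel E.p₂.1 (E.eve W) v z := by
  classical
  have h : ∀ v₂, law (letterLaw W E.joint) (fun ω => (ω.1.1, ω.1.2.1, ω.2.2.2)) (v, v₂, z) =
      law (letterLaw W E.joint) (fun ω => ((ω.1.1, ω.1.2.1), ω.2.2.2)) ((v, v₂), z) := by
    intro v₂
    simp only [law, Prod.mk.injEq, and_assoc]
  rw [law_eq_sum_middle _ _ (fun ω => ω.1.2.1)]
  simp only [h, law_joint_eve, leftChannel, Finset.mul_sum, mul_assoc]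

lemma law_joint_right (v : Fin E.size₂) (z : Z) :
    law (letterLaw W E.joint) (fun ω => (ω.1.2.1, ω.2.2.2)) (v, z) =
      E.p₂.1 v * rightChannel E.p₁.1 (E.eve W) v z := by
  classical
  have h : ∀ v₁, law (letterLaw W E.joint) (fun ω => (ω.1.2.1, ω.1.1, ω.2.2.2)) (v, v₁, z) =
      law (letterLaw W E.joint) (fun ω => ((ω.1.1, ω.1.2.1), ω.2.2.2)) ((v₁, v), z) := by
    intro v₁
    simp only [law, Prod.mk.injEq, and_assoc, and_left_comm]
  rw [law_eq_sum_middle _ _ (fun ω => ω.1.1)]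
  simp only [h, law_joint_eve, rightChannel, Finset.mul_sum]
  exact Finset.sum_congr rfl fun _ _ => by ring

lemma law_joint_forward (y₂ : Y₂) (v₁ : Fin E.size₁) (x₂ : X₂) :
    law (letterLaw W E.joint) (fun ω => (ω.2.2.1, ω.1.1, ω.1.2.2.2)) (y₂, v₁, x₂) =
      E.p₁.1 v₁ * (outLaw E.p₂.1 (fun v => (E.k₂ v).1) x₂ * forwardChannel W E.k₁ v₁ x₂ y₂) := by
  classical
  simp only [law, Prod.mk.injEq, ite_and, Fintype.sum_prod_type, Finset.sum_ite_irrel,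
    Finset.sum_const_zero, Finset.sum_ite_eq', Finset.mem_univ, if_true, letterLaw, joint,
    forwardChannel, outLaw]
  simp only [Finset.mul_sum, Finset.sum_mul]
  rw [Finset.sum_comm]
  refine Finset.sum_congr rfl fun _ _ => ?_
  rw [Finset.sum_comm]
  refine Finset.sum_congr rfl fun _ _ => ?_
  rw [Finset.sum_comm]
  refine Finset.sum_congr rfl fun _ _ => Finset.sum_congr rfl fun _ _ => ?_
  ring

lemma law_joint_backward (y₁ : Y₁) (v₂ : Fin E.size₂) (x₁ : X₁) :
    law (letterLaw W E.joint) (fun ω => (ω.2.1, ω.1.2.1, ω.1.2.2.1)) (y₁, v₂, x₁) =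
      E.p₂.1 v₂ * (outLaw E.p₁.1 (fun v => (E.k₁ v).1) x₁ * backwardChannel W E.k₂ v₂ x₁ y₁) := by
  classical
  simp only [law, Prod.mk.injEq, ite_and, Fintype.sum_prod_type, Finset.sum_ite_irrel,
    Finset.sum_const_zero, Finset.sum_ite_eq', Finset.mem_univ, if_true, letterLaw, joint,
    backwardChannel, outLaw]
  simp only [Finset.mul_sum, Finset.sum_mul]
  rw [Finset.sum_comm]
  refine Finset.sum_congr rfl fun _ _ => ?_
  rw [Finset.sum_comm]
  refine Finset.sum_congr rfl fun _ _ => ?_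
  rw [Finset.sum_comm]
  refine Finset.sum_congr rfl fun _ _ => Finset.sum_congr rfl fun _ _ => ?_
  ring

lemma infoV₁V₂Z_joint : infoV₁V₂Z W E.joint =
    channelInfo (fun u : Fin E.size₁ × Fin E.size₂ => E.p₁.1 u.1 * E.p₂.1 u.2)
      (fun u z => E.eve W u.1 u.2 z) :=
  mutualInfo_eq_channelInfo (fun _ => mul_nonneg (E.p₁.2.1 _) (E.p₂.2.1 _))
    (fun _ => sum_eveChannel W _ _ _ _)
    fun v z => E.law_joint_eve W v z

lemma infoZV₁_joint :
    infoZV₁ W E.joint = channelInfo E.p₁.1 (leftChannel E.p₂.1 (E.eve W)) := by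
  rw [infoZV₁, mutualInfo_comm]
  exact mutualInfo_eq_channelInfo E.p₁.2.1 (E.sum_leftChannel W)
    (E.law_joint_left W)

lemma infoZV₂_joint :
    infoZV₂ W E.joint = channelInfo E.p₂.1 (rightChannel E.p₁.1 (E.eve W)) := by
  rw [infoZV₂, mutualInfo_comm]
  exact mutualInfo_eq_channelInfo E.p₂.2.1 (E.sum_rightChannel W)
    (E.law_joint_right W)

lemma infoY₂V₁_joint : infoY₂V₁ W E.joint = channelInfo E.p₁.1 (E.forward W) :=
  condMutualInfo_eq_channelInfo E.p₁.2.1 E.p₁.2.2 (outLaw_nonneg E.p₂.2.1 fun v x => (E.k₂ v).2.1 x)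
    (sum_forwardChannel W E.k₁) (E.law_joint_forward W)

lemma infoY₁V₂_joint : infoY₁V₂ W E.joint = channelInfo E.p₂.1 (E.backward W) :=
  condMutualInfo_eq_channelInfo E.p₂.2.1 E.p₂.2.2 (outLaw_nonneg E.p₁.2.1 fun v x => (E.k₁ v).2.1 x)
    (sum_backwardChannel W E.k₂) (E.law_joint_backward W)

end Ensemble

end LetterInformation

/-! ### Time sharing -/

section TimeSharing

variable {J : Type*} [Fintype J]

/-- An i.i.d. time-sharing sequence is formally a random codebook indexed by positions. Its mean
turns a product of letter moments into the `n`-th power of the mixed moment, for arbitrary real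
weights. -/
lemma codeMean_prod (w : J → ℝ) (f : J → ℝ) (n : ℕ) :
    codeMean w (fun q : Fin n → J => ∏ t, f (q t)) = (∑ j, w j * f j) ^ n := by
  classical
  have h := Fintype.prod_sum (fun (_ : Fin n) (j : J) => w j * f j)
  rw [Finset.prod_const, Finset.card_univ, Fintype.card_fin] at h
  rw [h]
  simp only [codeMean, Finset.prod_mul_distrib]
  convert rfl

variable {X₁ X₂ Y₁ Y₂ Z : Type*}
variable [Fintype X₁] [Fintype X₂] [Fintype Y₁] [Fintype Y₂] [Fintype Z]
variable (W : Channel X₁ X₂ Y₁ Y₂ Z) (E : J → Ensemble X₁ X₂) (w : stdSimplex ℝ J)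

/-- The mean over the time-sharing variable of the moments of the information density between
`V₁` and `(X₂, Y₂)`. -/
def mixForward (s : ℝ) : ℝ := ∑ j, w.1 j * moment (E j).p₁.1 ((E j).forward W) s

/-- The mean over the time-sharing variable of the moments of the information density between
`V₂` and `(X₁, Y₁)`. -/
def mixBackward (s : ℝ) : ℝ := ∑ j, w.1 j * moment (E j).p₂.1 ((E j).backward W) s

/-- The mean over the time-sharing variable of the moments of the information density between
`(V₁, V₂)` and `Z`. -/
def mixPair (s : ℝ) : ℝ := ∑ j, w.1 j * pairMoment (E j).p₁.1 (E j).p₂.1 ((E j).eve W) s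

/-- The mean over the time-sharing variable of the moments of the information density between
`V₁` and `Z`. -/
def mixLeft (s : ℝ) : ℝ :=
  ∑ j, w.1 j * moment (E j).p₁.1 (leftChannel (E j).p₂.1 ((E j).eve W)) s

/-- The mean over the time-sharing variable of the moments of the information density between
`V₂` and `Z`. -/
def mixRight (s : ℝ) : ℝ :=
  ∑ j, w.1 j * moment (E j).p₂.1 (rightChannel (E j).p₁.1 ((E j).eve W)) s

/-- The decoding bound for time sharing. -/
def mixDecoding (F : ℝ → ℝ) (s θ : ℝ) (M L n : ℕ) : ℝ :=
  if M = 1 then 0 else θ ^ s * F (-s) ^ n + M * L / θ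

/-- The covering bound for time sharing. -/
def mixCovering (s N₁ N₂ : ℝ) (n : ℕ) : ℝ :=
  s⁻¹ * ((N₁ * N₂) ^ (-s) * mixPair W E w s ^ n + N₁ ^ (-s) * mixLeft W E w s ^ n +
    N₂ ^ (-s) * mixRight W E w s ^ n)

lemma codeMean_forwardBound (n M L : ℕ) (s θ : ℝ) :
    codeMean w.1 (fun q : Fin n → J => forwardBound W (wordLaw₁ fun t => E (q t))
      (wordKernel₁ fun t => E (q t)) (wordLaw₂ fun t => E (q t)) (wordKernel₂ fun t => E (q t))
      M L s θ) = mixDecoding (mixForward W E w) s θ M L n := by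
  simp only [forwardBound, mixDecoding]
  split_ifs
  · exact codeMean_const w 0
  · simp only [decodingBound, moment_forward_word]
    rw [codeMean_add, codeMean_const_mul, codeMean_const,
      codeMean_prod w.1 (fun j => moment (E j).p₁.1 ((E j).forward W) (-s)) n]
    rfl

lemma codeMean_backwardBound (n M L : ℕ) (s θ : ℝ) :
    codeMean w.1 (fun q : Fin n → J => backwardBound W (wordLaw₁ fun t => E (q t))
      (wordKernel₁ fun t => E (q t)) (wordLaw₂ fun t => E (q t)) (wordKernel₂ fun t => E (q t))
      M L s θ) = mixDecoding (mixBackward W E w) s θ M L n := by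
  simp only [backwardBound, mixDecoding]
  split_ifs
  · exact codeMean_const w 0
  · simp only [decodingBound, moment_backward_word]
    rw [codeMean_add, codeMean_const_mul, codeMean_const,
      codeMean_prod w.1 (fun j => moment (E j).p₂.1 ((E j).backward W) (-s)) n]
    rfl

lemma codeMean_coveringBound (n : ℕ) (s N₁ N₂ : ℝ) :
    codeMean w.1 (fun q : Fin n → J => coveringBound (wordLaw₁ fun t => E (q t)).1
      (wordLaw₂ fun t => E (q t)).1 (eveChannel (wordChannel W n) (wordKernel₁ fun t => E (q t))
        (wordKernel₂ fun t => E (q t))) s N₁ N₂) = mixCovering W E w s N₁ N₂ n := by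
  simp only [coveringBound, pairMoment_word, moment_left_word, moment_right_word]
  rw [codeMean_const_mul, codeMean_add, codeMean_add, codeMean_const_mul, codeMean_const_mul,
    codeMean_const_mul,
    codeMean_prod w.1 (fun j => pairMoment (E j).p₁.1 (E j).p₂.1 ((E j).eve W) s) n,
    codeMean_prod w.1 (fun j => moment (E j).p₁.1 (leftChannel (E j).p₂.1 ((E j).eve W)) s) n,
    codeMean_prod w.1 (fun j => moment (E j).p₂.1 (rightChannel (E j).p₁.1 ((E j).eve W)) s) n]
  rfl

variable {W E w} {n M₁ L₁ M₂ L₂ : ℕ} {s θ₁ θ₂ : ℝ}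

/-- The averaged bound is attained by some fixed time-sharing sequence, so the users need no common
randomness. -/
theorem exists_code_joint_timeSharing (hM₁ : 0 < M₁) (hL₁ : 0 < L₁) (hM₂ : 0 < M₂) (hL₂ : 0 < L₂)
    (hs : 0 < s) (hs1 : s ≤ 1) (hθ₁ : 0 < θ₁) (hθ₂ : 0 < θ₂) {r : ℝ}
    (hr : mixDecoding (mixForward W E w) s θ₁ M₁ L₁ n +
      mixDecoding (mixBackward W E w) s θ₂ M₂ L₂ n + mixCovering W E w s L₁ L₂ n ≤ r) :
    ∃ C : Code X₁ X₂ Y₁ Y₂ n, C.M₁ = M₁ ∧ C.M₂ = M₂ ∧ C.errorProb W ≤ r ∧ C.leakJoint W ≤ r := by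
  rw [← codeMean_forwardBound, ← codeMean_backwardBound, ← codeMean_coveringBound,
    ← codeMean_add, ← codeMean_add] at hr
  obtain ⟨q, -, hq⟩ := exists_of_codeMean_le w hr
  exact exists_code_joint W _ _ _ _ hM₁ hL₁ hM₂ hL₂ hs hs1 hθ₁ hθ₂ hq

theorem exists_code_individual_timeSharing (hM₁ : 0 < M₁) (hL₁ : 0 < L₁) (hM₂ : 0 < M₂)
    (hL₂ : 0 < L₂) (hs : 0 < s) (hs1 : s ≤ 1) (hθ₁ : 0 < θ₁) (hθ₂ : 0 < θ₂) {r : ℝ}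
    (hr : mixDecoding (mixForward W E w) s θ₁ M₁ L₁ n +
      mixDecoding (mixBackward W E w) s θ₂ M₂ L₂ n +
      (mixCovering W E w s L₁ (M₂ * L₂) n + mixCovering W E w s (M₁ * L₁) L₂ n) ≤ r) :
    ∃ C : Code X₁ X₂ Y₁ Y₂ n, C.M₁ = M₁ ∧ C.M₂ = M₂ ∧ C.errorProb W ≤ r ∧ C.leak₁ W ≤ r ∧
      C.leak₂ W ≤ r := by
  rw [← codeMean_forwardBound, ← codeMean_backwardBound, ← codeMean_coveringBound,
    ← codeMean_coveringBound, ← codeMean_add, ← codeMean_add, ← codeMean_add] at hr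
  obtain ⟨q, -, hq⟩ := exists_of_codeMean_le w hr
  exact exists_code_individual W _ _ _ _ hM₁ hL₁ hM₂ hL₂ hs hs1 hθ₁ hθ₂ hq

/-! ### Exponential decay of the bounds -/

lemma hasDerivAt_sum_mul {f : J → ℝ → ℝ} {f' : J → ℝ} {x : ℝ} (w : J → ℝ)
    (h : ∀ j, HasDerivAt (f j) (f' j) x) :
    HasDerivAt (fun s => ∑ j, w j * f j s) (∑ j, w j * f' j) x :=
  HasDerivAt.fun_sum fun j _ => (h j).const_mul (w j)

variable (W E w)

lemma hasDerivAt_mixForward :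
    HasDerivAt (mixForward W E w) (∑ j, w.1 j * infoY₂V₁ W (E j).joint) 0 :=
  hasDerivAt_sum_mul w.1 fun j => by
    rw [Ensemble.infoY₂V₁_joint]
    exact hasDerivAt_moment (E j).p₁.2.1 (forwardSideChannel_nonneg W _ _ _)

lemma hasDerivAt_mixBackward :
    HasDerivAt (mixBackward W E w) (∑ j, w.1 j * infoY₁V₂ W (E j).joint) 0 :=
  hasDerivAt_sum_mul w.1 fun j => by
    rw [Ensemble.infoY₁V₂_joint]
    exact hasDerivAt_moment (E j).p₂.2.1 (backwardSideChannel_nonneg W _ _ _)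

lemma hasDerivAt_mixLeft :
    HasDerivAt (mixLeft W E w) (∑ j, w.1 j * infoZV₁ W (E j).joint) 0 :=
  hasDerivAt_sum_mul w.1 fun j => by
    rw [Ensemble.infoZV₁_joint]
    exact hasDerivAt_moment (E j).p₁.2.1 ((E j).leftChannel_nonneg W)

lemma hasDerivAt_mixRight :
    HasDerivAt (mixRight W E w) (∑ j, w.1 j * infoZV₂ W (E j).joint) 0 :=
  hasDerivAt_sum_mul w.1 fun j => by
    rw [Ensemble.infoZV₂_joint]
    exact hasDerivAt_moment (E j).p₂.2.1 ((E j).rightChannel_nonneg W)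

lemma hasDerivAt_mixPair :
    HasDerivAt (mixPair W E w) (∑ j, w.1 j * infoV₁V₂Z W (E j).joint) 0 :=
  hasDerivAt_sum_mul w.1 fun j => by
    rw [Ensemble.infoV₁V₂Z_joint]
    exact hasDerivAt_moment (fun _ => mul_nonneg ((E j).p₁.2.1 _) ((E j).p₂.2.1 _))
      (fun _ _ => (E j).eve_nonneg W _ _ _)

lemma sum_mul_eq_one {f : J → ℝ} (h : ∀ j, f j = 1) : ∑ j, w.1 j * f j = 1 := by
  simp only [h, mul_one, w.2.2]

lemma mixForward_zero : mixForward W E w 0 = 1 :=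
  sum_mul_eq_one w fun j => moment_zero (E j).p₁.2.2 (sum_forwardSideChannel W _ _ _)

lemma mixBackward_zero : mixBackward W E w 0 = 1 :=
  sum_mul_eq_one w fun j => moment_zero (E j).p₂.2.2 (sum_backwardSideChannel W _ _ _)

lemma mixLeft_zero : mixLeft W E w 0 = 1 :=
  sum_mul_eq_one w fun j => moment_zero (E j).p₁.2.2 ((E j).sum_leftChannel W)

lemma mixRight_zero : mixRight W E w 0 = 1 :=
  sum_mul_eq_one w fun j => moment_zero (E j).p₂.2.2 ((E j).sum_rightChannel W)

lemma mixPair_zero : mixPair W E w 0 = 1 :=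
  sum_mul_eq_one w fun j => moment_zero (E j).sum_pair fun _ => sum_eveChannel W _ _ _ _

lemma mixForward_nonneg (s : ℝ) : 0 ≤ mixForward W E w s :=
  Finset.sum_nonneg fun j _ => mul_nonneg (w.2.1 j)
    (moment_nonneg (E j).p₁.2.1 (forwardSideChannel_nonneg W _ _ _) s)

lemma mixBackward_nonneg (s : ℝ) : 0 ≤ mixBackward W E w s :=
  Finset.sum_nonneg fun j _ => mul_nonneg (w.2.1 j)
    (moment_nonneg (E j).p₂.2.1 (backwardSideChannel_nonneg W _ _ _) s)

lemma mixLeft_nonneg (s : ℝ) : 0 ≤ mixLeft W E w s :=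
  Finset.sum_nonneg fun j _ => mul_nonneg (w.2.1 j)
    (moment_nonneg (E j).p₁.2.1 ((E j).leftChannel_nonneg W) s)

lemma mixRight_nonneg (s : ℝ) : 0 ≤ mixRight W E w s :=
  Finset.sum_nonneg fun j _ => mul_nonneg (w.2.1 j)
    (moment_nonneg (E j).p₂.2.1 ((E j).rightChannel_nonneg W) s)

lemma mixPair_nonneg (s : ℝ) : 0 ≤ mixPair W E w s :=
  Finset.sum_nonneg fun j _ => mul_nonneg (w.2.1 j)
    (moment_nonneg (fun _ => mul_nonneg ((E j).p₁.2.1 _) ((E j).p₂.2.1 _))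
      (fun _ _ => (E j).eve_nonneg W _ _ _) s)

lemma eventually_lt_of_hasDerivAt_neg {g : ℝ → ℝ} {g' : ℝ} (hg : HasDerivAt g g' 0) (h : g' < 0) :
    ∀ᶠ s in 𝓝[>] (0 : ℝ), g s < g 0 := by
  have h1 := hasDerivAt_iff_tendsto_slope.1 hg
  have h2 := (h1.mono_left (nhdsWithin_mono 0 fun x (hx : 0 < x) => hx.ne')).eventually_lt_const h
  filter_upwards [h2, self_mem_nhdsWithin] with s hs (hs0 : 0 < s)
  rw [slope_def_field, sub_zero, div_neg_iff] at hs
  rcases hs with hs | hs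
  · linarith [hs.2]
  · linarith [hs.1]

/-- The function equals 1 at `s = 0` and has derivative `I - ρ < 0` there. -/
lemma eventually_exp_neg_mul_lt_one {F : ℝ → ℝ} {I ρ : ℝ} (hF : HasDerivAt F I 0) (h0 : F 0 = 1)
    (h : I < ρ) : ∀ᶠ s in 𝓝[>] (0 : ℝ), Real.exp (-(s * ρ)) * F s < 1 := by
  have h1 : HasDerivAt (fun s : ℝ => Real.exp (-(s * ρ)) * F s) (I - ρ) 0 := by
    have := (((hasDerivAt_id (0 : ℝ)).mul_const ρ).neg.exp).mul hF
    convert! this using 1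
    simp [h0]
    ring
  simpa [h0] using eventually_lt_of_hasDerivAt_neg h1 (by linarith)

lemma eventually_exp_mul_lt_one {F : ℝ → ℝ} {I ρ : ℝ} (hF : HasDerivAt F I 0) (h0 : F 0 = 1)
    (h : ρ < I) : ∀ᶠ s in 𝓝[>] (0 : ℝ), Real.exp (s * ρ) * F (-s) < 1 := by
  have h2 : HasDerivAt (fun s : ℝ => F (-s)) (-I) 0 := by
    have hF' : HasDerivAt F I (-0) := by simpa using hF
    have h := hF'.comp (0 : ℝ) (hasDerivAt_neg (0 : ℝ))
    rwa [mul_neg_one] at h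
  have := eventually_exp_neg_mul_lt_one (ρ := -ρ) h2 (by simpa using h0) (by linarith)
  simpa using this

/-- The number `⌈exp (n r)⌉` of messages of rate `r`. -/
def expCeil (r : ℝ) (n : ℕ) : ℕ := ⌈Real.exp (n * r)⌉₊

lemma expCeil_pos (r : ℝ) (n : ℕ) : 0 < expCeil r n := Nat.ceil_pos.2 (Real.exp_pos _)

lemma exp_le_expCeil (r : ℝ) (n : ℕ) : Real.exp (n * r) ≤ expCeil r n := Nat.le_ceil _

lemma expCeil_le {r : ℝ} (hr : 0 ≤ r) (n : ℕ) : (expCeil r n : ℝ) ≤ 2 * Real.exp (n * r) := by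
  have h1 := (Nat.ceil_lt_add_one (Real.exp_pos (n * r)).le).le
  have h2 : 1 ≤ Real.exp (n * r) := Real.one_le_exp (by positivity)
  change (expCeil r n : ℝ) ≤ _ at h1
  linarith

/-- Rate zero means exactly one message, which is the case where the decoding bound is 0. -/
lemma expCeil_zero (n : ℕ) : expCeil 0 n = 1 := by simp [expCeil]

lemma tendsto_log_expCeil_div {r : ℝ} (hr : 0 ≤ r) :
    Tendsto (fun n : ℕ => Real.log (expCeil r n) / n) atTop (𝓝 r) := by
  have h2 : Tendsto (fun n : ℕ => Real.log 2 / (n : ℝ) + r) atTop (𝓝 r) := by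
    simpa using (tendsto_const_div_atTop_nhds_zero_nat (Real.log 2)).add_const r
  refine tendsto_of_tendsto_of_tendsto_of_le_of_le' tendsto_const_nhds h2 ?_ ?_
  · filter_upwards [eventually_gt_atTop 0] with n hn
    have hn' : (0 : ℝ) < n := by exact_mod_cast hn
    rw [le_div_iff₀ hn', mul_comm]
    exact (Real.le_log_iff_exp_le (by exact_mod_cast expCeil_pos r n)).2 (exp_le_expCeil r n)
  · filter_upwards [eventually_gt_atTop 0] with n hn
    have hn' : (0 : ℝ) < n := by exact_mod_cast hn
    rw [div_le_iff₀ hn', add_mul, div_mul_cancel₀ _ hn'.ne', mul_comm r]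
    have h := Real.log_le_log (by exact_mod_cast expCeil_pos r n) (expCeil_le hr n)
    rwa [Real.log_mul two_ne_zero (Real.exp_pos _).ne', Real.log_exp] at h

/-- With threshold `exp (n g)`, misses contribute `(exp (s g) F(-s)) ^ n` and false alarms at most
`4 exp (n (r + r' - g))`. The 4 is a factor 2 for each of the two rounded codebook sizes. -/
lemma tendsto_mixDecoding {F : ℝ → ℝ} {s g r r' : ℝ} (hF : 0 ≤ F (-s)) (hr : 0 ≤ r) (hr' : 0 ≤ r')
    (h : r = 0 ∨ r + r' < g ∧ Real.exp (s * g) * F (-s) < 1) :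
    Tendsto (fun n : ℕ => mixDecoding F s (Real.exp (n * g)) (expCeil r n) (expCeil r' n) n)
      atTop (𝓝 0) := by
  rcases h with rfl | ⟨h1, h2⟩
  · simp [mixDecoding, expCeil_zero]
  · have ht : Tendsto (fun n : ℕ => (Real.exp (s * g) * F (-s)) ^ n +
        4 * Real.exp (r + r' - g) ^ n) atTop (𝓝 0) := by
      simpa using (tendsto_pow_atTop_nhds_zero_of_lt_one (by positivity) h2).add
        ((tendsto_pow_atTop_nhds_zero_of_lt_one (Real.exp_pos _).le
          (Real.exp_lt_one_iff.2 (by linarith : r + r' - g < 0))).const_mul 4)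
    refine squeeze_zero (fun n => ?_) (fun n => ?_) ht
    · rw [mixDecoding]
      split_ifs
      · exact le_rfl
      · positivity
    · rw [mixDecoding]
      split_ifs
      · positivity
      · refine add_le_add (le_of_eq ?_) ?_
        · rw [mul_pow, ← Real.exp_mul, ← Real.exp_nat_mul]
          ring_nf
        · rw [div_le_iff₀ (Real.exp_pos _), ← Real.exp_nat_mul, mul_assoc, ← Real.exp_add]
          calc (expCeil r n : ℝ) * expCeil r' n
              ≤ (2 * Real.exp (n * r)) * (2 * Real.exp (n * r')) := by
                gcongr
                · exact expCeil_le hr n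
                · exact expCeil_le hr' n
            _ = 4 * Real.exp (n * (r + r' - g) + n * g) := by
                rw [mul_mul_mul_comm, ← Real.exp_add]
                ring_nf

lemma rpow_neg_mul_pow_le {N ρ s x : ℝ} {n : ℕ} (hs : 0 < s) (hx : 0 ≤ x)
    (hN : Real.exp (n * ρ) ≤ N) : N ^ (-s) * x ^ n ≤ (Real.exp (-(s * ρ)) * x) ^ n := by
  have h : N ^ (-s) ≤ Real.exp (n * ρ) ^ (-s) :=
    Real.rpow_le_rpow_of_nonpos (Real.exp_pos _) hN (by linarith)
  rw [mul_pow]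
  refine mul_le_mul_of_nonneg_right (h.trans_eq ?_) (by positivity)
  rw [← Real.exp_mul, ← Real.exp_nat_mul]
  ring_nf

lemma tendsto_mixCovering {s ρ₁ ρ₂ : ℝ} {N₁ N₂ : ℕ → ℝ} (hs : 0 < s)
    (hN₁ : ∀ n : ℕ, Real.exp (n * ρ₁) ≤ N₁ n) (hN₂ : ∀ n : ℕ, Real.exp (n * ρ₂) ≤ N₂ n)
    (hP : Real.exp (-(s * (ρ₁ + ρ₂))) * mixPair W E w s < 1)
    (hL : Real.exp (-(s * ρ₁)) * mixLeft W E w s < 1)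
    (hR : Real.exp (-(s * ρ₂)) * mixRight W E w s < 1) :
    Tendsto (fun n => mixCovering W E w s (N₁ n) (N₂ n) n) atTop (𝓝 0) := by
  have hP0 := mixPair_nonneg W E w s
  have hL0 := mixLeft_nonneg W E w s
  have hR0 := mixRight_nonneg W E w s
  have hp₁ : ∀ n, 0 < N₁ n := fun n => (Real.exp_pos _).trans_le (hN₁ n)
  have hp₂ : ∀ n, 0 < N₂ n := fun n => (Real.exp_pos _).trans_le (hN₂ n)
  have ht : Tendsto (fun n : ℕ => s⁻¹ * ((Real.exp (-(s * (ρ₁ + ρ₂))) * mixPair W E w s) ^ n +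
      (Real.exp (-(s * ρ₁)) * mixLeft W E w s) ^ n +
      (Real.exp (-(s * ρ₂)) * mixRight W E w s) ^ n)) atTop (𝓝 0) := by
    simpa using (((tendsto_pow_atTop_nhds_zero_of_lt_one (by positivity) hP).add
      (tendsto_pow_atTop_nhds_zero_of_lt_one (by positivity) hL)).add
      (tendsto_pow_atTop_nhds_zero_of_lt_one (by positivity) hR)).const_mul s⁻¹
  refine squeeze_zero (fun n => ?_) (fun n => ?_) ht
  · have := hp₁ n
    have := hp₂ n
    rw [mixCovering]
    positivity
  · rw [mixCovering]
    gcongr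
    · refine rpow_neg_mul_pow_le hs hP0 ?_
      rw [mul_add, Real.exp_add]
      exact mul_le_mul (hN₁ n) (hN₂ n) (Real.exp_pos _).le (hp₁ n).le
    · exact rpow_neg_mul_pow_le hs hL0 (hN₁ n)
    · exact rpow_neg_mul_pow_le hs hR0 (hN₂ n)

lemma exists_rate_between {r r' I : ℝ} (h : r = 0 ∨ r + r' < I) :
    ∃ g, (r = 0 ∨ r + r' < g) ∧ g < I := by
  rcases h with h | h
  -- With a single message the threshold plays no role; any value below `I` will do.
  · exact ⟨I - 1, Or.inl h, by linarith⟩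
  · obtain ⟨g, h1, h2⟩ := exists_between h
    exact ⟨g, Or.inr h1, h2⟩

variable {r₁ r₁' r₂ r₂' : ℝ}

theorem exists_codes_joint (hr₁ : 0 ≤ r₁) (hr₁' : 0 ≤ r₁') (hr₂ : 0 ≤ r₂) (hr₂' : 0 ≤ r₂')
    (h₁ : r₁ = 0 ∨ r₁ + r₁' < ∑ j, w.1 j * infoY₂V₁ W (E j).joint)
    (h₂ : r₂ = 0 ∨ r₂ + r₂' < ∑ j, w.1 j * infoY₁V₂ W (E j).joint)
    (hl : ∑ j, w.1 j * infoZV₁ W (E j).joint < r₁') (hr : ∑ j, w.1 j * infoZV₂ W (E j).joint < r₂')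
    (hp : ∑ j, w.1 j * infoV₁V₂Z W (E j).joint < r₁' + r₂') :
    ∃ B : ℕ → ℝ, Tendsto B atTop (𝓝 0) ∧ ∀ n, ∃ C : Code X₁ X₂ Y₁ Y₂ n, C.M₁ = expCeil r₁ n ∧
      C.M₂ = expCeil r₂ n ∧ C.errorProb W ≤ B n ∧ C.leakJoint W ≤ B n := by
  obtain ⟨g₁, hg₁, hg₁'⟩ := exists_rate_between h₁
  obtain ⟨g₂, hg₂, hg₂'⟩ := exists_rate_between h₂
  -- Each exponent condition holds for all small `s > 0`, so a single `s ≤ 1` satisfies them all.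
  have hev := (eventually_mem_set.2 (Ioc_mem_nhdsGT (one_pos : (0 : ℝ) < 1))).and <|
    (eventually_exp_mul_lt_one (hasDerivAt_mixForward W E w) (mixForward_zero W E w) hg₁').and <|
    (eventually_exp_mul_lt_one (hasDerivAt_mixBackward W E w) (mixBackward_zero W E w) hg₂').and <|
    (eventually_exp_neg_mul_lt_one (hasDerivAt_mixLeft W E w) (mixLeft_zero W E w) hl).and <|
    (eventually_exp_neg_mul_lt_one (hasDerivAt_mixRight W E w) (mixRight_zero W E w) hr).and <|
    eventually_exp_neg_mul_lt_one (hasDerivAt_mixPair W E w) (mixPair_zero W E w) hp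
  obtain ⟨s, ⟨hs, hs1⟩, e₁, e₂, el, er, ep⟩ := hev.exists
  have t₁ := tendsto_mixDecoding (mixForward_nonneg W E w (-s)) hr₁ hr₁' (hg₁.imp_right (⟨·, e₁⟩))
  have t₂ := tendsto_mixDecoding (mixBackward_nonneg W E w (-s)) hr₂ hr₂' (hg₂.imp_right (⟨·, e₂⟩))
  have t₃ := tendsto_mixCovering W E w hs (exp_le_expCeil r₁') (exp_le_expCeil r₂') ep el er
  refine ⟨_, by simpa only [add_zero] using (t₁.add t₂).add t₃, fun n => ?_⟩
  exact exists_code_joint_timeSharing (expCeil_pos _ _) (expCeil_pos _ _) (expCeil_pos _ _)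
    (expCeil_pos _ _) hs hs1 (Real.exp_pos _) (Real.exp_pos _) le_rfl

lemma exp_le_expCeil_mul_expCeil (r r' : ℝ) (n : ℕ) :
    Real.exp (n * (r + r')) ≤ (expCeil r n : ℝ) * expCeil r' n := by
  rw [mul_add, Real.exp_add]
  exact mul_le_mul (exp_le_expCeil r n) (exp_le_expCeil r' n) (Real.exp_pos _).le (by positivity)

theorem exists_codes_individual (hr₁ : 0 ≤ r₁) (hr₁' : 0 ≤ r₁') (hr₂ : 0 ≤ r₂) (hr₂' : 0 ≤ r₂')
    (h₁ : r₁ = 0 ∨ r₁ + r₁' < ∑ j, w.1 j * infoY₂V₁ W (E j).joint)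
    (h₂ : r₂ = 0 ∨ r₂ + r₂' < ∑ j, w.1 j * infoY₁V₂ W (E j).joint)
    (hl : ∑ j, w.1 j * infoZV₁ W (E j).joint < r₁') (hr : ∑ j, w.1 j * infoZV₂ W (E j).joint < r₂')
    (hp₁ : ∑ j, w.1 j * infoV₁V₂Z W (E j).joint < r₁' + (r₂ + r₂'))
    (hp₂ : ∑ j, w.1 j * infoV₁V₂Z W (E j).joint < (r₁ + r₁') + r₂') :
    ∃ B : ℕ → ℝ, Tendsto B atTop (𝓝 0) ∧ ∀ n, ∃ C : Code X₁ X₂ Y₁ Y₂ n, C.M₁ = expCeil r₁ n ∧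
      C.M₂ = expCeil r₂ n ∧ C.errorProb W ≤ B n ∧ C.leak₁ W ≤ B n ∧ C.leak₂ W ≤ B n := by
  obtain ⟨g₁, hg₁, hg₁'⟩ := exists_rate_between h₁
  obtain ⟨g₂, hg₂, hg₂'⟩ := exists_rate_between h₂
  -- When the whole codebook of a user acts as randomness, its covering condition follows from that
  -- of a single row.
  have hl' : ∑ j, w.1 j * infoZV₁ W (E j).joint < r₁ + r₁' := by linarith
  have hr' : ∑ j, w.1 j * infoZV₂ W (E j).joint < r₂ + r₂' := by linarith
  have hev := (eventually_mem_set.2 (Ioc_mem_nhdsGT (one_pos : (0 : ℝ) < 1))).and <|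
    (eventually_exp_mul_lt_one (hasDerivAt_mixForward W E w) (mixForward_zero W E w) hg₁').and <|
    (eventually_exp_mul_lt_one (hasDerivAt_mixBackward W E w) (mixBackward_zero W E w) hg₂').and <|
    (eventually_exp_neg_mul_lt_one (hasDerivAt_mixLeft W E w) (mixLeft_zero W E w) hl).and <|
    (eventually_exp_neg_mul_lt_one (hasDerivAt_mixRight W E w) (mixRight_zero W E w) hr).and <|
    (eventually_exp_neg_mul_lt_one (hasDerivAt_mixLeft W E w) (mixLeft_zero W E w) hl').and <|
    (eventually_exp_neg_mul_lt_one (hasDerivAt_mixRight W E w) (mixRight_zero W E w) hr').and <|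
    (eventually_exp_neg_mul_lt_one (hasDerivAt_mixPair W E w) (mixPair_zero W E w) hp₁).and <|
    eventually_exp_neg_mul_lt_one (hasDerivAt_mixPair W E w) (mixPair_zero W E w) hp₂
  obtain ⟨s, ⟨hs, hs1⟩, e₁, e₂, el, er, el', er', ep₁, ep₂⟩ := hev.exists
  have t₁ := tendsto_mixDecoding (mixForward_nonneg W E w (-s)) hr₁ hr₁' (hg₁.imp_right (⟨·, e₁⟩))
  have t₂ := tendsto_mixDecoding (mixBackward_nonneg W E w (-s)) hr₂ hr₂' (hg₂.imp_right (⟨·, e₂⟩))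
  have t₃ := tendsto_mixCovering W E w hs (exp_le_expCeil r₁')
    (exp_le_expCeil_mul_expCeil r₂ r₂') ep₁ el er'
  have t₄ := tendsto_mixCovering W E w hs (exp_le_expCeil_mul_expCeil r₁ r₁')
    (exp_le_expCeil r₂') ep₂ el' er
  refine ⟨_, by simpa only [add_zero] using (t₁.add t₂).add (t₃.add t₄), fun n => ?_⟩
  exact exists_code_individual_timeSharing (expCeil_pos _ _) (expCeil_pos _ _) (expCeil_pos _ _)
    (expCeil_pos _ _) hs hs1 (Real.exp_pos _) (Real.exp_pos _) le_rfl

end TimeSharing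

/-! ### From approximate achievability to code sequences -/

section Achievability

variable {X₁ X₂ Y₁ Y₂ Z : Type*}
variable [Fintype X₁] [Fintype X₂] [Fintype Y₁] [Fintype Y₂] [Fintype Z]
variable (W : Channel X₁ X₂ Y₁ Y₂ Z) (leak : ∀ {n : ℕ}, Code X₁ X₂ Y₁ Y₂ n → ℝ)

/-- The rate pairs that are approximated by long codes with a small error probability and a small
leakage. -/
def approxAchievable : Set (ℝ × ℝ) :=
  {R | ∀ δ > 0, ∀ᶠ n in atTop, ∃ C : Code X₁ X₂ Y₁ Y₂ n,
    |C.rate₁ - R.1| < δ ∧ |C.rate₂ - R.2| < δ ∧ C.errorProb W < δ ∧ leak C < δ}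

lemma closure_subset_approxAchievable {S : Set (ℝ × ℝ)} (hS : S ⊆ approxAchievable W leak) :
    closure S ⊆ approxAchievable W leak := by
  intro R hR δ hδ
  obtain ⟨R', hR', hd⟩ := Metric.mem_closure_iff.1 hR (δ / 2) (by linarith)
  rw [Prod.dist_eq, max_lt_iff, Real.dist_eq, Real.dist_eq] at hd
  filter_upwards [hS hR' (δ / 2) (by linarith)] with n ⟨C, h1, h2, h3, h4⟩
  refine ⟨C, ?_, ?_, by linarith, by linarith⟩
  · have := abs_sub_le C.rate₁ R'.1 R.1
    rw [abs_sub_comm R'.1] at this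
    linarith [hd.1]
  · have := abs_sub_le C.rate₂ R'.2 R.2
    rw [abs_sub_comm R'.2] at this
    linarith [hd.2]

lemma nonempty_code [Nonempty X₁] [Nonempty X₂] (n : ℕ) : Nonempty (Code X₁ X₂ Y₁ Y₂ n) := by
  classical
  obtain ⟨x₁⟩ := ‹Nonempty X₁›
  obtain ⟨x₂⟩ := ‹Nonempty X₂›
  exact ⟨{ M₁ := 1, M₂ := 1, M₁_pos := one_pos, M₂_pos := one_pos
           enc₁ := fun _ => ⟨_, single_mem_stdSimplex ℝ fun _ => x₁⟩
           enc₂ := fun _ => ⟨_, single_mem_stdSimplex ℝ fun _ => x₂⟩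
           dec₁ := fun _ _ => 0, dec₂ := fun _ _ => 0 }⟩

lemma nonempty_of_stdSimplex {α : Type*} [Fintype α] (p : stdSimplex ℝ α) : Nonempty α := by
  by_contra h
  rw [not_nonempty_iff] at h
  have := p.2.2
  simp at this

/-- At each length a nearly optimal code is taken for one figure of merit, the maximum of both rate
deviations, the error probability and the leakage. Its infimum tends to 0 by assumption, so no
diagonal argument over `δ` is needed. -/
lemma exists_codes_of_mem_approxAchievable {R : ℝ × ℝ} (hR : R ∈ approxAchievable W leak) :
    ∃ (C : ∀ n : ℕ, Code X₁ X₂ Y₁ Y₂ n) (ε : ℕ → ℝ),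
      Tendsto (fun n => (C n).rate₁) atTop (𝓝 R.1) ∧
      Tendsto (fun n => (C n).rate₂) atTop (𝓝 R.2) ∧
      (∀ n, (C n).errorProb W ≤ ε n) ∧ (∀ n, leak (C n) ≤ ε n) ∧ Tendsto ε atTop (𝓝 0) := by
  -- A code is required at every length, also the short ones. An encoder of positive length shows
  -- that the input alphabets are nonempty, so that trivial codes exist.
  obtain ⟨n₀, hn₀, C₀, -⟩ := ((eventually_gt_atTop 0).and (hR 1 one_pos)).exists
  have hX₁ : Nonempty X₁ := (nonempty_of_stdSimplex (C₀.enc₁ ⟨0, C₀.M₁_pos⟩)).map fun x => x ⟨0, hn₀⟩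
  have hX₂ : Nonempty X₂ := (nonempty_of_stdSimplex (C₀.enc₂ ⟨0, C₀.M₂_pos⟩)).map fun x => x ⟨0, hn₀⟩
  let f : ∀ n, Code X₁ X₂ Y₁ Y₂ n → ℝ := fun n C =>
    max (max |C.rate₁ - R.1| |C.rate₂ - R.2|) (max (C.errorProb W) (leak C))
  have hf0 : ∀ n C, 0 ≤ f n C := fun n C =>
    (abs_nonneg _).trans ((le_max_left _ _).trans (le_max_left _ _))
  have hbdd : ∀ n, BddBelow (Set.range (f n)) := fun n => ⟨0, by rintro _ ⟨C, rfl⟩; exact hf0 n C⟩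
  have hne : ∀ n, Nonempty (Code X₁ X₂ Y₁ Y₂ n) := fun n => nonempty_code n
  have hinf : Tendsto (fun n => ⨅ C, f n C) atTop (𝓝 0) := by
    refine tendsto_order.2 ⟨fun a ha => Eventually.of_forall fun n =>
      ha.trans_le (le_ciInf fun C => hf0 n C), fun a ha => ?_⟩
    filter_upwards [hR a ha] with n ⟨C, h1, h2, h3, h4⟩
    exact (ciInf_le (hbdd n) C).trans_lt (max_lt (max_lt h1 h2) (max_lt h3 h4))
  -- The infimum need not be attained; the vanishing slack `1 / (n + 1)` compensates.
  have hex : ∀ n : ℕ, ∃ C, f n C < (⨅ C, f n C) + 1 / ((n : ℝ) + 1) := fun n =>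
    exists_lt_of_ciInf_lt (lt_add_of_pos_right _ Nat.one_div_pos_of_nat)
  choose C hC using hex
  have hlim : Tendsto (fun n : ℕ => (⨅ C, f n C) + 1 / ((n : ℝ) + 1)) atTop (𝓝 0) := by
    simpa using hinf.add (tendsto_one_div_add_atTop_nhds_zero_nat (𝕜 := ℝ))
  refine ⟨C, fun n => (⨅ C, f n C) + 1 / ((n : ℝ) + 1), ?_, ?_, fun n => ?_, fun n => ?_, hlim⟩
  · rw [tendsto_iff_dist_tendsto_zero]
    exact squeeze_zero (fun _ => dist_nonneg) (fun n =>
      ((le_max_left _ _).trans (le_max_left _ _)).trans (hC n).le) hlim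
  · rw [tendsto_iff_dist_tendsto_zero]
    exact squeeze_zero (fun _ => dist_nonneg) (fun n =>
      ((le_max_right _ _).trans (le_max_left _ _)).trans (hC n).le) hlim
  · exact ((le_max_left _ _).trans (le_max_right _ _)).trans (hC n).le
  · exact ((le_max_right _ _).trans (le_max_right _ _)).trans (hC n).le

variable {W} {leak}

lemma mem_approxAchievable {R : ℝ × ℝ} (h : ∀ δ > 0, ∃ r₁ r₂ : ℝ, 0 ≤ r₁ ∧ 0 ≤ r₂ ∧
    |r₁ - R.1| ≤ δ ∧ |r₂ - R.2| ≤ δ ∧ ∃ B : ℕ → ℝ, Tendsto B atTop (𝓝 0) ∧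
    ∀ n, ∃ C : Code X₁ X₂ Y₁ Y₂ n, C.M₁ = expCeil r₁ n ∧ C.M₂ = expCeil r₂ n ∧
      C.errorProb W ≤ B n ∧ leak C ≤ B n) : R ∈ approxAchievable W leak := by
  intro δ hδ
  obtain ⟨r₁, r₂, h₁, h₂, hd₁, hd₂, B, hB, hC⟩ := h (δ / 2) (by linarith)
  filter_upwards [(tendsto_log_expCeil_div h₁).eventually (Metric.ball_mem_nhds r₁ (half_pos hδ)),
    (tendsto_log_expCeil_div h₂).eventually (Metric.ball_mem_nhds r₂ (half_pos hδ)),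
    hB.eventually_lt_const hδ] with n e₁ e₂ e₃
  obtain ⟨C, hM₁, hM₂, he, hl⟩ := hC n
  rw [Real.dist_eq, ← hM₁] at e₁
  rw [Real.dist_eq, ← hM₂] at e₂
  refine ⟨C, ?_, ?_, he.trans_lt e₃, hl.trans_lt e₃⟩
  · have := abs_sub_le C.rate₁ r₁ R.1
    rw [Code.rate₁] at this ⊢
    linarith
  · have := abs_sub_le C.rate₂ r₂ R.2
    rw [Code.rate₂] at this ⊢
    linarith

end Achievability

/-! ### Choice of message and randomisation rates -/

section Rates

/-- Here `r` and `r'` are the message and randomisation rates, `I` is the decodable rate and `a` is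
the user's own information at the eavesdropper. `T` stands for the pair information `I(V₁, V₂; Z)`.
The last disjunction is tailored to the sum constraints: either `r'` alone exceeds `T`, or `r'` and
`r + r'` are within controlled slack of their ideal values `I - R` and `I`. -/
lemma exists_rate_of_le {R I a T δ : ℝ} (hδ : 0 < δ) (hR : 0 ≤ R) (ha : 0 ≤ a) (h : R ≤ I - a) :
    ∃ r r' : ℝ, 0 ≤ r ∧ 0 ≤ r' ∧ |r - R| ≤ δ ∧ (r = 0 ∨ r + r' < I) ∧ a < r' ∧
      (T < r' ∨ I - R + δ / 2 < r' ∧ I - δ / 2 < r + r') := by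
  by_cases hRδ : R ≤ δ
  -- Rounding a tiny rate down to 0 removes the decodability constraint, so `r'` can exceed both `a`
  -- and `T`. This covers the degenerate case `I = a`.
  · refine ⟨0, |T| + a + 1, le_rfl, by positivity, ?_, Or.inl rfl, ?_, Or.inl ?_⟩
    · rwa [zero_sub, abs_neg, abs_of_nonneg hR]
    · linarith [abs_nonneg T]
    · linarith [le_abs_self T]
  · have hRδ' := not_le.1 hRδ
    -- The total `I - δ / 4` lies strictly between `I - δ / 2` and `I`, while `r'` exceeds `I - R`
    -- by more than `δ / 2`.
    refine ⟨R - δ, I - R + 3 / 4 * δ, by linarith, by linarith, ?_, Or.inr (by linarith),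
      by linarith, Or.inr ⟨by linarith, by linarith⟩⟩
    rw [sub_sub_cancel_left, abs_neg, abs_of_pos hδ]

end Rates

/-! ### The convex hulls of the single-letter regions -/

section Hull

variable {X₁ X₂ Y₁ Y₂ Z : Type*}
variable [Fintype X₁] [Fintype X₂] [Fintype Y₁] [Fintype Y₂] [Fintype Z]
variable {W : Channel X₁ X₂ Y₁ Y₂ Z}

lemma exists_ensemble_of_mem {k₁ k₂ : ℕ} {P : Fin k₁ × Fin k₂ × X₁ × X₂ → ℝ}
    (hP : P ∈ productLaws (Fin k₁) (Fin k₂) X₁ X₂) {S : ∀ {k₁ k₂ : ℕ},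
      (Fin k₁ × Fin k₂ × X₁ × X₂ → ℝ) → Set (ℝ × ℝ)} {z : ℝ × ℝ} (hz : z ∈ S P) :
    ∃ E : Ensemble X₁ X₂, z ∈ S E.joint := by
  obtain ⟨p₁, e₁, p₂, e₂, h⟩ := hP
  refine ⟨⟨k₁, k₂, p₁, e₁, p₂, e₂⟩, ?_⟩
  convert hz using 2
  ext ⟨v₁, v₂, x₁, x₂⟩
  exact (h v₁ v₂ x₁ x₂).symm

lemma exists_ensembles_of_mem_convexHull {S : ∀ {k₁ k₂ : ℕ},
      (Fin k₁ × Fin k₂ × X₁ × X₂ → ℝ) → Set (ℝ × ℝ)} {R : ℝ × ℝ}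
    (hR : R ∈ convexHull ℝ (⋃ (k₁ : ℕ) (k₂ : ℕ),
      ⋃ P ∈ productLaws (Fin k₁) (Fin k₂) X₁ X₂, S P)) :
    ∃ (J : Type) (_ : Fintype J) (w : stdSimplex ℝ J) (E : J → Ensemble X₁ X₂) (z : J → ℝ × ℝ),
      (∀ j, z j ∈ S (E j).joint) ∧ ∑ j, w.1 j * (z j).1 = R.1 ∧ ∑ j, w.1 j * (z j).2 = R.2 := by
  obtain ⟨J, _, w, z, hw0, hw1, hz, rfl⟩ := mem_convexHull_iff_exists_fintype.1 hR
  have hE : ∀ j, ∃ E : Ensemble X₁ X₂, z j ∈ S E.joint := by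
    intro j
    have := hz j
    simp only [Set.mem_iUnion] at this
    obtain ⟨k₁, k₂, P, hP, hzP⟩ := this
    exact exists_ensemble_of_mem hP hzP
  choose E hE using hE
  refine ⟨J, _, ⟨w, hw0, hw1⟩, E, z, hE, ?_, ?_⟩
  · simp [Prod.fst_sum]
  · simp [Prod.snd_sum]

variable {J : Type} [Fintype J] (w : stdSimplex ℝ J)

lemma sum_mul_le_sum_mul {f g : J → ℝ} (h : ∀ j, f j ≤ g j) :
    ∑ j, w.1 j * f j ≤ ∑ j, w.1 j * g j :=
  Finset.sum_le_sum fun j _ => mul_le_mul_of_nonneg_left (h j) (w.2.1 j)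

lemma sum_mul_nonneg {f : J → ℝ} (h : ∀ j, 0 ≤ f j) : 0 ≤ ∑ j, w.1 j * f j :=
  Finset.sum_nonneg fun j _ => mul_nonneg (w.2.1 j) (h j)

lemma Ensemble.infoZV₁_nonneg (E : Ensemble X₁ X₂) : 0 ≤ infoZV₁ W E.joint := by
  rw [E.infoZV₁_joint]
  exact channelInfo_nonneg E.p₁.2.1 E.p₁.2.2 (E.leftChannel_nonneg W) (E.sum_leftChannel W)

lemma Ensemble.infoZV₂_nonneg (E : Ensemble X₁ X₂) : 0 ≤ infoZV₂ W E.joint := by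
  rw [E.infoZV₂_joint]
  exact channelInfo_nonneg E.p₂.2.1 E.p₂.2.2 (E.rightChannel_nonneg W) (E.sum_rightChannel W)

theorem convexHull_regionJAt_subset :
    convexHull ℝ (⋃ (k₁ : ℕ) (k₂ : ℕ), ⋃ P ∈ productLaws (Fin k₁) (Fin k₂) X₁ X₂,
      regionJAt W P) ⊆ approxAchievable W fun C => C.leakJoint W := by
  intro R hR
  obtain ⟨J, _, w, E, z, hz, hR₁, hR₂⟩ :=
    exists_ensembles_of_mem_convexHull (S := fun P => regionJAt W P) hR
  -- The constraints are linear in the rates and the informations, so they survive averaging over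
  -- the points of the convex combination.
  have b₁ := sum_mul_le_sum_mul w fun j => (hz j).2.2.1
  have b₂ := sum_mul_le_sum_mul w fun j => (hz j).2.2.2.1
  have b₃ := sum_mul_le_sum_mul w fun j => (hz j).2.2.2.2
  have n₁ := sum_mul_nonneg w fun j => (hz j).1
  have n₂ := sum_mul_nonneg w fun j => (hz j).2.1
  have a₁ := sum_mul_nonneg w fun j => (E j).infoZV₁_nonneg (W := W)
  have a₂ := sum_mul_nonneg w fun j => (E j).infoZV₂_nonneg (W := W)
  simp only [mul_add, mul_sub, Finset.sum_add_distrib, Finset.sum_sub_distrib, hR₁, hR₂]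
    at b₁ b₂ b₃ n₁ n₂
  refine mem_approxAchievable fun δ hδ => ?_
  obtain ⟨r₁, r₁', h₁, h₁', d₁, e₁, l₁, t₁⟩ := exists_rate_of_le
    (T := ∑ j, w.1 j * infoV₁V₂Z W (E j).joint) hδ n₁ a₁ b₁
  obtain ⟨r₂, r₂', h₂, h₂', d₂, e₂, l₂, t₂⟩ := exists_rate_of_le
    (T := ∑ j, w.1 j * infoV₁V₂Z W (E j).joint) hδ n₂ a₂ b₂
  refine ⟨r₁, r₂, h₁, h₂, d₁, d₂, exists_codes_joint W E w h₁ h₁' h₂ h₂' e₁ e₂ l₁ l₂ ?_⟩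
  -- Unless one randomisation rate alone exceeds the pair information, the two slacks `δ / 2` add up
  -- to make the averaged sum-rate constraint strict.
  rcases t₁ with t₁ | t₁ <;> rcases t₂ with t₂ | t₂ <;> linarith

theorem convexHull_regionIAt_subset :
    convexHull ℝ (⋃ (k₁ : ℕ) (k₂ : ℕ), ⋃ P ∈ productLaws (Fin k₁) (Fin k₂) X₁ X₂,
      regionIAt W P) ⊆ approxAchievable W fun C => max (C.leak₁ W) (C.leak₂ W) := by
  intro R hR
  obtain ⟨J, _, w, E, z, hz, hR₁, hR₂⟩ :=
    exists_ensembles_of_mem_convexHull (S := fun P => regionIAt W P) hR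
  have b₁ := sum_mul_le_sum_mul w fun j => (hz j).2.2.1
  have b₂ := sum_mul_le_sum_mul w fun j => (hz j).2.2.2.1
  have b₃ := sum_mul_le_sum_mul w fun j => (le_max_left _ _).trans (hz j).2.2.2.2
  have b₄ := sum_mul_le_sum_mul w fun j => (le_max_right _ _).trans (hz j).2.2.2.2
  have n₁ := sum_mul_nonneg w fun j => (hz j).1
  have n₂ := sum_mul_nonneg w fun j => (hz j).2.1
  have a₁ := sum_mul_nonneg w fun j => (E j).infoZV₁_nonneg (W := W)
  have a₂ := sum_mul_nonneg w fun j => (E j).infoZV₂_nonneg (W := W)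
  simp only [mul_add, mul_sub, Finset.sum_add_distrib, Finset.sum_sub_distrib, hR₁, hR₂]
    at b₁ b₂ b₃ b₄ n₁ n₂
  refine mem_approxAchievable fun δ hδ => ?_
  obtain ⟨r₁, r₁', h₁, h₁', d₁, e₁, l₁, t₁⟩ := exists_rate_of_le
    (T := ∑ j, w.1 j * infoV₁V₂Z W (E j).joint) hδ n₁ a₁ b₁
  obtain ⟨r₂, r₂', h₂, h₂', d₂, e₂, l₂, t₂⟩ := exists_rate_of_le
    (T := ∑ j, w.1 j * infoV₁V₂Z W (E j).joint) hδ n₂ a₂ b₂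
  -- In the generic case the surplus `δ / 2` of one user's randomisation rate offsets the deficit `δ
  -- / 2` of the other user's total rate. The two averaged parts of the maximum constraint then give
  -- the two covering conditions.
  have hcodes := exists_codes_individual W E w h₁ h₁' h₂ h₂' e₁ e₂ l₁ l₂
    (by rcases t₁ with t₁ | t₁ <;> rcases t₂ with t₂ | t₂ <;> linarith)
    (by rcases t₁ with t₁ | t₁ <;> rcases t₂ with t₂ | t₂ <;> linarith)
  refine ⟨r₁, r₂, h₁, h₂, d₁, d₂, ?_⟩
  simpa only [max_le_iff] using hcodes

end Hull

end TwoWayWiretap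

end

theorem theorem1 {X₁ X₂ Y₁ Y₂ Z : Type*}
    [Fintype X₁] [Fintype X₂] [Fintype Y₁] [Fintype Y₂] [Fintype Z]
    (W : TwoWayWiretap.Channel X₁ X₂ Y₁ Y₂ Z) :
    TwoWayWiretap.regionJ W ⊆ TwoWayWiretap.capacityJ W ∧
      TwoWayWiretap.regionI W ⊆ TwoWayWiretap.capacityI W := by
  open TwoWayWiretap in
  constructor
  · intro R hR
    obtain ⟨C, ε, h₁, h₂, he, hl, hε⟩ := exists_codes_of_mem_approxAchievable W _
      (closure_subset_approxAchievable W _ convexHull_regionJAt_subset hR)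
    exact ⟨C, ε, ε, h₁, h₂, he, hl, hε, hε⟩
  · intro R hR
    obtain ⟨C, ε, h₁, h₂, he, hl, hε⟩ := exists_codes_of_mem_approxAchievable W _
      (closure_subset_approxAchievable W _ convexHull_regionIAt_subset hR)
    exact ⟨C, ε, ε, h₁, h₂, he, fun n => (max_le_iff.1 (hl n)).1,
      fun n => (max_le_iff.1 (hl n)).2, hε, hε⟩
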